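/- Let $\rho\ge 2$, $s>\tfrac12$, and let $L$ be the Fourier multiplier on $\mathbb R$ with a measurable, even, real symbol $l$ (in the angular frequency $\xi$, so that $\partial_x$ has symbol $i\xi$) satisfying $c_1^2(1+\xi^2)^{\rho/2}\le l(\xi)\le c_2^2(1+\xi^2)^{\rho/2}$ for all $\xi\in\mathbb R$, with constants $c_1,c_2>0$. Let $K=L^{1/2}$ be the multiplier with symbol $\sqrt{l(\xi)}$, let $\Lambda^{-1}$ be the multiplier with symbol $|\xi|^{-1}$, and let $\|\cdot\|$, $\|\cdot\|_\sigma$ be the norms of $L^2(\mathbb R)$ and $H^\sigma(\mathbb R)$. Let $g\in C^{[s]+1}(\mathbb R)$ be real valued, where $[s]$ is the integer part of $s$, and let $G(p)=\int_0^p g(q)\,dq$. Consider the Cauchy problem $$u_{tt}-Lu_{xx}=(g(u))_{xx}\quad (x\in\mathbb R,\ t>0),\qquad u(x,0)=\varphi(x),\quad u_t(x,0)=\psi(x),$$ with real $\varphi\in H^s(\mathbb R)$ and real $\psi\in H^{s-1-\rho/2}(\mathbb R)$. A solution on $[0,T)$ is a real valued $u\in C([0,T),H^s)\cap C^1([0,T),H^{s-1-\rho/2})$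 with the given initial data which satisfies the equation in the sense of tempered distributions on $\mathbb R$ for every $t\in[0,T)$. **Theorem 5.2.** Suppose that $K\varphi\in L^2$, $\Lambda^{-1}\varphi\in L^2$, $\Lambda^{-1}\psi\in L^2$ and $G(\varphi)\in L^1$, that for some $\nu>0$ $$p\,g(p)\le 2(1+2\nu)\,G(p)\qquad\text{for all }p\in\mathbb R,$$ and that $$E(0)=\|\Lambda^{-1}\psi\|^2+\|K\varphi\|^2+2\int_{\mathbb R}G(\varphi)\,dx<0 .$$ Then the solution blows up in finite time: there are a finite $T_{\max}>0$ and a solution $u$ on $[0,T_{\max})$ such that every solution on an interval $[0,T')$ with $T'>0$ satisfies $T'\le T_{\max}$ and coincides with $u$ on $[0,T')$, and $$\limsup_{t\to T_{\max}^-}\bigl[\|u(t)\|_s+\|u_t(t)\|_{s-1-\rho/2}\bigr]=\infty .$$ -/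

import Mathlib

open MeasureTheory Filter Topology Set
open scoped FourierTransform SchwartzMap ENNReal

noncomputable section

/-- The real Hilbert space `L²(ℝ)` of real valued functions. -/
abbrev RealL2 : Type := Lp ℝ 2 (volume : Measure ℝ)

/-- The Hilbert space `L²(ℝ)` of complex valued functions. -/
abbrev ComplexL2 : Type := Lp ℂ 2 (volume : Measure ℝ)

namespace RealL2

/-- A real `L²` function, regarded as a complex valued one. -/
def toComplex (f : RealL2) : ComplexL2 := Complex.ofRealCLM.compLp f

/-- A real `L²` function, regarded as a tempered distribution. -/
def toDist (f : RealL2) : 𝓢'(ℝ, ℂ) := Lp.toTemperedDistribution f.toComplex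

end RealL2

/-- The Fourier transform of the tempered distribution `f` is the function `F`. Here, as everywhere
in Mathlib, the Fourier transform is the unitary one with kernel `exp (-2 π i x ξ)`. -/
def HasFourier (f : 𝓢'(ℝ, ℂ)) (F : ℝ → ℂ) : Prop :=
  ∀ θ : 𝓢(ℝ, ℂ), Integrable (fun ξ => F ξ * θ ξ) ∧ (𝓕 f) θ = ∫ ξ, F ξ * θ ξ

/-- `w = m(D) f`, where `w` is in `L²` and `m(D)` is the Fourier multiplier with symbol `m`.
The symbol is a function of the angular frequency `2 π ξ`, so that `∂ₓ` has symbol `i η`. As `w`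
is in `L²`, the assertion is that `m(D) f` exists and lies in `L²`. -/
def IsMultiplierL2 (m : ℝ → ℝ) (f : 𝓢'(ℝ, ℂ)) (w : ComplexL2) : Prop :=
  ∃ F : ℝ → ℂ, HasFourier f F ∧
    ((𝓕 w : ComplexL2) : ℝ → ℂ) =ᵐ[volume] fun ξ => (m (2 * Real.pi * ξ) : ℂ) * F ξ

/-- The symbol `(1 + η²)^(σ/2)` which defines the Sobolev space `H^σ`. -/
def besselSymbol (σ : ℝ) (η : ℝ) : ℝ := (1 + η ^ 2) ^ (σ / 2)

/-- The symbol `|η|⁻¹` of the operator `Λ⁻¹`. -/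
def lambdaInvSymbol (η : ℝ) : ℝ := |η|⁻¹

/-- The symbol `√l` of the operator `K = L^{1/2}`. -/
def sqrtSymbol (l : ℝ → ℝ) (η : ℝ) : ℝ := Real.sqrt (l η)

/-- `f` belongs to the Sobolev space `H^σ(ℝ)`. -/
def MemH (σ : ℝ) (f : 𝓢'(ℝ, ℂ)) : Prop :=
  ∃ w : ComplexL2, IsMultiplierL2 (besselSymbol σ) f w

/-- The norm `‖f‖_σ` of `H^σ(ℝ)`; it is `∞` if `f` is not in `H^σ(ℝ)`. -/
def normH (σ : ℝ) (f : 𝓢'(ℝ, ℂ)) : ℝ≥0∞ :=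
  ⨅ (w : ComplexL2) (_ : IsMultiplierL2 (besselSymbol σ) f w), ‖w‖ₑ

/-- A tempered distribution is real if it takes real values at real test functions. -/
def IsRealDist (f : 𝓢'(ℝ, ℂ)) : Prop :=
  ∀ θ : 𝓢(ℝ, ℂ), (∀ x, (θ x).im = 0) → (f θ).im = 0

/-- The pairing `⟨(L f)_{xx}, θ⟩`, where `L` has symbol `l`: the Fourier transform of `(L f)_{xx}`
is `-η² l(η)`, `η = 2 π ξ`, times that of `f`, and `⟨h, θ⟩ = ⟨𝓕 h, 𝓕⁻ θ⟩`. -/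
def pairLxx (l : ℝ → ℝ) (f : RealL2) (θ : 𝓢(ℝ, ℂ)) : ℂ :=
  ∫ ξ, ((-(2 * Real.pi * ξ) ^ 2 * l (2 * Real.pi * ξ) : ℝ) : ℂ)
    * (𝓕 f.toComplex : ComplexL2) ξ * (𝓕⁻ θ) ξ

/-- The pairing `⟨(g(f))_{xx}, θ⟩ = ∫ g(f(x)) θ''(x) dx`. -/
def pairGxx (g : ℝ → ℝ) (f : RealL2) (θ : 𝓢(ℝ, ℂ)) : ℂ :=
  ∫ x, (g (f x) : ℂ) * iteratedDeriv 2 θ x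

/-- `u`, with time derivative `v`, is a real solution of the Cauchy problem
`u_tt - L u_xx = (g(u))_xx`, `u(0) = φ`, `u_t(0) = ψ` in
`C([0,T), H^s) ∩ C¹([0,T), H^{s-1-ρ/2})`. The equation holds in the sense of tempered
distributions, for every `t` in `[0,T)`. Values of `u`, `v` outside `[0,T)` play no role. -/
structure IsSolution (ρ s : ℝ) (l g : ℝ → ℝ) (φ : RealL2) (ψ : 𝓢'(ℝ, ℂ)) (T : ℝ)
    (u : ℝ → RealL2) (v : ℝ → 𝓢'(ℝ, ℂ)) : Prop where
  mem_u : ∀ t ∈ Ico 0 T, MemH s (u t).toDist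
  mem_v : ∀ t ∈ Ico 0 T, MemH (s - 1 - ρ / 2) (v t)
  continuous_u : ∀ t ∈ Ico 0 T,
    Tendsto (fun τ => normH s ((u τ).toDist - (u t).toDist)) (𝓝[Ico 0 T] t) (𝓝 0)
  continuous_v : ∀ t ∈ Ico 0 T,
    Tendsto (fun τ => normH (s - 1 - ρ / 2) (v τ - v t)) (𝓝[Ico 0 T] t) (𝓝 0)
  deriv_u : ∀ t ∈ Ico 0 T,
    Tendsto (fun τ => normH (s - 1 - ρ / 2)
      ((((τ - t)⁻¹ : ℝ) : ℂ) • ((u τ).toDist - (u t).toDist) - v t))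
      (𝓝[Ico 0 T \ {t}] t) (𝓝 0)
  equation : ∀ θ : 𝓢(ℝ, ℂ), ∀ t ∈ Ico 0 T,
    HasDerivWithinAt (fun τ => v τ θ) (pairLxx l (u t) θ + pairGxx g (u t) θ) (Ico 0 T) t
  initial_u : u 0 = φ
  initial_v : v 0 = ψ

/-- `u`, with time derivative `v`, is the solution of the Cauchy problem, its maximal interval of
existence is `[0,T)`, `T < ∞`, and its norm is unbounded as `t → T`:
every solution on an interval `[0,T')` is a restriction of `u`, and
`limsup_{t → T-} (‖u(t)‖_s + ‖u_t(t)‖_{s-1-ρ/2}) = ∞`. -/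
structure BlowsUpAt (ρ s : ℝ) (l g : ℝ → ℝ) (φ : RealL2) (ψ : 𝓢'(ℝ, ℂ)) (T : ℝ)
    (u : ℝ → RealL2) (v : ℝ → 𝓢'(ℝ, ℂ)) : Prop where
  pos : 0 < T
  solution : IsSolution ρ s l g φ ψ T u v
  maximal : ∀ (T' : ℝ) (u' : ℝ → RealL2) (v' : ℝ → 𝓢'(ℝ, ℂ)), 0 < T' →
    IsSolution ρ s l g φ ψ T' u' v' → T' ≤ T ∧ ∀ t ∈ Ico 0 T', u' t = u t ∧ v' t = v t
  limsup_norm :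
    limsup (fun t => normH s (u t).toDist + normH (s - 1 - ρ / 2) (v t)) (𝓝[<] T) = ⊤

/-- The primitive `G(p) = ∫₀ᵖ g`. -/
def primitiveG (g : ℝ → ℝ) (p : ℝ) : ℝ := ∫ q in (0 : ℝ)..p, g q

end

/-!
# Blow up for `u_tt - L u_xx = (g(u))_xx` with negative energy

The idea is Levine's. The energy `E = ‖Λ⁻¹ u_t‖² + ‖K u‖² + 2 ∫ G(u)` is conserved. If it is
negative, then with `β = -E` the functional `H(t) = ‖Λ⁻¹ u‖² + β (t + t₀)²` satisfies
`(1 + ν) H'² ≤ H H''` by the condition `p g(p) ≤ 2 (1 + 2 ν) G(p)`, so that `H^{-ν}` is concave, and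
it would reach `0` in finite time (`levine_bound`, `WaveData.exists_time_bound`). Hence no solution
is global. What remains is a local theory in which a solution can be continued as long as its norm
is bounded.

For this, the equation is diagonalized on the Fourier side. With `v = u_t` and `ω = |η| √l`, the
unknown `y = (1 + η²)^{-1/2} (√l û + i |η|⁻¹ v̂)` satisfies `y' = -i ω y + N(y)`, and
`W = exp (i t ω) y` satisfies an ordinary differential equation `W' = Φ(t, W)` whose field contains
no unbounded operator. One complex valued unknown encodes both `u` and `v`, because these are real.
The field is Lipschitz continuous in `L²` on bounded sets of the Sobolev space of order `κ + 1`,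
`κ = max (s - ρ/2) 0`, and maps them to bounded sets (`WaveData.tameField`). The latter rests on the
theorem that composition with a `C^n` function which vanishes at `0` is bounded on bounded sets of
`H^r` for `1 ≤ r ≤ n` (`exists_compR_mem_sobBall`), which is proved by induction on `n` from the
product estimate `H^r · H^a ⊆ H^a` (`exists_product_mem_sobBall`) and, for `r = 1`, from difference
quotients. That `g` vanishes at `0` follows from the condition on `g` (`apply_zero_of_le`). For a
field of this kind, called tame here, the differential equation is solved in `L²` after truncation
by the projection onto a closed ball of the Sobolev space, and the maximal solution is unbounded in
that space if its existence time is finite (`exists_maximal_isSol`).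

Trajectories are differentiable in `L²`, but not in the norm in which the energy is defined. There
they are Lipschitz continuous and weakly differentiable, which is enough to differentiate the square
of the norm, as the group `exp (i t ω)` is unitary; the potential energy is differentiated by
interpolation between `H⁻¹` and `H¹`. This gives conservation of energy (`WaveData.energy_eq`).

A trajectory gives a solution in the sense of distributions (`WaveData.isSolution`). As the bound of
the nonlinear term in the Sobolev space of order `κ + 1` is linear as long as `u` is bounded in
`H^s`, Grönwall's inequality shows that the trajectory stays bounded if `u` does (`IsSol.growth`);
so the norm of the solution is unbounded at the end of the maximal interval
(`WaveData.limsup_eq_top`). Finally, an arbitrary solution in the sense of distributions need not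
come from a trajectory. The difference of two of them solves the linear wave equation with a source
bounded by the difference itself, and an energy estimate in a weak norm, truncated in frequency,
shows that it vanishes (`WaveData.eq_zero_of_energy`, `WaveData.isSolution_unique`). Since the norm
of a solution is bounded on compact intervals, no solution exists beyond the maximal interval
(`WaveData.blowsUpAt`).
-/

noncomputable section

/-! ### Fourier multipliers on `L²` -/

/-- The symbol `(1 + η²)^(σ/2)` as a function of the frequency `ξ`, where `η = 2 π ξ`. -/
def jb (σ ξ : ℝ) : ℝ := besselSymbol σ (2 * Real.pi * ξ)

lemma jb_base_one_le (ξ : ℝ) : (1 : ℝ) ≤ 1 + (2 * Real.pi * ξ) ^ 2 := by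
  nlinarith [sq_nonneg (2 * Real.pi * ξ)]

lemma jb_pos (σ ξ : ℝ) : 0 < jb σ ξ :=
  Real.rpow_pos_of_pos (lt_of_lt_of_le one_pos (jb_base_one_le ξ)) _

lemma jb_ne (σ ξ : ℝ) : jb σ ξ ≠ 0 := (jb_pos σ ξ).ne'

lemma jb_add (σ τ ξ : ℝ) : jb (σ + τ) ξ = jb σ ξ * jb τ ξ := by
  unfold jb besselSymbol
  rw [add_div, Real.rpow_add (lt_of_lt_of_le one_pos (jb_base_one_le ξ))]

@[simp] lemma jb_zero (ξ : ℝ) : jb 0 ξ = 1 := by simp [jb, besselSymbol]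

lemma jb_mono {σ τ : ℝ} (h : σ ≤ τ) (ξ : ℝ) : jb σ ξ ≤ jb τ ξ :=
  Real.rpow_le_rpow_of_exponent_le (jb_base_one_le ξ) (by linarith)

lemma one_le_jb {σ : ℝ} (h : 0 ≤ σ) (ξ : ℝ) : 1 ≤ jb σ ξ := by
  simpa using jb_mono h ξ

lemma jb_le_one {σ : ℝ} (h : σ ≤ 0) (ξ : ℝ) : jb σ ξ ≤ 1 := by
  simpa using jb_mono h ξ

lemma jb_two (ξ : ℝ) : jb 2 ξ = 1 + (2 * Real.pi * ξ) ^ 2 := by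
  simp [jb, besselSymbol]

lemma jb_one_sq (ξ : ℝ) : jb 1 ξ ^ 2 = 1 + (2 * Real.pi * ξ) ^ 2 := by
  rw [← jb_two, sq, ← jb_add]; norm_num

lemma abs_le_jb_one (ξ : ℝ) : |2 * Real.pi * ξ| ≤ jb 1 ξ := by
  apply abs_le_of_sq_le_sq _ (jb_pos 1 ξ).le
  rw [jb_one_sq]; linarith

lemma jb_one_le (ξ : ℝ) : jb 1 ξ ≤ 1 + |2 * Real.pi * ξ| := by
  apply le_of_sq_le_sq _ (by positivity)
  rw [jb_one_sq, add_sq, sq_abs]; nlinarith [abs_nonneg (2 * Real.pi * ξ)]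

@[simp] lemma jb_even (σ ξ : ℝ) : jb σ (-ξ) = jb σ ξ := by
  simp [jb, besselSymbol]

@[fun_prop] lemma continuous_jb (σ : ℝ) : Continuous (jb σ) := by
  unfold jb besselSymbol
  refine Continuous.rpow_const (by fun_prop) fun ξ => Or.inl ?_
  exact (lt_of_lt_of_le one_pos (jb_base_one_le ξ)).ne'

@[fun_prop] lemma measurable_jb (σ : ℝ) : Measurable (jb σ) := (continuous_jb σ).measurable

lemma jb_rpow (σ ξ : ℝ) : jb σ ξ = (1 + (2 * Real.pi * ξ) ^ 2) ^ (σ / 2) := rfl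

/-- A bounded measurable symbol. -/
def BddSym (m : ℝ → ℂ) : Prop := Measurable m ∧ ∃ C, ∀ ξ, ‖m ξ‖ ≤ C

lemma BddSym.mk' {m : ℝ → ℂ} (h : Measurable m) {C : ℝ} (hC : ∀ ξ, ‖m ξ‖ ≤ C) : BddSym m :=
  ⟨h, C, hC⟩

lemma BddSym.memLp {m : ℝ → ℂ} (h : BddSym m) (F : ComplexL2) :
    MemLp (fun ξ => m ξ * F ξ) 2 volume := by
  obtain ⟨hm, C, hC⟩ := h
  refine (Lp.memLp F).of_le_mul (c := C)
    (hm.aestronglyMeasurable.mul (Lp.memLp F).1) (ae_of_all _ fun ξ => ?_)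
  rw [norm_mul]
  exact mul_le_mul_of_nonneg_right (hC ξ) (norm_nonneg _)

lemma BddSym.mul {m n : ℝ → ℂ} (hm : BddSym m) (hn : BddSym n) :
    BddSym (fun ξ => m ξ * n ξ) := by
  obtain ⟨hm, C, hC⟩ := hm
  obtain ⟨hn, D, hD⟩ := hn
  refine ⟨hm.mul hn, C * D, fun ξ => ?_⟩
  rw [norm_mul]
  exact mul_le_mul (hC ξ) (hD ξ) (norm_nonneg _) ((norm_nonneg _).trans (hC ξ))

lemma BddSym.add {m n : ℝ → ℂ} (hm : BddSym m) (hn : BddSym n) :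
    BddSym (fun ξ => m ξ + n ξ) := by
  obtain ⟨hm, C, hC⟩ := hm
  obtain ⟨hn, D, hD⟩ := hn
  exact ⟨hm.add hn, C + D, fun ξ => (norm_add_le _ _).trans (add_le_add (hC ξ) (hD ξ))⟩

lemma norm_le_of_ae_le {F G : ComplexL2} {C : ℝ}
    (h : ∀ᵐ ξ, ‖F ξ‖ ≤ C * ‖G ξ‖) : ‖F‖ ≤ C * ‖G‖ :=
  Lp.norm_le_mul_norm_of_ae_le_mul h

open Classical in
/-- Multiplication by the bounded measurable symbol `m` on `L²`; the junk value is `0`. -/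
def mulL2 (m : ℝ → ℂ) : ComplexL2 →L[ℂ] ComplexL2 :=
  if h : BddSym m then
    LinearMap.mkContinuous
      { toFun := fun F => (h.memLp F).toLp
        map_add' := fun F G => by
          rw [← MemLp.toLp_add]
          apply MemLp.toLp_congr
          filter_upwards [Lp.coeFn_add F G] with ξ h1
          change m ξ * (F + G : ComplexL2) ξ = m ξ * F ξ + m ξ * G ξ
          rw [h1, Pi.add_apply, mul_add]
        map_smul' := fun c F => by
          rw [RingHom.id_apply, ← MemLp.toLp_const_smul]
          apply MemLp.toLp_congr
          filter_upwards [Lp.coeFn_smul c F] with ξ h1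
          change m ξ * (c • F : ComplexL2) ξ = c * (m ξ * F ξ)
          rw [h1, Pi.smul_apply, smul_eq_mul]; ring }
      (max h.2.choose 0) (fun F => by
        apply norm_le_of_ae_le
        filter_upwards [(h.memLp F).coeFn_toLp] with ξ h1
        rw [LinearMap.coe_mk, AddHom.coe_mk, h1, norm_mul]
        exact mul_le_mul_of_nonneg_right
          ((h.2.choose_spec ξ).trans (le_max_left _ _)) (norm_nonneg _))
  else 0

lemma mulL2_coe {m : ℝ → ℂ} (h : BddSym m) (F : ComplexL2) :
    mulL2 m F =ᵐ[volume] fun ξ => m ξ * F ξ := by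
  rw [mulL2, dif_pos h]
  exact (h.memLp F).coeFn_toLp

lemma mulL2_norm_le {m : ℝ → ℂ} (hm : Measurable m) {C : ℝ} (hC : ∀ ξ, ‖m ξ‖ ≤ C)
    (F : ComplexL2) : ‖mulL2 m F‖ ≤ C * ‖F‖ := by
  apply norm_le_of_ae_le
  filter_upwards [mulL2_coe (BddSym.mk' hm hC) F] with ξ h1
  rw [h1, norm_mul]
  exact mul_le_mul_of_nonneg_right (hC ξ) (norm_nonneg _)

lemma mulL2_mul {m n : ℝ → ℂ} (hm : BddSym m) (hn : BddSym n) (F : ComplexL2) :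
    mulL2 m (mulL2 n F) = mulL2 (fun ξ => m ξ * n ξ) F := by
  apply Lp.ext
  filter_upwards [mulL2_coe hm (mulL2 n F), mulL2_coe hn F, mulL2_coe (hm.mul hn) F] with ξ h1 h2 h3
  rw [h1, h2, h3, mul_assoc]

lemma mulL2_add_sym {m n : ℝ → ℂ} (hm : BddSym m) (hn : BddSym n) (F : ComplexL2) :
    mulL2 (fun ξ => m ξ + n ξ) F = mulL2 m F + mulL2 n F := by
  apply Lp.ext
  filter_upwards [mulL2_coe hm F, mulL2_coe hn F, mulL2_coe (hm.add hn) F,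
    Lp.coeFn_add (mulL2 m F) (mulL2 n F)] with ξ h1 h2 h3 h4
  rw [h3, h4, Pi.add_apply, h1, h2, add_mul]

lemma mulL2_one (F : ComplexL2) : mulL2 (fun _ => 1) F = F := by
  apply Lp.ext
  filter_upwards [mulL2_coe (m := fun _ => 1) ⟨measurable_const, 1, by simp⟩ F] with ξ h1
  rw [h1, one_mul]

lemma mulL2_congr {m n : ℝ → ℂ} (h : ∀ ξ, m ξ = n ξ) : mulL2 m = mulL2 n := by
  rw [funext h]

lemma mulL2_norm_eq {m : ℝ → ℂ} (hm : Measurable m) (h1 : ∀ ξ, ‖m ξ‖ = 1) (F : ComplexL2) :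
    ‖mulL2 m F‖ = ‖F‖ := by
  rw [Lp.norm_def, Lp.norm_def]
  congr 1
  apply eLpNorm_congr_norm_ae
  filter_upwards [mulL2_coe (BddSym.mk' hm fun ξ => (h1 ξ).le) F] with ξ h2
  rw [h2, norm_mul, h1, one_mul]

/-- Multiplication by a bounded real symbol. -/
def mulR (b : ℝ → ℝ) : ComplexL2 →L[ℂ] ComplexL2 := mulL2 fun ξ => (b ξ : ℂ)

/-- A bounded measurable real symbol. -/
def BddR (b : ℝ → ℝ) : Prop := Measurable b ∧ ∃ C, ∀ ξ, |b ξ| ≤ C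

lemma BddR.sym {b : ℝ → ℝ} (h : BddR b) : BddSym fun ξ => (b ξ : ℂ) := by
  obtain ⟨h, C, hC⟩ := h
  exact ⟨Complex.measurable_ofReal.comp h, C, fun ξ => by simpa using hC ξ⟩

lemma BddR.mul {b c : ℝ → ℝ} (hb : BddR b) (hc : BddR c) : BddR fun ξ => b ξ * c ξ := by
  obtain ⟨hm, C, hC⟩ := hb
  obtain ⟨hn, D, hD⟩ := hc
  refine ⟨hm.mul hn, C * D, fun ξ => ?_⟩
  rw [abs_mul]
  exact mul_le_mul (hC ξ) (hD ξ) (abs_nonneg _) ((abs_nonneg _).trans (hC ξ))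

lemma BddR.of_le {b c : ℝ → ℝ} (hc : BddR c) (hb : Measurable b) (h : ∀ ξ, |b ξ| ≤ |c ξ|) :
    BddR b := by
  obtain ⟨_, D, hD⟩ := hc
  exact ⟨hb, D, fun ξ => (h ξ).trans (hD ξ)⟩

lemma bddR_jb {σ : ℝ} (h : σ ≤ 0) : BddR (jb σ) :=
  ⟨measurable_jb σ, 1, fun ξ => by rw [abs_of_pos (jb_pos _ _)]; exact jb_le_one h ξ⟩

lemma mulR_coe {b : ℝ → ℝ} (h : BddR b) (F : ComplexL2) :
    mulR b F =ᵐ[volume] fun ξ => (b ξ : ℂ) * F ξ := mulL2_coe h.sym F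

lemma mulR_norm_le {b : ℝ → ℝ} (hb : Measurable b) {C : ℝ} (hC : ∀ ξ, |b ξ| ≤ C)
    (F : ComplexL2) : ‖mulR b F‖ ≤ C * ‖F‖ :=
  mulL2_norm_le (Complex.measurable_ofReal.comp hb) (fun ξ => by simpa using hC ξ) F

lemma mulR_mulR {b c : ℝ → ℝ} (hb : BddR b) (hc : BddR c) (F : ComplexL2) :
    mulR b (mulR c F) = mulR (fun ξ => b ξ * c ξ) F := by
  unfold mulR
  rw [mulL2_mul hb.sym hc.sym]
  exact congrFun (congrArg _ (mulL2_congr fun ξ => by push_cast; rfl)) F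

lemma mulR_congr {b c : ℝ → ℝ} (h : ∀ ξ, b ξ = c ξ) : mulR b = mulR c := by
  rw [funext h]

lemma mulR_one (F : ComplexL2) : mulR (fun _ => 1) F = F := by
  unfold mulR
  simpa using mulL2_one F

lemma mulR_comm {b : ℝ → ℝ} {m : ℝ → ℂ} (hb : BddR b) (hm : BddSym m) (F : ComplexL2) :
    mulR b (mulL2 m F) = mulL2 m (mulR b F) := by
  unfold mulR
  rw [mulL2_mul hb.sym hm, mulL2_mul hm hb.sym]
  exact congrFun (congrArg _ (mulL2_congr fun ξ => mul_comm _ _)) F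

lemma inner_mulR {b : ℝ → ℝ} (hb : BddR b) (F G : ComplexL2) :
    inner ℝ (mulR b F) G = inner ℝ F (mulR b G) := by
  rw [L2.inner_def, L2.inner_def]
  apply integral_congr_ae
  filter_upwards [mulR_coe hb F, mulR_coe hb G] with ξ h1 h2
  rw [h1, h2]
  simp only [Complex.inner, map_mul, Complex.conj_ofReal]
  congr 1; ring

lemma inner_mulL2_unit {m : ℝ → ℂ} (hm : Measurable m) (h1 : ∀ ξ, ‖m ξ‖ = 1)
    (F G : ComplexL2) : inner ℝ (mulL2 m F) (mulL2 m G) = inner ℝ F G := by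
  rw [L2.inner_def, L2.inner_def]
  apply integral_congr_ae
  have hb : BddSym m := BddSym.mk' hm fun ξ => (h1 ξ).le
  filter_upwards [mulL2_coe hb F, mulL2_coe hb G] with ξ h2 h3
  rw [h2, h3]
  simp only [Complex.inner, map_mul]
  have : (starRingEnd ℂ) (m ξ) * m ξ = 1 := by
    rw [mul_comm, Complex.mul_conj, Complex.normSq_eq_norm_sq, h1]; simp
  congr 1
  linear_combination (starRingEnd ℂ) (F ξ) * (G ξ) * this

/-- Multiplication operators converge strongly if their symbols converge boundedly. -/
lemma tendsto_mulL2 {ι : Type*} {L : Filter ι} [L.IsCountablyGenerated] {m : ι → ℝ → ℂ}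
    {m₀ : ℝ → ℂ} {C : ℝ} (hm : ∀ i, Measurable (m i)) (hm₀ : Measurable m₀)
    (hC : ∀ᶠ i in L, ∀ ξ, ‖m i ξ‖ ≤ C) (hC₀ : ∀ ξ, ‖m₀ ξ‖ ≤ C)
    (h : ∀ ξ, Tendsto (fun i => m i ξ) L (𝓝 (m₀ ξ))) (F : ComplexL2) :
    Tendsto (fun i => mulL2 (m i) F) L (𝓝 (mulL2 m₀ F)) := by
  rw [tendsto_iff_norm_sub_tendsto_zero]
  have hsq : Tendsto (fun i => ∫ ξ, ‖(m i ξ - m₀ ξ) * F ξ‖ ^ 2) L (𝓝 (∫ ξ : ℝ, (0 : ℝ))) := by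
    have hF : Integrable (fun ξ => ‖F ξ‖ ^ 2) := (Lp.memLp F).integrable_norm_pow (by norm_num)
    refine tendsto_integral_filter_of_dominated_convergence
      (fun ξ => (2 * C) ^ 2 * ‖F ξ‖ ^ 2) (Eventually.of_forall fun i => ?_) ?_ (hF.const_mul _) ?_
    · exact ((((hm i).sub hm₀).aestronglyMeasurable.mul (Lp.memLp F).1).norm.pow 2)
    · filter_upwards [hC] with i hi
      refine ae_of_all _ fun ξ => ?_
      rw [norm_mul, mul_pow, norm_mul, norm_pow, norm_pow, norm_norm, norm_norm]
      gcongr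
      calc ‖m i ξ - m₀ ξ‖ ≤ ‖m i ξ‖ + ‖m₀ ξ‖ := norm_sub_le _ _
        _ ≤ 2 * C := by linarith [hi ξ, hC₀ ξ]
    · refine ae_of_all _ fun ξ => ?_
      have h1 : Tendsto (fun i => ‖(m i ξ - m₀ ξ) * F ξ‖ ^ 2) L
          (𝓝 (‖(m₀ ξ - m₀ ξ) * F ξ‖ ^ 2)) :=
        ((((h ξ).sub_const _).mul_const _).norm).pow 2
      simpa using h1
  have hb₀ := BddSym.mk' hm₀ hC₀
  have h3 := (Real.continuous_sqrt.tendsto _).comp hsq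
  simp only [integral_zero, Real.sqrt_zero] at h3
  refine h3.congr' ?_
  filter_upwards [hC] with i hi
  have hbi := BddSym.mk' (hm i) hi
  have h4 : ‖mulL2 (m i) F - mulL2 m₀ F‖ ^ 2 = ∫ ξ, ‖(m i ξ - m₀ ξ) * F ξ‖ ^ 2 := by
    rw [← @inner_self_eq_norm_sq ℝ, L2.inner_def]
    simp only [RCLike.re_to_real]
    apply integral_congr_ae
    filter_upwards [mulL2_coe hbi F, mulL2_coe hb₀ F,
      Lp.coeFn_sub (mulL2 (m i) F) (mulL2 m₀ F)] with ξ h5 h6 h7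
    rw [real_inner_self_eq_norm_sq, h7, Pi.sub_apply, h5, h6, sub_mul]
  simp only [Function.comp_apply]
  rw [← h4, Real.sqrt_sq (norm_nonneg _)]

/-! ### Distributions whose Fourier transform is a function -/

/-- A smooth compactly supported real function as a complex valued Schwartz function. -/
def realTest (g : ℝ → ℝ) (hg : ContDiff ℝ ((⊤ : ℕ∞) : WithTop ℕ∞) g) (hc : HasCompactSupport g)
    : 𝓢(ℝ, ℂ) :=
  HasCompactSupport.toSchwartzMap (f := Complex.ofRealCLM ∘ g) (hc.comp_left rfl)
    (Complex.ofRealCLM.contDiff.comp hg)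

lemma realTest_apply (g : ℝ → ℝ) (hg : ContDiff ℝ ((⊤ : ℕ∞) : WithTop ℕ∞) g)
    (hc : HasCompactSupport g) (x : ℝ) :
    realTest g hg hc x = (g x : ℂ) := rfl

lemma locallyIntegrable_of_schwartz {F : ℝ → ℂ}
    (h : ∀ θ : 𝓢(ℝ, ℂ), Integrable fun ξ => F ξ * θ ξ) : LocallyIntegrable F := by
  intro x
  obtain ⟨b⟩ : Nonempty (ContDiffBump x) := ⟨⟨1, 2, by norm_num, by norm_num⟩⟩
  have hb := h (realTest b b.contDiff b.hasCompactSupport)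
  refine ⟨Metric.closedBall x b.rIn, Metric.closedBall_mem_nhds x b.rIn_pos, ?_⟩
  refine (hb.integrableOn (s := Metric.closedBall x b.rIn)).congr_fun (fun y hy => ?_)
    Metric.isClosed_closedBall.measurableSet
  simp only [realTest_apply, b.one_of_mem_closedBall hy, Complex.ofReal_one, mul_one]

lemma ae_zero_of_realTest {F : ℝ → ℂ} (h : ∀ θ : 𝓢(ℝ, ℂ), Integrable fun ξ => F ξ * θ ξ)
    (h0 : ∀ g hg hc, ∫ ξ, F ξ * realTest g hg hc ξ = 0) : ∀ᵐ ξ, F ξ = 0 := by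
  apply ae_eq_zero_of_integral_contDiff_smul_eq_zero (locallyIntegrable_of_schwartz h)
  intro g hg hc
  rw [← h0 g hg hc]
  congr 1; ext ξ
  rw [realTest_apply, Complex.real_smul, mul_comm]

namespace HasFourier

variable {f f' : 𝓢'(ℝ, ℂ)} {F F' : ℝ → ℂ}

lemma congr_ae (h : HasFourier f F) (hF : F =ᵐ[volume] F') : HasFourier f F' := by
  intro θ
  have : (fun ξ => F ξ * θ ξ) =ᵐ[volume] fun ξ => F' ξ * θ ξ := by
    filter_upwards [hF] with ξ h1; rw [h1]
  exact ⟨(h θ).1.congr this, (h θ).2.trans (integral_congr_ae this)⟩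

lemma locallyIntegrable (h : HasFourier f F) : LocallyIntegrable F :=
  locallyIntegrable_of_schwartz fun θ => (h θ).1

lemma aestronglyMeasurable (h : HasFourier f F) : AEStronglyMeasurable F volume :=
  h.locallyIntegrable.aestronglyMeasurable

lemma sub (h : HasFourier f F) (h' : HasFourier f' F') :
    HasFourier (f - f') (fun ξ => F ξ - F' ξ) := by
  intro θ
  refine ⟨by simpa only [sub_mul] using! (h θ).1.sub (h' θ).1, ?_⟩
  have e : 𝓕 (f - f') θ = 𝓕 f θ - 𝓕 f' θ := rfl
  rw [e, (h θ).2, (h' θ).2, ← integral_sub (h θ).1 (h' θ).1]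
  simp only [sub_mul]

lemma smul (c : ℂ) (h : HasFourier f F) : HasFourier (c • f) (fun ξ => c * F ξ) := by
  intro θ
  refine ⟨by simpa only [mul_assoc] using! (h θ).1.const_mul c, ?_⟩
  have e : 𝓕 (c • f) θ = c * 𝓕 f θ := rfl
  rw [e, (h θ).2, ← integral_const_mul]
  simp only [mul_assoc]

lemma unique (h : HasFourier f F) (h' : HasFourier f F') : F =ᵐ[volume] F' := by
  have hs := h.sub h'
  rw [sub_self] at hs
  have h0 := ae_zero_of_realTest (fun θ => (hs θ).1) (fun g hg hc => by
    rw [← (hs _).2]; rfl)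
  filter_upwards [h0] with ξ h1
  exact sub_eq_zero.1 h1

lemma eq_of_ae (h : HasFourier f F) (h' : HasFourier f' F') (hF : F =ᵐ[volume] F') : f = f' := by
  have h1 : 𝓕 f = 𝓕 f' := by
    ext θ
    rw [(h θ).2, (h' θ).2]
    apply integral_congr_ae
    filter_upwards [hF] with ξ h1; rw [h1]
  have h2 := congrArg (fun x : 𝓢'(ℝ, ℂ) => (𝓕⁻ x : 𝓢'(ℝ, ℂ))) h1
  simpa using h2

end HasFourier

lemma memLp_schwartz (θ : 𝓢(ℝ, ℂ)) : MemLp (θ : ℝ → ℂ) 2 volume := θ.memLp 2 volume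

lemma hasFourier_toTempered (w : ComplexL2) :
    HasFourier (Lp.toTemperedDistribution w) ((𝓕 w : ComplexL2) : ℝ → ℂ) := by
  intro θ
  refine ⟨(Lp.memLp (𝓕 w : ComplexL2)).integrable_mul (memLp_schwartz θ), ?_⟩
  rw [Lp.fourier_toTemperedDistribution_eq, Lp.toTemperedDistribution_apply]
  simp only [smul_eq_mul, mul_comm]

lemma hasFourier_toDist (f : RealL2) :
    HasFourier f.toDist ((𝓕 f.toComplex : ComplexL2) : ℝ → ℂ) :=
  hasFourier_toTempered _

/-- The symbol `1 + η²` as a complex valued function of `ξ`. -/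
def jbTwo (ξ : ℝ) : ℂ := ((1 + (2 * Real.pi * ξ) ^ 2 : ℝ) : ℂ)

lemma jbTwo_temperate : jbTwo.HasTemperateGrowth := by
  unfold jbTwo; fun_prop

/-- The tempered distribution with Fourier transform `(1 + η²) w`, for `w` in `L²`. -/
def distOf (w : ComplexL2) : 𝓢'(ℝ, ℂ) :=
  𝓕⁻ (TemperedDistribution.smulLeftCLM ℂ jbTwo (Lp.toTemperedDistribution w))

lemma hasFourier_distOf (w : ComplexL2) :
    HasFourier (distOf w) (fun ξ => (jb 2 ξ : ℂ) * w ξ) := by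
  intro θ
  have e : ∀ ξ, (jb 2 ξ : ℂ) * w ξ * θ ξ = w ξ * (SchwartzMap.smulLeftCLM ℂ jbTwo θ) ξ := by
    intro ξ
    rw [SchwartzMap.smulLeftCLM_apply_apply jbTwo_temperate, jb_two, jbTwo, smul_eq_mul]
    ring
  simp only [e]
  refine ⟨(Lp.memLp w).integrable_mul (memLp_schwartz _), ?_⟩
  rw [distOf, FourierTransform.fourier_fourierInv_eq, TemperedDistribution.smulLeftCLM_apply_apply,
    Lp.toTemperedDistribution_apply]
  simp only [smul_eq_mul, mul_comm]

lemma isMultiplierL2_iff {m : ℝ → ℝ} {f : 𝓢'(ℝ, ℂ)} {F : ℝ → ℂ} (h : HasFourier f F)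
    {w : ComplexL2} : IsMultiplierL2 m f w ↔
      ((𝓕 w : ComplexL2) : ℝ → ℂ) =ᵐ[volume] fun ξ => (m (2 * Real.pi * ξ) : ℂ) * F ξ := by
  constructor
  · rintro ⟨F', hF', hw⟩
    filter_upwards [hw, h.unique hF'] with ξ h1 h2
    rw [h1, h2]
  · exact fun hw => ⟨F, h, hw⟩

lemma memH_iff {σ : ℝ} {f : 𝓢'(ℝ, ℂ)} {F : ℝ → ℂ} (h : HasFourier f F) :
    MemH σ f ↔ MemLp (fun ξ => (jb σ ξ : ℂ) * F ξ) 2 volume := by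
  constructor
  · rintro ⟨w, hw⟩
    rw [isMultiplierL2_iff h] at hw
    exact (Lp.memLp (𝓕 w : ComplexL2)).ae_eq hw
  · intro hm
    refine ⟨𝓕⁻ hm.toLp, ?_⟩
    rw [isMultiplierL2_iff h, FourierTransform.fourier_fourierInv_eq]
    exact hm.coeFn_toLp

/-- At most one `w` enters the infimum in the definition of `normH`, because the Fourier transform
of a distribution is determined almost everywhere. -/
lemma normH_eq {σ : ℝ} {f : 𝓢'(ℝ, ℂ)} {F : ℝ → ℂ} (h : HasFourier f F) :
    normH σ f = eLpNorm (fun ξ => (jb σ ξ : ℂ) * F ξ) 2 volume := by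
  have key : ∀ w : ComplexL2, IsMultiplierL2 (besselSymbol σ) f w →
      ‖w‖ₑ = eLpNorm (fun ξ => (jb σ ξ : ℂ) * F ξ) 2 volume := by
    intro w hw
    rw [isMultiplierL2_iff h] at hw
    change _ = eLpNorm (fun ξ => (besselSymbol σ (2 * Real.pi * ξ) : ℂ) * F ξ) 2 volume
    rw [← eLpNorm_congr_ae hw, ← Lp.enorm_def, ← ofReal_norm, ← ofReal_norm, Lp.norm_fourier_eq]
  by_cases hm : MemH σ f
  · obtain ⟨w, hw⟩ := hm
    apply le_antisymm
    · exact (iInf₂_le w hw).trans (key w hw).le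
    · exact le_iInf₂ fun w hw => (key w hw).ge
  · have h1 : normH σ f = ⊤ := by
      simp only [normH, iInf_eq_top]
      intro w hw
      exact absurd ⟨w, hw⟩ hm
    rw [h1]
    rw [memH_iff h] at hm
    by_contra h2
    exact hm ⟨(Complex.measurable_ofReal.comp (measurable_jb σ)).aestronglyMeasurable.mul
      h.aestronglyMeasurable, lt_top_iff_ne_top.2 (Ne.symm h2)⟩

/-! ### Reality -/

/-- The Fourier transform of a real `L²` function, as an isometry. -/
def fr : RealL2 →ₗᵢ[ℝ] ComplexL2 where
  toFun f := 𝓕 f.toComplex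
  map_add' f g := by
    have : (f + g).toComplex = f.toComplex + g.toComplex :=
      (Complex.ofRealCLM.compLpL 2 (volume : Measure ℝ)).map_add f g
    rw [this, FourierTransform.fourier_add]
  map_smul' c f := by
    have : (c • f).toComplex = c • f.toComplex :=
      (Complex.ofRealCLM.compLpL 2 (volume : Measure ℝ)).map_smul c f
    rw [this, RingHom.id_apply]
    exact ((Lp.fourierTransformₗᵢ ℝ ℂ).toLinearMap.restrictScalars ℝ).map_smul c _
  norm_map' f := by
    simp only [LinearMap.coe_mk, AddHom.coe_mk]
    rw [Lp.norm_fourier_eq, Lp.norm_def, Lp.norm_def]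
    congr 1
    apply eLpNorm_congr_norm_ae
    filter_upwards [Complex.ofRealCLM.coeFn_compLp f] with x hx
    rw [RealL2.toComplex, hx]; simp

lemma fr_apply (f : RealL2) : fr f = 𝓕 f.toComplex := rfl

lemma toComplex_coe (f : RealL2) : f.toComplex =ᵐ[volume] fun x => (f x : ℂ) :=
  Complex.ofRealCLM.coeFn_compLp f

/-- The real part of the inverse Fourier transform. -/
def reInv : ComplexL2 →L[ℝ] RealL2 :=
  (Complex.reCLM.compLpL 2 (volume : Measure ℝ)).comp
    ((Lp.fourierTransformₗᵢ ℝ ℂ).symm.toContinuousLinearEquiv.toContinuousLinearMap.restrictScalars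
      ℝ)

lemma reInv_coe (F : ComplexL2) :
    reInv F =ᵐ[volume] fun x => ((𝓕⁻ F : ComplexL2) x).re :=
  Complex.reCLM.coeFn_compLpL (𝓕⁻ F : ComplexL2)

lemma reInv_fr (f : RealL2) : reInv (fr f) = f := by
  apply Lp.ext
  have h := reInv_coe (fr f)
  rw [fr_apply, FourierTransform.fourierInv_fourier_eq] at h
  filter_upwards [h, toComplex_coe f] with x h1 h2
  rw [fr_apply, h1, h2, Complex.ofReal_re]

lemma fourierInv_smul_I (F : ComplexL2) : (𝓕⁻ (Complex.I • F) : ComplexL2) = Complex.I • 𝓕⁻ F :=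
  FourierTransform.fourierInv_smul _ _

lemma reInv_negI_coe (F : ComplexL2) :
    reInv (-(Complex.I • F)) =ᵐ[volume] fun x => ((𝓕⁻ F : ComplexL2) x).im := by
  rw [map_neg]
  filter_upwards [reInv_coe (Complex.I • F), Lp.coeFn_neg (reInv (Complex.I • F)),
    Lp.coeFn_smul Complex.I (𝓕⁻ F : ComplexL2)] with x h1 h2 h3
  rw [h2, Pi.neg_apply, h1, fourierInv_smul_I, h3]
  simp

lemma reInv_I_fr (f : RealL2) : reInv (Complex.I • fr f) = 0 := by
  apply Lp.ext
  have h := reInv_negI_coe (fr f)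
  rw [fr_apply, FourierTransform.fourierInv_fourier_eq, map_neg] at h
  filter_upwards [h, Lp.coeFn_neg (reInv (Complex.I • 𝓕 f.toComplex)), toComplex_coe f,
    Lp.coeFn_zero ℝ 2 (volume : Measure ℝ)] with x h1 h2 h3 h4
  rw [h4, fr_apply]
  rw [h2, h3] at h1
  simpa using h1

/-- Every `L²` function is the Fourier transform of `a + i q` with real `a`, `q`. -/
lemma fr_decomp (F : ComplexL2) :
    F = fr (reInv F) + Complex.I • fr (reInv (-(Complex.I • F))) := by
  have h : (𝓕⁻ F : ComplexL2) = (reInv F).toComplex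
      + Complex.I • (reInv (-(Complex.I • F))).toComplex := by
    apply Lp.ext
    filter_upwards [toComplex_coe (reInv F), toComplex_coe (reInv (-(Complex.I • F))),
      reInv_coe F, reInv_negI_coe F,
      Lp.coeFn_add (reInv F).toComplex (Complex.I • (reInv (-(Complex.I • F))).toComplex),
      Lp.coeFn_smul Complex.I (reInv (-(Complex.I • F))).toComplex] with x h1 h2 h3 h4 h5 h6
    rw [h5, Pi.add_apply, h6, Pi.smul_apply, h1, h2, h3, h4, smul_eq_mul, mul_comm]
    exact (Complex.re_add_im _).symm
  have h2 := congrArg (fun x : ComplexL2 => (𝓕 x : ComplexL2)) h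
  simp only [FourierTransform.fourier_fourierInv_eq, FourierTransform.fourier_add,
    FourierTransform.fourier_smul] at h2
  exact h2

lemma norm_sq_decomp (F : ComplexL2) :
    ‖F‖ ^ 2 = ‖reInv F‖ ^ 2 + ‖reInv (-(Complex.I • F))‖ ^ 2 := by
  have h0 : ‖F‖ = ‖(𝓕⁻ F : ComplexL2)‖ :=
    ((Lp.fourierTransformₗᵢ ℝ ℂ).symm.norm_map F).symm
  rw [h0]
  simp only [← @inner_self_eq_norm_sq ℝ, L2.inner_def, RCLike.re_to_real]
  rw [← integral_add]
  · apply integral_congr_ae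
    filter_upwards [reInv_coe F, reInv_negI_coe F] with x h1 h2
    rw [h1, h2]
    simp only [real_inner_self_eq_norm_sq, Complex.sq_norm, Complex.normSq_apply, Real.norm_eq_abs,
      sq_abs]
    ring
  · exact L2.integrable_inner _ _
  · exact L2.integrable_inner _ _

lemma norm_reInv_le (F : ComplexL2) : ‖reInv F‖ ≤ ‖F‖ := by
  apply le_of_sq_le_sq _ (norm_nonneg _)
  rw [norm_sq_decomp F]; nlinarith [sq_nonneg ‖reInv (-(Complex.I • F))‖]

lemma fourier_realTest_neg (g : ℝ → ℝ) (hg hc) (x : ℝ) :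
    (𝓕 (realTest g hg hc)) (-x) = (starRingEnd ℂ) ((𝓕 (realTest g hg hc)) x) := by
  simp only [SchwartzMap.fourier_coe, Real.fourier_eq', ← integral_conj]
  congr 1; ext v
  simp only [realTest_apply, smul_eq_mul, map_mul, Complex.conj_ofReal, ← Complex.exp_conj]
  congr 2
  simp

lemma fourier_realTest_comp_neg (g : ℝ → ℝ) (hg hc hg' hc') (x : ℝ) :
    (𝓕 (realTest (fun y => g (-y)) hg' hc')) x = (𝓕 (realTest g hg hc)) (-x) := by
  simp only [SchwartzMap.fourier_coe, Real.fourier_eq']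
  rw [← integral_neg_eq_self]
  congr 1; ext v
  simp [realTest_apply]

/-- The Fourier transform of a real distribution is invariant under `F ↦ conj (F (-·))`. -/
lemma IsRealDist.conj_symm {f : 𝓢'(ℝ, ℂ)} {F : ℝ → ℂ} (hf : IsRealDist f)
    (h : HasFourier f F) : ∀ᵐ ξ, (starRingEnd ℂ) (F (-ξ)) = F ξ := by
  have hmeas : AEStronglyMeasurable (fun ξ => (starRingEnd ℂ) (F (-ξ))) volume :=
    Complex.continuous_conj.comp_aestronglyMeasurable
      (h.aestronglyMeasurable.comp_measurePreserving (Measure.measurePreserving_neg _))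
  have hint : ∀ θ : 𝓢(ℝ, ℂ), Integrable fun ξ => (starRingEnd ℂ) (F (-ξ)) * θ ξ := by
    intro θ
    have h1 := (h (SchwartzMap.compCLMOfContinuousLinearEquiv ℂ
      (ContinuousLinearEquiv.neg ℝ) θ)).1.comp_neg
    refine h1.mono (hmeas.mul θ.continuous.aestronglyMeasurable) (ae_of_all _ fun ξ => ?_)
    simp
  have key := ae_zero_of_realTest (F := fun ξ => (starRingEnd ℂ) (F (-ξ)) - F ξ)
    (fun θ => by simpa only [sub_mul] using! (hint θ).sub (h θ).1) ?_
  · filter_upwards [key] with ξ h1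
    exact sub_eq_zero.1 h1
  intro g hg hc
  have hg' : ContDiff ℝ ((⊤ : ℕ∞) : WithTop ℕ∞) fun y => g (-y) := hg.comp contDiff_neg
  have hc' : HasCompactSupport fun y => g (-y) := hc.comp_homeomorph (Homeomorph.neg ℝ)
  set χ := realTest g hg hc with hχ
  set χ' := realTest _ hg' hc' with hχ'
  simp only [sub_mul]
  rw [integral_sub (hint _) (h _).1, ← (h _).2]
  have e1 : ∫ ξ, (starRingEnd ℂ) (F (-ξ)) * χ ξ = (starRingEnd ℂ) (𝓕 f χ') := by
    rw [(h χ').2, ← integral_conj, ← integral_neg_eq_self]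
    congr 1; ext ξ
    simp [hχ, hχ', realTest_apply]
  rw [e1]
  have hF' : ∀ x, (𝓕 χ') x = (starRingEnd ℂ) ((𝓕 χ) x) := fun x => by
    rw [hχ', fourier_realTest_comp_neg g hg hc, fourier_realTest_neg]
  have h1 := hf (𝓕 χ + 𝓕 χ') (fun x => by
    rw [add_apply, hF']; simp)
  have h2 := hf (Complex.I • (𝓕 χ - 𝓕 χ')) (fun x => by
    rw [smul_apply, sub_apply, hF']; simp)
  rw [map_add] at h1
  rw [map_smul, map_sub] at h2
  change (starRingEnd ℂ) (f (𝓕 χ')) - f (𝓕 χ) = 0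
  simp only [Complex.add_im, smul_eq_mul, Complex.I_mul_im, Complex.sub_re] at h1 h2
  apply Complex.ext
  · simp only [Complex.sub_re, Complex.conj_re, Complex.zero_re]; linarith
  · simp only [Complex.sub_im, Complex.conj_im, Complex.zero_im]; linarith

lemma isRealDist_toDist (f : RealL2) : IsRealDist f.toDist := by
  intro θ hθ
  rw [RealL2.toDist, Lp.toTemperedDistribution_apply, ← Complex.imCLM_apply,
    ← ContinuousLinearMap.integral_comp_comm]
  · rw [← integral_zero ℝ ℝ]
    apply integral_congr_ae
    filter_upwards [toComplex_coe f] with x hx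
    rw [hx]; simp [hθ x]
  · simpa only [smul_eq_mul, mul_comm] using!
      (Lp.memLp f.toComplex).integrable_mul (memLp_schwartz θ)

lemma fr_conj_symm (f : RealL2) : ∀ᵐ ξ, (starRingEnd ℂ) (fr f (-ξ)) = fr f ξ :=
  (isRealDist_toDist f).conj_symm (hasFourier_toDist f)

/-- A function with `conj (F (-·)) = F` is the Fourier transform of a real function. -/
lemma fr_reInv_of_conj_symm {F : ComplexL2} (hF : ∀ᵐ ξ, (starRingEnd ℂ) (F (-ξ)) = F ξ) :
    fr (reInv F) = F := by
  have key : reInv (-(Complex.I • F)) = 0 := by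
    rw [Lp.eq_zero_iff_ae_eq_zero]
    apply ae_eq_zero_of_integral_contDiff_smul_eq_zero
      ((Lp.memLp _).locallyIntegrable (by norm_num))
    intro g hg hc
    set χ := realTest g hg hc with hχ
    have h1 : Lp.toTemperedDistribution (𝓕⁻ F : ComplexL2) χ
        = Lp.toTemperedDistribution F (𝓕⁻ χ) := by
      rw [← Lp.fourierInv_toTemperedDistribution_eq]; rfl
    rw [Lp.toTemperedDistribution_apply, Lp.toTemperedDistribution_apply] at h1
    have hsym : ∀ ξ, (𝓕⁻ χ) (-ξ) = (starRingEnd ℂ) ((𝓕⁻ χ) ξ) := by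
      intro ξ
      have e : ∀ y, (𝓕⁻ χ) y = (𝓕 χ) (-y) := fun y => by
        rw [SchwartzMap.fourier_coe, SchwartzMap.fourierInv_coe, Real.fourierInv_eq_fourier_neg]
      rw [e, e, hχ, fourier_realTest_neg, fourier_realTest_neg]
    have h2 : (starRingEnd ℂ) (∫ ξ, (𝓕⁻ χ) ξ • F ξ) = ∫ ξ, (𝓕⁻ χ) ξ • F ξ := by
      rw [← integral_conj, ← integral_neg_eq_self]
      apply integral_congr_ae
      filter_upwards [hF] with ξ h3
      rw [hsym, smul_eq_mul, smul_eq_mul, map_mul, Complex.conj_conj, h3]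
    rw [← h1, Complex.conj_eq_iff_im, ← Complex.imCLM_apply,
      ← ContinuousLinearMap.integral_comp_comm] at h2
    · rw [← h2]
      apply integral_congr_ae
      filter_upwards [reInv_negI_coe F] with x h3
      rw [h3]; simp [hχ, realTest_apply]
    · simpa only [smul_eq_mul, mul_comm] using!
        (Lp.memLp (𝓕⁻ F : ComplexL2)).integrable_mul (memLp_schwartz χ)
  have h := fr_decomp F
  rw [key, map_zero, smul_zero, add_zero] at h
  exact h.symm

/-- Real even multipliers preserve the Fourier transforms of real functions. -/
lemma fr_reInv_mulR_fr {b : ℝ → ℝ} (hb : BddR b) (he : ∀ ξ, b (-ξ) = b ξ) (f : RealL2) :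
    fr (reInv (mulR b (fr f))) = mulR b (fr f) := by
  apply fr_reInv_of_conj_symm
  have h := mulR_coe hb (fr f)
  have h' := (Measure.measurePreserving_neg (volume : Measure ℝ)).quasiMeasurePreserving.ae h
  filter_upwards [h, h', fr_conj_symm f] with ξ h1 h2 h3
  rw [h1, h2, map_mul, Complex.conj_ofReal, he, h3]

/-- Real even multipliers commute with taking the real part. -/
lemma fr_reInv_mulR {b : ℝ → ℝ} (hb : BddR b) (he : ∀ ξ, b (-ξ) = b ξ) (F : ComplexL2) :
    fr (reInv (mulR b F)) = mulR b (fr (reInv F)) := by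
  conv_lhs => rw [fr_decomp F]
  have h2 : reInv (mulR b (Complex.I • fr (reInv (-(Complex.I • F))))) = 0 := by
    rw [map_smul, ← fr_reInv_mulR_fr hb he, reInv_I_fr]
  rw [map_add, map_add, h2, add_zero, fr_reInv_mulR_fr hb he]

/-! ### Balls of Sobolev spaces, on the Fourier side -/

/-- The set of `F` in `L²` with `‖(1 + η²)^(r/2) F‖ ≤ M`, for `r ≥ 0`. An element is encoded through
its preimage under the bounded multiplier with symbol `(1 + η²)^(-r/2)`. -/
def SobBall (r M : ℝ) : Set ComplexL2 := {F | ∃ Y : ComplexL2, ‖Y‖ ≤ M ∧ mulR (jb (-r)) Y = F}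

lemma jb_neg_mul (r ξ : ℝ) : jb (-r) ξ * jb r ξ = 1 := by
  rw [← jb_add]; simp

lemma mulR_jb_ae {r : ℝ} (hr : 0 ≤ r) (Y : ComplexL2) :
    ∀ᵐ ξ, (jb r ξ : ℂ) * mulR (jb (-r)) Y ξ = Y ξ := by
  filter_upwards [mulR_coe (bddR_jb (neg_nonpos.2 hr)) Y] with ξ h
  rw [h, ← mul_assoc, ← Complex.ofReal_mul, mul_comm (jb r ξ), jb_neg_mul]; simp

lemma eq_mulR_of_ae {r : ℝ} (hr : 0 ≤ r) {F Y : ComplexL2}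
    (h : ∀ᵐ ξ, Y ξ = (jb r ξ : ℂ) * F ξ) : mulR (jb (-r)) Y = F := by
  apply Lp.ext
  filter_upwards [mulR_coe (bddR_jb (neg_nonpos.2 hr)) Y, h] with ξ h1 h2
  rw [h1, h2, ← mul_assoc, ← Complex.ofReal_mul, jb_neg_mul]; simp

/-- Multiplication by `(1 + η²)^(-r/2)` is injective. -/
lemma mulR_jb_injective {r : ℝ} (hr : 0 ≤ r) : Function.Injective (mulR (jb (-r))) := by
  intro Y Y' h
  apply Lp.ext
  filter_upwards [mulR_jb_ae hr Y, mulR_jb_ae hr Y'] with ξ h1 h2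
  rw [← h1, ← h2, h]

lemma mem_sobBall_iff {r M : ℝ} (hr : 0 ≤ r) (hM : 0 ≤ M) (F : ComplexL2) :
    F ∈ SobBall r M ↔ eLpNorm (fun ξ => (jb r ξ : ℂ) * F ξ) 2 volume ≤ ENNReal.ofReal M := by
  constructor
  · rintro ⟨Y, hY, rfl⟩
    rw [eLpNorm_congr_ae (mulR_jb_ae hr Y), ← Lp.enorm_def, ← ofReal_norm]
    exact ENNReal.ofReal_le_ofReal hY
  · intro h
    have hm : MemLp (fun ξ => (jb r ξ : ℂ) * F ξ) 2 volume :=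
      ⟨(Complex.measurable_ofReal.comp (measurable_jb r)).aestronglyMeasurable.mul
        (Lp.memLp F).1, h.trans_lt ENNReal.ofReal_lt_top⟩
    refine ⟨hm.toLp, ?_, eq_mulR_of_ae hr hm.coeFn_toLp⟩
    rw [Lp.norm_toLp]
    exact ENNReal.toReal_le_of_le_ofReal hM h

lemma sobBall_mono {r r' M M' : ℝ} (hr : 0 ≤ r') (h : r' ≤ r) (hM : M ≤ M') :
    SobBall r M ⊆ SobBall r' M' := by
  rintro _ ⟨Y, hY, rfl⟩
  have h1 : BddR (jb (r' - r)) := bddR_jb (by linarith)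
  refine ⟨mulR (jb (r' - r)) Y, ?_, ?_⟩
  · refine ((mulR_norm_le (measurable_jb _) (C := 1) (fun ξ => ?_) Y).trans (by rw [one_mul])).trans
      (hY.trans hM)
    rw [abs_of_pos (jb_pos _ _)]; exact jb_le_one (by linarith) ξ
  · rw [mulR_mulR (bddR_jb (by linarith)) h1]
    congr 1
    apply mulR_congr fun ξ => ?_
    rw [← jb_add]; congr 1; ring

lemma sobBall_mulL2 {r M C : ℝ} (hr : 0 ≤ r) {m : ℝ → ℂ} (hm : Measurable m)
    (hC : ∀ ξ, ‖m ξ‖ ≤ C) {F : ComplexL2} (hF : F ∈ SobBall r M) :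
    mulL2 m F ∈ SobBall r (C * M) := by
  obtain ⟨Y, hY, rfl⟩ := hF
  refine ⟨mulL2 m Y, (mulL2_norm_le hm hC Y).trans ?_,
    mulR_comm (bddR_jb (neg_nonpos.2 hr)) ⟨hm, C, hC⟩ Y⟩
  exact mul_le_mul_of_nonneg_left hY ((norm_nonneg _).trans (hC 0))

lemma sobBall_mulR {r M C : ℝ} (hr : 0 ≤ r) {b : ℝ → ℝ} (hb : Measurable b)
    (hC : ∀ ξ, |b ξ| ≤ C) {F : ComplexL2} (hF : F ∈ SobBall r M) :
    mulR b F ∈ SobBall r (C * M) :=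
  sobBall_mulL2 hr (Complex.measurable_ofReal.comp hb) (fun ξ => by simpa using hC ξ) hF

lemma sobBall_fr_reInv {r M : ℝ} (hr : 0 ≤ r) {F : ComplexL2} (hF : F ∈ SobBall r M) :
    fr (reInv F) ∈ SobBall r M := by
  obtain ⟨Y, hY, rfl⟩ := hF
  refine ⟨fr (reInv Y), ?_, (fr_reInv_mulR (bddR_jb (neg_nonpos.2 hr)) (jb_even _) Y).symm⟩
  rw [fr.norm_map]
  exact (norm_reInv_le Y).trans hY

lemma sobBall_add {r M M' : ℝ} {F G : ComplexL2} (hF : F ∈ SobBall r M) (hG : G ∈ SobBall r M') :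
    F + G ∈ SobBall r (M + M') := by
  obtain ⟨Y, hY, rfl⟩ := hF
  obtain ⟨X, hX, rfl⟩ := hG
  exact ⟨Y + X, (norm_add_le _ _).trans (add_le_add hY hX), map_add _ _ _⟩

lemma sobBall_smul {r M : ℝ} {F : ComplexL2} (c : ℂ) (hF : F ∈ SobBall r M) :
    c • F ∈ SobBall r (‖c‖ * M) := by
  obtain ⟨Y, hY, rfl⟩ := hF
  exact ⟨c • Y, by rw [norm_smul]; gcongr, map_smul _ _ _⟩

lemma sobBall_rsmul {r M : ℝ} {F : ComplexL2} (c : ℝ) (hF : F ∈ SobBall r M) :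
    c • F ∈ SobBall r (|c| * M) := by
  have h := sobBall_smul (c : ℂ) hF
  rwa [Complex.norm_real, Real.norm_eq_abs, Complex.coe_smul] at h

lemma norm_le_of_mem_sobBall {r M : ℝ} (hr : 0 ≤ r) {F : ComplexL2} (hF : F ∈ SobBall r M) :
    ‖F‖ ≤ M := by
  obtain ⟨Y, hY, rfl⟩ := hF
  refine (mulR_norm_le (measurable_jb _) (C := 1) (fun ξ => ?_) Y).trans (by rwa [one_mul])
  rw [abs_of_pos (jb_pos _ _)]; exact jb_le_one (by linarith) ξ

lemma sobBall_nonneg {r M : ℝ} {F : ComplexL2} (hF : F ∈ SobBall r M) : 0 ≤ M := by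
  obtain ⟨Y, hY, _⟩ := hF
  exact (norm_nonneg _).trans hY

/-- Fatou's lemma for Sobolev balls: it suffices to bound approximate weights. -/
lemma mem_sobBall_of_tendsto {r M : ℝ} (hr : 0 ≤ r) {b : ℕ → ℝ → ℝ} (hb : ∀ n, BddR (b n))
    (h : ∀ ξ, Tendsto (fun n => b n ξ) atTop (𝓝 (jb r ξ))) {F : ComplexL2}
    (hF : ∀ n, ‖mulR (b n) F‖ ≤ M) : F ∈ SobBall r M := by
  rw [mem_sobBall_iff hr ((norm_nonneg _).trans (hF 0))]
  refine (Lp.eLpNorm_lim_le_liminf_eLpNorm (f := fun n ξ => (b n ξ : ℂ) * F ξ)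
    (fun n => ((hb n).sym.memLp F).1) _ (ae_of_all _ fun ξ => ?_)).trans ?_
  · exact ((Complex.continuous_ofReal.tendsto _).comp (h ξ)).mul_const _
  · have : ∀ n, eLpNorm (fun ξ => (b n ξ : ℂ) * F ξ) 2 volume ≤ ENNReal.ofReal M := by
      intro n
      rw [← eLpNorm_congr_ae (mulR_coe (hb n) F), ← Lp.enorm_def, ← ofReal_norm]
      exact ENNReal.ofReal_le_ofReal (hF n)
    calc _ ≤ atTop.liminf fun _ : ℕ => ENNReal.ofReal M := by
          exact liminf_le_liminf (Eventually.of_forall this)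
      _ = _ := by simp

/-- The weight `(1 + η²)^(r/2)`, cut off at `|ξ| ≤ n`. -/
def cutJb (r : ℝ) (n : ℕ) : ℝ → ℝ := indicator (Icc (-(n : ℝ)) n) (jb r)

lemma cutJb_nonneg (r : ℝ) (n : ℕ) (ξ : ℝ) : 0 ≤ cutJb r n ξ :=
  indicator_nonneg (fun ξ _ => (jb_pos r ξ).le) ξ

lemma cutJb_le (r : ℝ) (n : ℕ) (ξ : ℝ) : cutJb r n ξ ≤ jb r ξ :=
  indicator_le_self' (fun ξ _ => (jb_pos r ξ).le) ξ

lemma measurable_cutJb (r : ℝ) (n : ℕ) : Measurable (cutJb r n) :=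
  (measurable_jb r).indicator measurableSet_Icc

lemma bddR_cutJb (r : ℝ) (n : ℕ) : BddR (cutJb r n) := by
  obtain ⟨C, hC⟩ := (isCompact_Icc (a := -(n : ℝ)) (b := n)).bddAbove_image
    (continuous_jb r).continuousOn
  refine ⟨measurable_cutJb r n, max C 0, fun ξ => ?_⟩
  rw [abs_of_nonneg (cutJb_nonneg r n ξ), cutJb]
  by_cases h : ξ ∈ Icc (-(n : ℝ)) n
  · rw [indicator_of_mem h]
    exact (hC (mem_image_of_mem _ h)).trans (le_max_left _ _)
  · rw [indicator_of_notMem h]; exact le_max_right _ _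

lemma tendsto_indicator_Icc (f : ℝ → ℝ) (ξ : ℝ) :
    Tendsto (fun n : ℕ => indicator (Icc (-(n : ℝ)) n) f ξ) atTop (𝓝 (f ξ)) := by
  obtain ⟨N, hN⟩ := exists_nat_ge |ξ|
  refine tendsto_const_nhds.congr' ?_
  filter_upwards [eventually_ge_atTop N] with n hn
  have h2 : |ξ| ≤ n := hN.trans (by exact_mod_cast hn)
  exact (indicator_of_mem (s := Icc (-(n : ℝ)) n) (abs_le.1 h2) f).symm

lemma mem_sobBall_iff_cut {r M : ℝ} (hr : 0 ≤ r) (F : ComplexL2) :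
    F ∈ SobBall r M ↔ ∀ n, ‖mulR (cutJb r n) F‖ ≤ M := by
  constructor
  · rintro ⟨Y, hY, rfl⟩ n
    rw [mulR_mulR (bddR_cutJb r n) (bddR_jb (neg_nonpos.2 hr))]
    refine (mulR_norm_le ?_ (C := 1) (fun ξ => ?_) Y).trans (by rwa [one_mul])
    · exact (measurable_cutJb r n).mul (measurable_jb _)
    · rw [abs_of_nonneg (mul_nonneg (cutJb_nonneg _ _ _) (jb_pos _ _).le), ← jb_neg_mul r ξ,
        mul_comm]
      exact mul_le_mul_of_nonneg_left (cutJb_le r n ξ) (jb_pos _ _).le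
  · exact fun h => mem_sobBall_of_tendsto hr (bddR_cutJb r) (tendsto_indicator_Icc _) h

lemma isClosed_sobBall {r M : ℝ} (hr : 0 ≤ r) : IsClosed (SobBall r M) := by
  have : SobBall r M = ⋂ n, {F | ‖mulR (cutJb r n) F‖ ≤ M} := by
    ext F; simp [mem_sobBall_iff_cut hr]
  rw [this]
  exact isClosed_iInter fun n => isClosed_le (by fun_prop) continuous_const

lemma convex_sobBall {r M : ℝ} : Convex ℝ (SobBall r M) := by
  rintro F ⟨Y, hY, rfl⟩ G ⟨X, hX, rfl⟩ a b ha hb hab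
  refine ⟨a • Y + b • X, ?_, ?_⟩
  · calc ‖a • Y + b • X‖ ≤ a * ‖Y‖ + b * ‖X‖ := by
          refine (norm_add_le _ _).trans (le_of_eq ?_)
          rw [norm_smul, norm_smul, Real.norm_of_nonneg ha, Real.norm_of_nonneg hb]
      _ ≤ a * M + b * M := by gcongr
      _ = M := by rw [← add_mul, hab, one_mul]
  · rw [map_add]
    congr 1
    · exact ((mulR (jb (-r))).restrictScalars ℝ).map_smul a Y
    · exact ((mulR (jb (-r))).restrictScalars ℝ).map_smul b X

/-! ### Bounded functions in Sobolev spaces -/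

lemma memLp_jb {r : ℝ} (hr : 1 / 2 < r) : MemLp (jb (-r)) 2 volume := by
  rw [memLp_two_iff_integrable_sq (measurable_jb _).aestronglyMeasurable]
  have h := (integrable_rpow_neg_one_add_norm_sq (E := ℝ) (μ := volume) (r := 2 * r)
    (by simp; linarith))
  refine h.mono ((measurable_jb _).pow_const 2).aestronglyMeasurable (ae_of_all _ fun ξ => ?_)
  rw [Real.norm_of_nonneg (sq_nonneg _), Real.norm_of_nonneg (by positivity), sq, ← jb_add, jb_rpow]
  have e : (-r + -r) / 2 = -(2 * r) / 2 := by ring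
  rw [e]
  apply Real.rpow_le_rpow_of_nonpos (by positivity) _ (by linarith)
  rw [Real.norm_eq_abs, sq_abs]
  have : 1 ≤ 2 * Real.pi := by linarith [Real.pi_gt_three]
  rw [mul_pow]
  have h2 : 1 ≤ (2 * Real.pi) ^ 2 := one_le_pow₀ this
  nlinarith [mul_le_mul_of_nonneg_right h2 (sq_nonneg ξ)]

/-- Elements of a Sobolev space of order `r > 1/2` have integrable Fourier transforms. -/
lemma exists_integral_norm_le {r : ℝ} (hr : 1 / 2 < r) : ∃ C, 0 < C ∧ ∀ M, ∀ F ∈ SobBall r M,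
    Integrable F ∧ ∫ ξ, ‖F ξ‖ ≤ C * M := by
  set j : Lp ℝ 2 (volume : Measure ℝ) := (memLp_jb hr).toLp with hj
  refine ⟨‖j‖ + 1, by positivity, ?_⟩
  rintro M _ ⟨Y, hY, rfl⟩
  have hb := bddR_jb (σ := -r) (by linarith)
  have hint : Integrable (fun ξ => (jb (-r) ξ : ℂ) * Y ξ) := by
    have h1 : MemLp (fun ξ => (jb (-r) ξ : ℂ)) 2 volume := (memLp_jb hr).ofReal
    exact h1.integrable_mul (Lp.memLp Y)
  refine ⟨hint.congr (mulR_coe hb Y).symm, ?_⟩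
  set y : Lp ℝ 2 (volume : Measure ℝ) := (Lp.memLp Y).norm.toLp with hy
  have hy' : ‖y‖ = ‖Y‖ := by
    rw [hy, Lp.norm_toLp, eLpNorm_norm, Lp.norm_def]
  calc ∫ ξ, ‖mulR (jb (-r)) Y ξ‖ = inner ℝ j y := by
        rw [L2.inner_def]
        apply integral_congr_ae
        filter_upwards [mulR_coe hb Y, (memLp_jb hr).coeFn_toLp,
          (Lp.memLp Y).norm.coeFn_toLp] with ξ h1 h2 h3
        rw [h1, h2, h3, norm_mul, Complex.norm_real, Real.norm_of_nonneg (jb_pos _ _).le]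
        simp [mul_comm]
    _ ≤ ‖j‖ * ‖y‖ := real_inner_le_norm _ _
    _ ≤ (‖j‖ + 1) * M := by
        rw [hy']
        exact mul_le_mul (by linarith) hY (norm_nonneg _) (by positivity)

lemma norm_fourierInv_le (F : ℝ → ℂ) (x : ℝ) : ‖𝓕⁻ F x‖ ≤ ∫ ξ, ‖F ξ‖ := by
  rw [Real.fourierInv_eq']
  refine (norm_integral_le_integral_norm _).trans (le_of_eq ?_)
  congr 1; ext ξ
  rw [norm_smul, Complex.norm_exp_ofReal_mul_I, one_mul]

lemma continuous_fourierInv {F : ℝ → ℂ} (hF : Integrable F) : Continuous (𝓕⁻ F) :=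
  VectorFourier.fourierIntegral_continuous Real.continuous_fourierChar
    (by simp; fun_prop) hF

/-- The inverse Fourier transform on `L²` is given by the integral, for integrable functions. -/
lemma fourierInv_coe_of_integrable {F : ComplexL2} (hF : Integrable F) :
    ((𝓕⁻ F : ComplexL2) : ℝ → ℂ) =ᵐ[volume] 𝓕⁻ (F : ℝ → ℂ) := by
  have hint : ∀ θ : 𝓢(ℝ, ℂ), Integrable fun x => (𝓕⁻ (F : ℝ → ℂ)) x * θ x := by
    intro θ
    exact θ.integrable.bdd_mul (continuous_fourierInv hF).aestronglyMeasurable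
      (ae_of_all _ (norm_fourierInv_le F))
  have hint2 : ∀ θ : 𝓢(ℝ, ℂ), Integrable fun x => (𝓕⁻ F : ComplexL2) x * θ x := fun θ =>
    (Lp.memLp (𝓕⁻ F : ComplexL2)).integrable_mul (memLp_schwartz θ)
  have key := ae_zero_of_realTest (F := fun x => (𝓕⁻ F : ComplexL2) x - (𝓕⁻ (F : ℝ → ℂ)) x)
    (fun θ => by simpa only [sub_mul] using! (hint2 θ).sub (hint θ)) ?_
  · filter_upwards [key] with x h1
    exact sub_eq_zero.1 h1
  intro g hg hc
  set χ := realTest g hg hc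
  simp only [sub_mul]
  rw [integral_sub (hint2 _) (hint _), sub_eq_zero]
  have h1 : Lp.toTemperedDistribution (𝓕⁻ F : ComplexL2) χ
      = Lp.toTemperedDistribution F (𝓕⁻ χ) := by
    rw [← Lp.fourierInv_toTemperedDistribution_eq]; rfl
  rw [Lp.toTemperedDistribution_apply, Lp.toTemperedDistribution_apply] at h1
  simp only [smul_eq_mul] at h1
  have h2 := VectorFourier.integral_fourierIntegral_smul_eq_flip (e := Real.fourierChar)
    (L := -(innerₗ ℝ)) (μ := volume) (ν := volume) (f := (F : ℝ → ℂ)) (g := (χ : ℝ → ℂ))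
    Real.continuous_fourierChar (by simp; fun_prop) hF
    χ.integrable
  have e : (-(innerₗ ℝ) : ℝ →ₗ[ℝ] ℝ →ₗ[ℝ] ℝ).flip = -(innerₗ ℝ) := by
    ext; simp
  rw [e] at h2
  simp only [smul_eq_mul] at h2
  calc ∫ x, (𝓕⁻ F : ComplexL2) x * χ x = ∫ x, χ x * (𝓕⁻ F : ComplexL2) x := by
        simp only [mul_comm]
    _ = ∫ ξ, F ξ * (𝓕⁻ χ) ξ := by rw [h1]; simp only [mul_comm]
    _ = _ := by rw [SchwartzMap.fourierInv_coe]; exact h2.symm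

/-- Sobolev's embedding of `H^r`, `r > 1/2`, into `L^∞`. -/
lemma exists_ae_abs_le {r : ℝ} (hr : 1 / 2 < r) : ∃ C, 0 < C ∧ ∀ M, ∀ u : RealL2,
    fr u ∈ SobBall r M → ∀ᵐ x, |u x| ≤ C * M := by
  obtain ⟨C, hC, h⟩ := exists_integral_norm_le hr
  refine ⟨C, hC, fun M u hu => ?_⟩
  obtain ⟨h1, h2⟩ := h M _ hu
  have h3 := fourierInv_coe_of_integrable h1
  rw [fr_apply, FourierTransform.fourierInv_fourier_eq] at h3
  filter_upwards [h3, toComplex_coe u] with x h4 h5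
  rw [h5] at h4
  rw [← Real.norm_eq_abs, ← Complex.norm_real, h4]
  exact (norm_fourierInv_le _ x).trans h2

/-! ### Composition with a function, in `L²` and in `H¹` -/

open Classical in
/-- The composition `g ∘ u` as an element of `L²`; the junk value is `0`. -/
def compR (g : ℝ → ℝ) (u : RealL2) : RealL2 :=
  if h : MemLp (fun x => g (u x)) 2 (volume : Measure ℝ) then h.toLp else 0

/-- `g` is Lipschitz on `[-R, R]` with constant `L`. -/
def LipOn (g : ℝ → ℝ) (R L : ℝ) : Prop :=
  ∀ p q, |p| ≤ R → |q| ≤ R → |g p - g q| ≤ L * |p - q|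

lemma exists_lipOn {g : ℝ → ℝ} (hg : ContDiff ℝ 1 g) (R : ℝ) : ∃ L, 0 ≤ L ∧ LipOn g R L := by
  have hc : Continuous (deriv g) := hg.continuous_deriv le_rfl
  obtain ⟨C, hC⟩ := (isCompact_Icc (a := -R) (b := R)).exists_bound_of_continuousOn hc.continuousOn
  refine ⟨max C 0, le_max_right _ _, fun p q hp hq => ?_⟩
  have h := (convex_Icc (-R) R).norm_image_sub_le_of_norm_deriv_le (f := g) (C := max C 0)
    (fun x _ => (hg.differentiable one_ne_zero).differentiableAt)
    (fun x hx => (hC x hx).trans (le_max_left _ _)) (abs_le.1 hq) (abs_le.1 hp)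
  exact h

section compR

variable {g : ℝ → ℝ} {R L : ℝ}

lemma compR_coe (hg : Continuous g) (g0 : g 0 = 0) (hL : LipOn g R L) {u : RealL2}
    (hu : ∀ᵐ x, |u x| ≤ R) : compR g u =ᵐ[volume] fun x => g (u x) := by
  have h : MemLp (fun x => g (u x)) 2 (volume : Measure ℝ) := by
    refine (Lp.memLp u).of_le_mul (c := L) (hg.comp_aestronglyMeasurable (Lp.memLp u).1) ?_
    filter_upwards [hu] with x hx
    have := hL (u x) 0 hx (by simpa using (abs_nonneg _).trans hx)
    simpa [g0] using this
  rw [compR, dif_pos h]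
  exact h.coeFn_toLp

lemma norm_compR_sub_le (hg : Continuous g) (g0 : g 0 = 0) (hL : LipOn g R L)
    {u w : RealL2} (hu : ∀ᵐ x, |u x| ≤ R) (hw : ∀ᵐ x, |w x| ≤ R) :
    ‖compR g u - compR g w‖ ≤ L * ‖u - w‖ := by
  apply Lp.norm_le_mul_norm_of_ae_le_mul
  filter_upwards [hu, hw, compR_coe hg g0 hL hu, compR_coe hg g0 hL hw,
    Lp.coeFn_sub (compR g u) (compR g w), Lp.coeFn_sub u w] with x h1 h2 h3 h4 h5 h6
  rw [h5, h6, Pi.sub_apply, Pi.sub_apply, h3, h4]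
  exact hL _ _ h1 h2

lemma norm_compR_le (hg : Continuous g) (g0 : g 0 = 0) (hL : LipOn g R L)
    {u : RealL2} (hu : ∀ᵐ x, |u x| ≤ R) : ‖compR g u‖ ≤ L * ‖u‖ := by
  apply Lp.norm_le_mul_norm_of_ae_le_mul
  filter_upwards [hu, compR_coe hg g0 hL hu] with x h1 h3
  rw [h3]
  have := hL (u x) 0 h1 (by simpa using (abs_nonneg _).trans h1)
  simpa [g0] using this

end compR

/-- The translate `x ↦ u (x + h)`. -/
def transl (h : ℝ) (u : RealL2) : RealL2 :=
  Lp.compMeasurePreserving (fun x => x + h) (measurePreserving_add_right volume h) u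

lemma transl_coe (h : ℝ) (u : RealL2) : transl h u =ᵐ[volume] fun x => u (x + h) :=
  Lp.coeFn_compMeasurePreserving u _

lemma ae_transl {p : ℝ → Prop} (h : ℝ) (hp : ∀ᵐ x, p x) : ∀ᵐ x, p (x + h) :=
  (measurePreserving_add_right (volume : Measure ℝ) h).quasiMeasurePreserving.ae hp

/-- The character `e^{i h η}` as a function of the frequency. -/
def chr (h ξ : ℝ) : ℂ := Complex.exp ((2 * Real.pi * h * ξ : ℝ) * Complex.I)

lemma norm_chr (h ξ : ℝ) : ‖chr h ξ‖ = 1 := Complex.norm_exp_ofReal_mul_I _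

lemma continuous_chr (h : ℝ) : Continuous (chr h) := by unfold chr; fun_prop

lemma bddSym_chr (h : ℝ) : BddSym (chr h) := ⟨(continuous_chr h).measurable, 1,
    fun ξ => (norm_chr h ξ).le⟩

/-- The pairing form of the Fourier transform on `L²`. -/
lemma integral_fr_mul (u : RealL2) (θ : 𝓢(ℝ, ℂ)) :
    ∫ ξ, fr u ξ * θ ξ = ∫ x, (u x : ℂ) * (𝓕 θ) x := by
  have h := (hasFourier_toDist u θ).2
  rw [← fr_apply] at h
  rw [← h]
  change Lp.toTemperedDistribution u.toComplex (𝓕 θ) = _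
  rw [Lp.toTemperedDistribution_apply]
  apply integral_congr_ae
  filter_upwards [toComplex_coe u] with x hx
  rw [hx, smul_eq_mul, mul_comm]

/-- Translations become multiplications by characters. -/
lemma fr_transl (h : ℝ) (u : RealL2) : fr (transl h u) = mulL2 (chr h) (fr u) := by
  have hint : ∀ (w : ComplexL2) (θ : 𝓢(ℝ, ℂ)), Integrable fun ξ => w ξ * θ ξ := fun w θ =>
    (Lp.memLp w).integrable_mul (memLp_schwartz θ)
  have key := ae_zero_of_realTest (F := fun ξ => fr (transl h u) ξ - mulL2 (chr h) (fr u) ξ)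
    (fun θ => by simpa only [sub_mul] using! (hint _ θ).sub (hint _ θ)) ?_
  · apply Lp.ext
    filter_upwards [key] with ξ h1
    exact sub_eq_zero.1 h1
  intro g hg hc
  set χ := realTest g hg hc with hχ
  have hsm : ContDiff ℝ ((⊤ : ℕ∞) : WithTop ℕ∞) fun ξ => chr h ξ * (g ξ : ℂ) := by
    have h1 : ContDiff ℝ ((⊤ : ℕ∞) : WithTop ℕ∞) fun ξ => (g ξ : ℂ) :=
      Complex.ofRealCLM.contDiff.comp hg
    have h2 : ContDiff ℝ ((⊤ : ℕ∞) : WithTop ℕ∞) fun ξ => ((2 * Real.pi * h * ξ : ℝ) : ℂ) :=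
      Complex.ofRealCLM.contDiff.comp (contDiff_const.mul contDiff_id)
    exact (h2.mul contDiff_const).cexp.mul h1
  have hcs : HasCompactSupport fun ξ => chr h ξ * (g ξ : ℂ) :=
    (hc.comp_left (g := fun y : ℝ => (y : ℂ)) rfl).mul_left
  set χ' : 𝓢(ℝ, ℂ) := hcs.toSchwartzMap hsm with hχ'
  have hF : ∀ x, (𝓕 χ') x = (𝓕 χ) (x - h) := by
    intro x
    simp only [SchwartzMap.fourier_coe, Real.fourier_eq']
    congr 1; ext v
    change _ • (chr h v * (g v : ℂ)) = _ • (g v : ℂ)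
    rw [chr, smul_eq_mul, smul_eq_mul, ← mul_assoc, ← Complex.exp_add]
    congr 2
    simp
    ring
  simp only [sub_mul]
  rw [integral_sub (hint _ _) (hint _ _), sub_eq_zero, integral_fr_mul]
  have e1 : ∫ ξ, mulL2 (chr h) (fr u) ξ * χ ξ = ∫ ξ, fr u ξ * χ' ξ := by
    apply integral_congr_ae
    filter_upwards [mulL2_coe (bddSym_chr h) (fr u)] with ξ h1
    rw [h1]
    change _ = fr u ξ * (chr h ξ * (g ξ : ℂ))
    rw [hχ, realTest_apply]; ring
  have e2 : ∫ x, (u x : ℂ) * (𝓕 χ' : 𝓢(ℝ, ℂ)) x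
      = ∫ x, (u (x + h) : ℂ) * (𝓕 χ' : 𝓢(ℝ, ℂ)) (x + h) :=
    (integral_add_right_eq_self (fun x => (u x : ℂ) * (𝓕 χ' : 𝓢(ℝ, ℂ)) x) h).symm
  rw [e1, integral_fr_mul, e2]
  apply integral_congr_ae
  filter_upwards [transl_coe h u] with x h1
  rw [h1, hF, add_sub_cancel_right]

/-- The symbol of the difference quotient `h⁻¹ (u (· + h) - u)`. -/
def dq (h ξ : ℝ) : ℂ := (h : ℂ)⁻¹ * (chr h ξ - 1)

lemma continuous_dq (h : ℝ) : Continuous (dq h) := by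
  unfold dq; exact continuous_const.mul ((continuous_chr h).sub continuous_const)

lemma norm_dq_le (h ξ : ℝ) : ‖dq h ξ‖ ≤ |2 * Real.pi * ξ| := by
  rcases eq_or_ne h 0 with rfl | hh
  · simp [dq]
  have h1 := Real.norm_exp_I_mul_ofReal_sub_one_le (x := 2 * Real.pi * h * ξ)
  rw [dq, norm_mul, chr, mul_comm ((2 * Real.pi * h * ξ : ℝ) : ℂ), norm_inv, Complex.norm_real,
    Real.norm_eq_abs, inv_mul_le_iff₀ (abs_pos.2 hh), ← abs_mul]
  refine h1.trans (le_of_eq ?_)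
  rw [Real.norm_eq_abs]; congr 1; ring

lemma bddSym_dq (h : ℝ) : BddSym (dq h) := by
  refine ⟨(continuous_dq h).measurable, |h|⁻¹ * 2, fun ξ => ?_⟩
  rw [dq, norm_mul, norm_inv, Complex.norm_real, Real.norm_eq_abs]
  gcongr
  refine (norm_sub_le _ _).trans ?_
  rw [norm_chr, norm_one]; norm_num

lemma tendsto_dq (ξ : ℝ) :
    Tendsto (fun h => dq h ξ) (𝓝[≠] 0) (𝓝 ((2 * Real.pi * ξ : ℝ) * Complex.I)) := by
  have h1 : HasDerivAt (fun h : ℝ => chr h ξ) ((2 * Real.pi * ξ : ℝ) * Complex.I) 0 := by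
    have h2 : HasDerivAt (fun h : ℝ => ((2 * Real.pi * h * ξ : ℝ) : ℂ) * Complex.I)
        ((2 * Real.pi * ξ : ℝ) * Complex.I) 0 := by
      apply HasDerivAt.mul_const
      apply HasDerivAt.ofReal_comp
      simpa using! ((hasDerivAt_id (0 : ℝ)).const_mul (2 * Real.pi)).mul_const ξ
    simpa [chr] using! h2.cexp
  have h3 := h1.tendsto_slope
  refine h3.congr fun h => ?_
  rw [slope_def_module, dq]
  simp [chr]

lemma mulL2_dq (h : ℝ) (u : RealL2) :
    mulL2 (dq h) (fr u) = fr (h⁻¹ • (transl h u - u)) := by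
  rw [LinearIsometry.map_smul, LinearIsometry.map_sub, fr_transl]
  apply Lp.ext
  filter_upwards [mulL2_coe (bddSym_dq h) (fr u), mulL2_coe (bddSym_chr h) (fr u),
    Lp.coeFn_smul h⁻¹ (mulL2 (chr h) (fr u) - fr u), Lp.coeFn_sub (mulL2 (chr h) (fr u)) (fr u)]
    with ξ h1 h2 h3 h4
  rw [h1, h3, Pi.smul_apply, h4, Pi.sub_apply, h2, dq, Complex.real_smul, Complex.ofReal_inv]
  ring

/-- The approximation `(1 + |dq h|²)^{1/2}` of the weight of `H¹`. -/
def dqWeight (h ξ : ℝ) : ℝ := Real.sqrt (1 + ‖dq h ξ‖ ^ 2)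

lemma dqWeight_le (h ξ : ℝ) : dqWeight h ξ ≤ jb 1 ξ := by
  rw [dqWeight, Real.sqrt_le_left (jb_pos _ _).le, jb_one_sq, ← sq_abs (2 * Real.pi * ξ)]
  gcongr
  exact norm_dq_le h ξ

lemma bddR_dqWeight (h : ℝ) : BddR (dqWeight h) := by
  obtain ⟨_, C, hC⟩ := bddSym_dq h
  refine ⟨?_, Real.sqrt (1 + C ^ 2), fun ξ => ?_⟩
  · exact (Real.continuous_sqrt.comp
      (continuous_const.add ((continuous_dq h).norm.pow 2))).measurable
  · rw [dqWeight, abs_of_nonneg (Real.sqrt_nonneg _)]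
    gcongr; exact hC ξ

lemma tendsto_dqWeight (ξ : ℝ) : Tendsto (fun h => dqWeight h ξ) (𝓝[≠] 0) (𝓝 (jb 1 ξ)) := by
  have h1 := (Real.continuous_sqrt.tendsto _).comp
    (((tendsto_dq ξ).norm.pow 2).const_add 1)
  have e : Real.sqrt (1 + ‖((2 * Real.pi * ξ : ℝ) : ℂ) * Complex.I‖ ^ 2) = jb 1 ξ := by
    rw [norm_mul, Complex.norm_I, mul_one, Complex.norm_real, Real.norm_eq_abs, sq_abs, 
      ← jb_one_sq, Real.sqrt_sq (jb_pos _ _).le]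
  rw [e] at h1
  exact h1

lemma norm_sq_mulR_dqWeight (h : ℝ) (F : ComplexL2) :
    ‖mulR (dqWeight h) F‖ ^ 2 = ‖F‖ ^ 2 + ‖mulL2 (dq h) F‖ ^ 2 := by
  simp only [← @inner_self_eq_norm_sq ℝ, L2.inner_def, RCLike.re_to_real]
  rw [← integral_add (L2.integrable_inner _ _) (L2.integrable_inner _ _)]
  apply integral_congr_ae
  filter_upwards [mulR_coe (bddR_dqWeight h) F, mulL2_coe (bddSym_dq h) F] with ξ h1 h2
  rw [h1, h2]
  simp only [real_inner_self_eq_norm_sq, norm_mul, Complex.norm_real, mul_pow]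
  rw [dqWeight, Real.norm_of_nonneg (Real.sqrt_nonneg _), Real.sq_sqrt (by positivity)]
  ring

/-- Composition with a Lipschitz function is bounded on `H¹`. As translation invariance and a
Lipschitz bound control all difference quotients, no chain rule is needed. -/
lemma compR_mem_sobBall_one {g : ℝ → ℝ} {R L M : ℝ} (hg : Continuous g) (g0 : g 0 = 0)
    (hL0 : 0 ≤ L) (hL : LipOn g R L) {u : RealL2} (hu : ∀ᵐ x, |u x| ≤ R)
    (hM : fr u ∈ SobBall 1 M) : fr (compR g u) ∈ SobBall 1 (L * M) := by
  set hn : ℕ → ℝ := fun n => 1 / ((n : ℝ) + 1) with hhn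
  have hn0 : Tendsto hn atTop (𝓝[≠] 0) :=
    tendsto_nhdsWithin_iff.2 ⟨tendsto_one_div_add_atTop_nhds_zero_nat,
      Eventually.of_forall fun n => by
        simp only [hhn, mem_compl_iff, mem_singleton_iff]; positivity⟩
  refine mem_sobBall_of_tendsto zero_le_one (b := fun n => dqWeight (hn n))
    (fun n => bddR_dqWeight _) (fun ξ => (tendsto_dqWeight ξ).comp hn0) fun n => ?_
  have hM0 := sobBall_nonneg hM
  set h := hn n
  have h1 : ‖mulR (dqWeight h) (fr u)‖ ≤ M := by
    obtain ⟨Y, hY, hYu⟩ := hM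
    rw [← hYu, mulR_mulR (bddR_dqWeight h) (bddR_jb (by norm_num))]
    refine (mulR_norm_le ((bddR_dqWeight h).1.mul (measurable_jb _)) (C := 1) (fun ξ => ?_) Y).trans
      (by rwa [one_mul])
    have hp := jb_pos (-1) ξ
    have hp' : 0 ≤ dqWeight h ξ := Real.sqrt_nonneg _
    rw [Pi.mul_apply, abs_of_nonneg (mul_nonneg hp' hp.le), mul_comm]
    exact (mul_le_mul_of_nonneg_left (dqWeight_le h ξ) hp.le).trans (jb_neg_mul 1 ξ).le
  have hu' : ∀ᵐ x, |transl h u x| ≤ R := by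
    filter_upwards [transl_coe h u, ae_transl h hu] with x h1 h2
    rwa [h1]
  have e : transl h (compR g u) = compR g (transl h u) := by
    apply Lp.ext
    filter_upwards [transl_coe h (compR g u), compR_coe hg g0 hL hu',
      ae_transl h (compR_coe hg g0 hL hu), transl_coe h u] with x h1 h2 h3 h4
    rw [h1, h2, h3, h4]
  have h2 : ‖mulL2 (dq h) (fr (compR g u))‖ ≤ L * ‖mulL2 (dq h) (fr u)‖ := by
    rw [mulL2_dq, mulL2_dq, fr.norm_map, fr.norm_map, norm_smul, norm_smul, e, mul_left_comm]
    gcongr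
    exact norm_compR_sub_le hg g0 hL hu' hu
  have h3 : ‖fr (compR g u)‖ ≤ L * ‖fr u‖ := by
    rw [fr.norm_map, fr.norm_map]; exact norm_compR_le hg g0 hL hu
  refine le_trans ?_ (mul_le_mul_of_nonneg_left h1 hL0)
  apply le_of_sq_le_sq _ (by positivity)
  rw [norm_sq_mulR_dqWeight, mul_pow, norm_sq_mulR_dqWeight, mul_add, ← mul_pow, ← mul_pow]
  gcongr

/-! ### Products in Sobolev spaces -/

lemma eLpNorm_two_sq {ε : Type*} [TopologicalSpace ε] [ContinuousENorm ε] (f : ℝ → ε) :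
    eLpNorm f 2 volume ^ 2 = ∫⁻ x, ‖f x‖ₑ ^ 2 := by
  rw [eLpNorm_eq_lintegral_rpow_enorm_toReal (by norm_num) (by norm_num)]
  simp only [ENNReal.toReal_ofNat, one_div, ENNReal.rpow_ofNat]
  rw [← ENNReal.rpow_natCast, ← ENNReal.rpow_mul]; simp

/-- The Cauchy-Schwarz inequality with respect to the measure with density `Φ`. -/
lemma sq_lintegral_mul_le {Φ Ψ : ℝ → ℝ≥0∞} (hΦ : Measurable Φ) (hΨ : Measurable Ψ) :
    (∫⁻ x, Φ x * Ψ x) ^ 2 ≤ (∫⁻ x, Φ x) * ∫⁻ x, Φ x * Ψ x ^ 2 := by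
  have h := ENNReal.lintegral_mul_le_Lp_mul_Lq (volume.withDensity Φ) Real.HolderConjugate.two_two
    (f := fun _ => 1) (g := Ψ) aemeasurable_const hΨ.aemeasurable
  rw [lintegral_withDensity_eq_lintegral_mul _ hΦ (by fun_prop),
    lintegral_withDensity_eq_lintegral_mul _ hΦ (by fun_prop),
    lintegral_withDensity_eq_lintegral_mul _ hΦ (by fun_prop)] at h
  simp only [Pi.mul_apply, one_mul, one_pow, mul_one, ENNReal.rpow_ofNat] at h
  calc (∫⁻ x, Φ x * Ψ x) ^ 2
      ≤ ((∫⁻ x, Φ x) ^ (1 / 2 : ℝ) * (∫⁻ x, Φ x * Ψ x ^ 2) ^ (1 / 2 : ℝ)) ^ 2 := by gcongr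
    _ = _ := by
        rw [mul_pow, ← ENNReal.rpow_natCast, ← ENNReal.rpow_natCast, ← ENNReal.rpow_mul,
          ← ENNReal.rpow_mul]
        norm_num

/-- Young's inequality `‖Φ ∗ Ψ‖₂ ≤ ‖Φ‖₁ ‖Ψ‖₂`. -/
lemma eLpNorm_convolution_le {Φ Ψ : ℝ → ℝ≥0∞} (hΦ : Measurable Φ) (hΨ : Measurable Ψ) :
    eLpNorm (fun ξ => ∫⁻ ζ, Φ ζ * Ψ (ξ - ζ)) 2 volume ≤ (∫⁻ ζ, Φ ζ) * eLpNorm Ψ 2 volume := by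
  rw [← ENNReal.pow_le_pow_left_iff two_ne_zero, mul_pow, eLpNorm_two_sq, eLpNorm_two_sq]
  simp only [enorm_eq_self]
  calc ∫⁻ ξ, (∫⁻ ζ, Φ ζ * Ψ (ξ - ζ)) ^ 2
      ≤ ∫⁻ ξ, (∫⁻ ζ, Φ ζ) * ∫⁻ ζ, Φ ζ * Ψ (ξ - ζ) ^ 2 :=
        lintegral_mono fun ξ => sq_lintegral_mul_le hΦ (by fun_prop)
    _ = (∫⁻ ζ, Φ ζ) * ∫⁻ ξ, ∫⁻ ζ, Φ ζ * Ψ (ξ - ζ) ^ 2 := by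
        rw [lintegral_const_mul]
        exact Measurable.lintegral_prod_right' (f := fun p : ℝ × ℝ => Φ p.2 * Ψ (p.1 - p.2) ^ 2)
          (by fun_prop)
    _ = (∫⁻ ζ, Φ ζ) * ∫⁻ ζ, ∫⁻ ξ, Φ ζ * Ψ (ξ - ζ) ^ 2 := by
        rw [lintegral_lintegral_swap]
        exact Measurable.aemeasurable (f := fun p : ℝ × ℝ => Φ p.2 * Ψ (p.1 - p.2) ^ 2)
          (by fun_prop)
    _ = (∫⁻ ζ, Φ ζ) * ∫⁻ ζ, Φ ζ * ∫⁻ ξ, Ψ ξ ^ 2 := by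
        congr 2; ext ζ
        rw [lintegral_const_mul _ (by fun_prop),
          lintegral_sub_right_eq_self (fun ξ => Ψ ξ ^ 2) ζ]
    _ = _ := by rw [lintegral_mul_const _ hΦ]; ring

lemma eLpNorm_convolution_le' {Φ Ψ : ℝ → ℝ≥0∞} (hΦ : Measurable Φ) (hΨ : Measurable Ψ) :
    eLpNorm (fun ξ => ∫⁻ ζ, Φ ζ * Ψ (ξ - ζ)) 2 volume ≤ (∫⁻ ζ, Ψ ζ) * eLpNorm Φ 2 volume := by
  have : (fun ξ => ∫⁻ ζ, Φ ζ * Ψ (ξ - ζ)) = fun ξ => ∫⁻ ζ, Ψ ζ * Φ (ξ - ζ) := by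
    ext ξ
    rw [← lintegral_sub_left_eq_self _ ξ]
    simp only [sub_sub_cancel, mul_comm]
  rw [this]
  exact eLpNorm_convolution_le hΨ hΦ

/-- The Fourier transform of a product is the convolution of the Fourier transforms. -/
lemma fr_product {f w p : RealL2} (hf : Integrable (fr f)) (hp : p =ᵐ[volume] fun x => f x * w x) :
    ∀ᵐ ξ, fr p ξ = ∫ ζ, fr f ζ * fr w (ξ - ζ) := by
  have mf : StronglyMeasurable (fr f) := Lp.stronglyMeasurable _
  have mw : StronglyMeasurable (fr w) := Lp.stronglyMeasurable _
  have hsq : ∀ (ζ : ℝ), MemLp (fun ξ => fr w (ξ - ζ)) 2 volume := fun ζ =>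
    (Lp.memLp (fr w)).comp_measurePreserving (measurePreserving_sub_right volume ζ)
  -- The kernel is integrable on the product against every Schwartz function.
  have hker : ∀ χ : 𝓢(ℝ, ℂ), Integrable (Function.uncurry fun ζ ξ => fr f ζ * fr w (ξ - ζ) * χ ξ)
      (volume.prod volume) := by
    intro χ
    have hsm : StronglyMeasurable (Function.uncurry fun ζ ξ => fr f ζ * fr w (ξ - ζ) * χ ξ) := by
      refine ((mf.comp_measurable measurable_fst).mul (mw.comp_measurable
        (measurable_snd.sub measurable_fst))).mul ?_
      exact χ.continuous.stronglyMeasurable.comp_measurable measurable_snd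
    rw [integrable_prod_iff hsm.aestronglyMeasurable]
    constructor
    · refine ae_of_all _ fun ζ => ?_
      simp only [Function.uncurry_apply_pair, mul_assoc]
      exact ((hsq ζ).integrable_mul (memLp_schwartz χ)).const_mul _
    · refine (hf.norm.mul_const (‖fr w‖ * ‖(memLp_schwartz χ).toLp‖)).mono
        hsm.norm.integral_prod_right'.aestronglyMeasurable (ae_of_all _ fun ζ => ?_)
      simp only [Function.uncurry_apply_pair, norm_mul, norm_norm, mul_assoc]
      rw [integral_const_mul, norm_mul, norm_norm]
      gcongr
      rw [Real.norm_of_nonneg (by positivity)]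
      set a : Lp ℝ 2 (volume : Measure ℝ) := (hsq ζ).norm.toLp
      set b : Lp ℝ 2 (volume : Measure ℝ) := (memLp_schwartz χ).norm.toLp
      have ha : ‖a‖ = ‖fr w‖ := by
        rw [Lp.norm_toLp, eLpNorm_norm, Lp.norm_def]
        congr 1
        exact eLpNorm_comp_measurePreserving (Lp.memLp (fr w)).1
          (measurePreserving_sub_right volume ζ)
      have hb : ‖b‖ = ‖(memLp_schwartz χ).toLp‖ := by
        rw [Lp.norm_toLp, eLpNorm_norm, Lp.norm_toLp]
      rw [← ha, ← hb]
      refine le_trans (le_of_eq ?_) (real_inner_le_norm a b)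
      rw [L2.inner_def]
      apply integral_congr_ae
      filter_upwards [(hsq ζ).norm.coeFn_toLp, (memLp_schwartz χ).norm.coeFn_toLp] with ξ h1 h2
      rw [h1, h2]; simp [mul_comm]
  have hint : ∀ χ : 𝓢(ℝ, ℂ), Integrable fun ξ => (∫ ζ, fr f ζ * fr w (ξ - ζ)) * χ ξ := by
    intro χ
    have := (hker χ).integral_prod_right
    simpa only [Function.uncurry_apply_pair, integral_mul_const] using! this
  have hint2 : ∀ χ : 𝓢(ℝ, ℂ), Integrable fun ξ => fr p ξ * χ ξ := fun χ =>
    (Lp.memLp (fr p)).integrable_mul (memLp_schwartz χ)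
  have key := ae_zero_of_realTest (F := fun ξ => fr p ξ - ∫ ζ, fr f ζ * fr w (ξ - ζ))
    (fun χ => by simpa only [sub_mul] using! (hint2 χ).sub (hint χ)) ?_
  · filter_upwards [key] with ξ h1
    exact sub_eq_zero.1 h1
  intro g hg hc
  set χ := realTest g hg hc
  simp only [sub_mul]
  rw [integral_sub (hint2 χ) (hint χ), sub_eq_zero, integral_fr_mul]
  -- Translates of `χ`.
  let χt : ℝ → 𝓢(ℝ, ℂ) := fun ζ => realTest (fun v => g (v + ζ))
    (hg.comp (contDiff_id.add contDiff_const)) (hc.comp_homeomorph (Homeomorph.addRight ζ))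
  have hχt : ∀ ζ v, χt ζ v = χ (v + ζ) := fun ζ v => rfl
  have hFχt : ∀ ζ x, (𝓕 (χt ζ)) x = chr ζ x * (𝓕 χ) x := by
    intro ζ x
    simp only [SchwartzMap.fourier_coe, Real.fourier_eq', hχt]
    rw [← integral_const_mul, ← integral_sub_right_eq_self _ ζ]
    congr 1; ext v
    rw [sub_add_cancel, smul_eq_mul, smul_eq_mul, ← mul_assoc, chr, ← Complex.exp_add]
    congr 2
    simp
    ring
  have hfx : ∀ᵐ x, (f x : ℂ) = ∫ ζ, fr f ζ * chr ζ x := by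
    have h3 := fourierInv_coe_of_integrable hf
    rw [fr_apply, FourierTransform.fourierInv_fourier_eq] at h3
    filter_upwards [h3, toComplex_coe f] with x h4 h5
    rw [h5] at h4
    rw [h4, Real.fourierInv_eq']
    congr 1; ext ζ
    rw [smul_eq_mul, mul_comm, chr, fr_apply]
    congr 3
    simp
    ring
  have hk2 : Integrable (Function.uncurry fun x ζ => fr f ζ * chr ζ x * (w x * (𝓕 χ) x))
      (volume.prod volume) := by
    have h1 : Integrable (fun x => (w x : ℂ) * (𝓕 χ) x) :=
      (Lp.memLp w).ofReal.integrable_mul (memLp_schwartz _)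
    have h2 := (h1.mul_prod hf)
    refine h2.mono ?_ (ae_of_all _ fun z => ?_)
    · have hch : Measurable fun z : ℝ × ℝ => chr z.2 z.1 := by
        unfold chr; fun_prop
      have : (Function.uncurry fun x ζ => fr f ζ * chr ζ x * (w x * (𝓕 χ) x))
          = fun z : ℝ × ℝ => chr z.2 z.1 * ((w z.1 * (𝓕 χ) z.1) * fr f z.2) := by
        ext ⟨x, ζ⟩; simp only [Function.uncurry_apply_pair]; ring
      rw [this]
      exact hch.aestronglyMeasurable.mul h2.1
    · simp only [Function.uncurry, norm_mul, norm_chr]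
      apply le_of_eq; ring
  calc ∫ x, (p x : ℂ) * (𝓕 χ) x
      = ∫ x, ∫ ζ, fr f ζ * chr ζ x * (w x * (𝓕 χ) x) := by
        apply integral_congr_ae
        filter_upwards [hp, hfx] with x h1 h2
        rw [integral_mul_const, ← h2, h1]; push_cast; ring
    _ = ∫ ζ, ∫ x, fr f ζ * chr ζ x * (w x * (𝓕 χ) x) := integral_integral_swap hk2
    _ = ∫ ζ, ∫ ξ, fr f ζ * fr w (ξ - ζ) * χ ξ := by
        congr 1; ext ζ
        have h1 : ∀ x, fr f ζ * chr ζ x * (w x * (𝓕 χ) x)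
            = fr f ζ * (w x * (𝓕 (χt ζ)) x) := fun x => by rw [hFχt]; ring
        simp only [h1, mul_assoc]
        rw [integral_const_mul, integral_const_mul, ← integral_fr_mul]
        congr 1
        rw [← integral_sub_right_eq_self _ ζ]
        simp only [hχt, sub_add_cancel]
    _ = ∫ ξ, ∫ ζ, fr f ζ * fr w (ξ - ζ) * χ ξ := integral_integral_swap (hker χ)
    _ = _ := by simp only [integral_mul_const]

/-- The weights satisfy `⟨η⟩^a ≤ 2^a max(⟨η - ζ⟩^a, ⟨ζ⟩^a)`. -/
lemma jb_le_max {a : ℝ} (ha : 0 ≤ a) (ξ ζ : ℝ) :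
    jb a ξ ≤ (2 : ℝ) ^ a * max (jb a ζ) (jb a (ξ - ζ)) := by
  have h4 : (2 : ℝ) ^ a = (4 : ℝ) ^ (a / 2) := by
    rw [show (4 : ℝ) = 2 ^ (2 : ℝ) by norm_num, ← Real.rpow_mul (by norm_num)]; congr 1; ring
  have hmax : max (jb a ζ) (jb a (ξ - ζ))
      = (max (1 + (2 * Real.pi * ζ) ^ 2) (1 + (2 * Real.pi * (ξ - ζ)) ^ 2)) ^ (a / 2) := by
    rw [jb_rpow, jb_rpow]
    refine (MonotoneOn.map_max (s := Ici (0 : ℝ)) (f := fun x : ℝ => x ^ (a / 2)) ?_ ?_ ?_).symm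
    · intro x hx y _ hxy
      exact Real.rpow_le_rpow hx hxy (by positivity)
    · exact mem_Ici.2 (by positivity)
    · exact mem_Ici.2 (by positivity)
  rw [hmax, h4, ← Real.mul_rpow (by norm_num) (le_max_of_le_left (by positivity)), jb_rpow]
  apply Real.rpow_le_rpow (by positivity) _ (by positivity)
  have h1 := le_max_left (1 + (2 * Real.pi * ζ) ^ 2) (1 + (2 * Real.pi * (ξ - ζ)) ^ 2)
  have h2 := le_max_right (1 + (2 * Real.pi * ζ) ^ 2) (1 + (2 * Real.pi * (ξ - ζ)) ^ 2)
  have e : 2 * Real.pi * ξ = 2 * Real.pi * ζ + 2 * Real.pi * (ξ - ζ) := by ring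
  rw [e]
  nlinarith [sq_nonneg (2 * Real.pi * ζ - 2 * Real.pi * (ξ - ζ))]

/-- The weight of order `a` moves to the factor with the larger frequency. If that is the first one,
the surplus of decay of order `r - a` is passed on to the second one. -/
lemma jb_split {a r : ℝ} (ha : 0 ≤ a) (har : a ≤ r) (ξ ζ : ℝ) {x y X Y : ℝ} (hx : 0 ≤ X)
    (hy : 0 ≤ Y) (hX : x = jb (-r) ζ * X) (hY : y = jb (-a) (ξ - ζ) * Y) :
    jb a ξ * (x * y) ≤ 2 ^ a * (x * Y + X * (jb (-r) (ξ - ζ) * Y)) := by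
  have p1 := (jb_pos (-r) ζ).le
  have p2 := (jb_pos (-a) (ξ - ζ)).le
  have p3 := (jb_pos (-r) (ξ - ζ)).le
  have hx0 : 0 ≤ x := by rw [hX]; positivity
  have hy0 : 0 ≤ y := by rw [hY]; positivity
  refine (mul_le_mul_of_nonneg_right (jb_le_max ha ξ ζ) (by positivity)).trans ?_
  rw [mul_assoc]
  gcongr
  rcases le_total (1 + (2 * Real.pi * ζ) ^ 2) (1 + (2 * Real.pi * (ξ - ζ)) ^ 2) with hb | hb
  · have h : jb a ζ ≤ jb a (ξ - ζ) := Real.rpow_le_rpow (by positivity) hb (by positivity)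
    rw [max_eq_right h]
    have : jb a (ξ - ζ) * (x * y) = x * Y := by
      rw [hY]
      have := jb_neg_mul a (ξ - ζ)
      linear_combination x * Y * this
    rw [this]
    have : 0 ≤ X * (jb (-r) (ξ - ζ) * Y) := by positivity
    linarith
  · have h : jb a (ξ - ζ) ≤ jb a ζ := Real.rpow_le_rpow (by positivity) hb (by positivity)
    rw [max_eq_left h]
    have h0 : 0 ≤ x * Y := by positivity
    refine le_trans ?_ (le_add_of_nonneg_left h0)
    have hmono : jb (a - r) ζ ≤ jb (a - r) (ξ - ζ) :=
      Real.rpow_le_rpow_of_nonpos (by positivity) hb (by linarith)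
    calc jb a ζ * (x * y) = (jb a ζ * jb (-r) ζ) * (X * (jb (-a) (ξ - ζ) * Y)) := by
          rw [hX, hY]; ring
      _ = jb (a - r) ζ * (X * (jb (-a) (ξ - ζ) * Y)) := by rw [← jb_add, ← sub_eq_add_neg]
      _ ≤ jb (a - r) (ξ - ζ) * (X * (jb (-a) (ξ - ζ) * Y)) := by gcongr
      _ = X * (jb (a - r) (ξ - ζ) * jb (-a) (ξ - ζ) * Y) := by ring
      _ = _ := by rw [← jb_add]; congr 4; ring

lemma lintegral_enorm_le {F : ComplexL2} {c : ℝ} (h : Integrable F) (hc : ∫ ξ, ‖F ξ‖ ≤ c) :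
    ∫⁻ ξ, ‖F ξ‖ₑ ≤ ENNReal.ofReal c := by
  rw [← ofReal_integral_norm_eq_lintegral_enorm h]
  exact ENNReal.ofReal_le_ofReal hc

/-- Multiplication maps `H^r × H^a` into `H^a`, if `0 ≤ a ≤ r` and `r > 1/2`. -/
lemma exists_product_mem_sobBall {a r : ℝ} (ha : 0 ≤ a) (har : a ≤ r) (hr : 1 / 2 < r) :
    ∃ C, 0 ≤ C ∧ ∀ A B : ℝ, ∀ f w p : RealL2, fr f ∈ SobBall r A → fr w ∈ SobBall a B →
      p =ᵐ[volume] (fun x => f x * w x) → fr p ∈ SobBall a (C * A * B) := by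
  obtain ⟨C, hC, hL⟩ := exists_integral_norm_le hr
  refine ⟨2 ^ a * (2 * C), by positivity, ?_⟩
  intro A B f w p hf hw hp
  have hA := sobBall_nonneg hf
  have hB := sobBall_nonneg hw
  obtain ⟨f1, f2⟩ := hL A _ hf
  obtain ⟨X, hX, hXf⟩ := hf
  obtain ⟨Y, hY, hYw⟩ := hw
  have hbr : BddR (jb (-r)) := bddR_jb (by linarith)
  obtain ⟨y1, y2⟩ := hL B (mulR (jb (-r)) Y) ⟨Y, hY, rfl⟩
  rw [mem_sobBall_iff ha (by positivity)]
  set Z := mulR (jb (-r)) Y with hZ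
  have mX : StronglyMeasurable X := Lp.stronglyMeasurable _
  have mY : StronglyMeasurable Y := Lp.stronglyMeasurable _
  have mZ : StronglyMeasurable Z := Lp.stronglyMeasurable _
  have mf : StronglyMeasurable (fr f) := Lp.stronglyMeasurable _
  have mw : StronglyMeasurable (fr w) := Lp.stronglyMeasurable _
  have mZe : Measurable fun ξ => ‖Z ξ‖ₑ := mZ.measurable.enorm
  have mYe : Measurable fun ξ => ‖Y ξ‖ₑ := mY.measurable.enorm
  have mXe : Measurable fun ξ => ‖X ξ‖ₑ := mX.measurable.enorm
  have mfe : Measurable fun ξ => ‖fr f ξ‖ₑ := mf.measurable.enorm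
  have hXf' : ∀ᵐ ζ, ‖fr f ζ‖ = jb (-r) ζ * ‖X ζ‖ := by
    filter_upwards [mulR_coe hbr X] with ζ h
    rw [← hXf, h, norm_mul, Complex.norm_real, Real.norm_of_nonneg (jb_pos _ _).le]
  have hYw' : ∀ᵐ ζ, ‖fr w ζ‖ = jb (-a) ζ * ‖Y ζ‖ ∧ ‖Z ζ‖ = jb (-r) ζ * ‖Y ζ‖ := by
    filter_upwards [mulR_coe (bddR_jb (neg_nonpos.2 ha)) Y, mulR_coe hbr Y] with ζ h h'
    rw [← hYw, h, hZ, h', norm_mul, norm_mul, Complex.norm_real, Complex.norm_real,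
      Real.norm_of_nonneg (jb_pos _ _).le, Real.norm_of_nonneg (jb_pos _ _).le]
    exact ⟨rfl, rfl⟩
  -- The weight `(1 + η²)^{a/2}` falls on one of the two factors, up to a constant: `T1` has it on
  -- `w`, and `T2` has it on `f` (where the excess `r - a` is moved to `w`). In both convolutions
  -- one factor is in `L²` and the other in `L¹`.
  set T1 : ℝ → ℝ≥0∞ := fun ξ => ∫⁻ ζ, ‖fr f ζ‖ₑ * ‖Y (ξ - ζ)‖ₑ with hT1
  set T2 : ℝ → ℝ≥0∞ := fun ξ => ∫⁻ ζ, ‖X ζ‖ₑ * ‖Z (ξ - ζ)‖ₑ with hT2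
  have mT1 : Measurable T1 := Measurable.lintegral_prod_right'
    (f := fun q : ℝ × ℝ => ‖fr f q.2‖ₑ * ‖Y (q.1 - q.2)‖ₑ)
    ((mfe.comp measurable_snd).mul (mYe.comp (measurable_fst.sub measurable_snd)))
  have mT2 : Measurable T2 := Measurable.lintegral_prod_right'
    (f := fun q : ℝ × ℝ => ‖X q.2‖ₑ * ‖Z (q.1 - q.2)‖ₑ)
    ((mXe.comp measurable_snd).mul (mZe.comp (measurable_fst.sub measurable_snd)))
  have hpt : ∀ᵐ ξ, ‖(jb a ξ : ℂ) * fr p ξ‖ₑ ≤ ENNReal.ofReal (2 ^ a) * (T1 ξ + T2 ξ) := by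
    filter_upwards [fr_product f1 hp] with ξ hξ
    rw [hξ, ← integral_const_mul]
    refine (enorm_integral_le_lintegral_enorm _).trans ?_
    have m1 : Measurable fun ζ => ‖fr f ζ‖ₑ * ‖Y (ξ - ζ)‖ₑ :=
      mfe.mul (mYe.comp (measurable_const.sub measurable_id))
    have m2 : Measurable fun ζ => ‖X ζ‖ₑ * ‖Z (ξ - ζ)‖ₑ :=
      mXe.mul (mZe.comp (measurable_const.sub measurable_id))
    change _ ≤ ENNReal.ofReal (2 ^ a) *
      ((∫⁻ ζ, ‖fr f ζ‖ₑ * ‖Y (ξ - ζ)‖ₑ) + ∫⁻ ζ, ‖X ζ‖ₑ * ‖Z (ξ - ζ)‖ₑ)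
    have m3 : Measurable fun ζ => ‖fr f ζ‖ₑ * ‖Y (ξ - ζ)‖ₑ + ‖X ζ‖ₑ * ‖Z (ξ - ζ)‖ₑ := m1.add m2
    rw [← lintegral_add_left m1, ← lintegral_const_mul _ m3]
    apply lintegral_mono_ae
    have hq := (Measure.measurePreserving_sub_left (volume : Measure ℝ)
      ξ).quasiMeasurePreserving.ae hYw'
    filter_upwards [hXf', hq] with ζ h1 h2
    have h := jb_split ha har ξ ζ (norm_nonneg (X ζ)) (norm_nonneg (Y (ξ - ζ))) h1 h2.1
    rw [← h2.2] at h
    have e1 : ‖(jb a ξ : ℂ) * (fr f ζ * fr w (ξ - ζ))‖ₑ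
        = ENNReal.ofReal (jb a ξ * (‖fr f ζ‖ * ‖fr w (ξ - ζ)‖)) := by
      rw [← ofReal_norm, norm_mul, norm_mul, Complex.norm_real,
        Real.norm_of_nonneg (jb_pos _ _).le]
    rw [e1]
    refine (ENNReal.ofReal_le_ofReal h).trans (le_of_eq ?_)
    rw [ENNReal.ofReal_mul (by positivity), ENNReal.ofReal_add (by positivity) (by positivity),
      ENNReal.ofReal_mul (norm_nonneg _), ENNReal.ofReal_mul (norm_nonneg _)]
    simp only [ofReal_norm]
  -- Young's inequality `L¹ * L² ⊆ L²`.
  have n1 : eLpNorm T1 2 volume ≤ ENNReal.ofReal (C * A) * ENNReal.ofReal B := by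
    refine (eLpNorm_convolution_le mfe mYe).trans (mul_le_mul' (lintegral_enorm_le f1 f2) ?_)
    rw [eLpNorm_enorm, ← Lp.enorm_def, ← ofReal_norm]
    exact ENNReal.ofReal_le_ofReal hY
  have n2 : eLpNorm T2 2 volume ≤ ENNReal.ofReal (C * B) * ENNReal.ofReal A := by
    refine (eLpNorm_convolution_le' mXe mZe).trans (mul_le_mul' (lintegral_enorm_le y1 y2) ?_)
    rw [eLpNorm_enorm, ← Lp.enorm_def, ← ofReal_norm]
    exact ENNReal.ofReal_le_ofReal hX
  calc eLpNorm (fun ξ => (jb a ξ : ℂ) * fr p ξ) 2 volume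
      ≤ eLpNorm (fun ξ => ENNReal.ofReal (2 ^ a) * (T1 ξ + T2 ξ)) 2 volume := by
        apply eLpNorm_mono_enorm_ae
        simpa only [enorm_eq_self] using hpt
    _ ≤ ENNReal.ofReal (2 ^ a) * eLpNorm (T1 + T2) 2 volume := by
        apply le_of_eq
        rw [← (ENNReal.pow_right_strictMono two_ne_zero).injective.eq_iff, mul_pow,
          eLpNorm_two_sq, eLpNorm_two_sq,
          ← lintegral_const_mul]
        · simp only [enorm_eq_self, mul_pow, Pi.add_apply]
        · simp only [enorm_eq_self]; exact (mT1.add mT2).pow_const 2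
    _ ≤ ENNReal.ofReal (2 ^ a) * (ENNReal.ofReal (C * A) * ENNReal.ofReal B
          + ENNReal.ofReal (C * B) * ENNReal.ofReal A) := by
        gcongr
        exact (eLpNorm_add_le mT1.aestronglyMeasurable mT2.aestronglyMeasurable
          (by norm_num)).trans (add_le_add n1 n2)
    _ = _ := by
        rw [← ENNReal.ofReal_mul (by positivity), ← ENNReal.ofReal_mul (by positivity),
          ← ENNReal.ofReal_add (by positivity) (by positivity),
            ← ENNReal.ofReal_mul (by positivity)]
        congr 1; ring

/-! ### Composition with a smooth function in Sobolev spaces -/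

/-- The derivative of `u` in `H¹`: it is the limit of the difference quotients and its Fourier
transform is `i η` times that of `u`. -/
lemma exists_deriv {u : RealL2} {M : ℝ} (hu : fr u ∈ SobBall 1 M) :
    ∃ D : RealL2, (fr D =ᵐ[volume] fun ξ => ((2 * Real.pi * ξ : ℝ) * Complex.I) * fr u ξ) ∧
      Tendsto (fun n : ℕ => (1 / ((n : ℝ) + 1))⁻¹ • (transl (1 / ((n : ℝ) + 1)) u - u)) atTop
        (𝓝 D) := by
  obtain ⟨Z, hZ, hZu⟩ := hu
  have hb : BddR (jb (-1)) := bddR_jb (by norm_num)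
  have hn0 : Tendsto (fun n : ℕ => 1 / ((n : ℝ) + 1)) atTop (𝓝[≠] 0) :=
    tendsto_nhdsWithin_iff.2 ⟨tendsto_one_div_add_atTop_nhds_zero_nat,
      Eventually.of_forall fun n => by simp only [mem_compl_iff, mem_singleton_iff]; positivity⟩
  set m₀ : ℝ → ℂ := fun ξ => ((2 * Real.pi * ξ : ℝ) * Complex.I) * (jb (-1) ξ : ℂ) with hm₀
  have bd : ∀ ξ (z : ℂ), ‖z‖ ≤ |2 * Real.pi * ξ| → ‖z * (jb (-1) ξ : ℂ)‖ ≤ 1 := by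
    intro ξ z hz
    rw [norm_mul, Complex.norm_real, Real.norm_of_nonneg (jb_pos _ _).le, mul_comm]
    exact (mul_le_mul_of_nonneg_left (hz.trans (abs_le_jb_one ξ)) (jb_pos _ _).le).trans
      (jb_neg_mul 1 ξ).le
  have mm₀ : Measurable m₀ := by
    have : Measurable fun ξ : ℝ => ((2 * Real.pi * ξ : ℝ) : ℂ) := by fun_prop
    exact (this.mul_const _).mul (Complex.measurable_ofReal.comp (measurable_jb _))
  have bm₀ : ∀ ξ, ‖m₀ ξ‖ ≤ 1 := fun ξ => bd ξ _ (by
    rw [norm_mul, Complex.norm_I, mul_one, Complex.norm_real, Real.norm_eq_abs])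
  have lim := tendsto_mulL2 (L := atTop) (m := fun n : ℕ => fun ξ =>
      dq (1 / ((n : ℝ) + 1)) ξ * (jb (-1) ξ : ℂ)) (m₀ := m₀) (C := 1)
    (fun n => (continuous_dq _).measurable.mul (Complex.measurable_ofReal.comp (measurable_jb _)))
    mm₀ (Eventually.of_forall fun n ξ => bd ξ _ (norm_dq_le _ ξ)) bm₀
    (fun ξ => ((tendsto_dq ξ).comp hn0).mul_const _) Z
  have e : ∀ n : ℕ, mulL2 (fun ξ => dq (1 / ((n : ℝ) + 1)) ξ * (jb (-1) ξ : ℂ)) Z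
      = fr ((1 / ((n : ℝ) + 1))⁻¹ • (transl (1 / ((n : ℝ) + 1)) u - u)) := by
    intro n
    rw [← mulL2_mul (bddSym_dq _) hb.sym, ← mulL2_dq, ← hZu]; rfl
  simp only [e] at lim
  have lim2 := (reInv.continuous.tendsto _).comp lim
  simp only [Function.comp_def, reInv_fr] at lim2
  refine ⟨_, ?_, lim2⟩
  have lim3 := (fr.continuous.tendsto _).comp lim2
  have e2 := tendsto_nhds_unique lim3 lim
  rw [e2]
  filter_upwards [mulL2_coe ⟨mm₀, 1, bm₀⟩ Z, mulR_coe hb Z] with ξ h1 h2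
  rw [h1, ← hZu, h2, hm₀]; ring

/-- The chain rule for functions that are differentiable in `L²`: along a subsequence, difference
quotients of `u` and of `g ∘ u` converge almost everywhere. -/
lemma chain_rule {g : ℝ → ℝ} (hg : ContDiff ℝ 1 g) (g0 : g 0 = 0) {R L : ℝ} (hL : LipOn g R L)
    {u D D' : RealL2} (hu : ∀ᵐ x, |u x| ≤ R)
    (hD : Tendsto (fun n : ℕ => (1 / ((n : ℝ) + 1))⁻¹ • (transl (1 / ((n : ℝ) + 1)) u - u)) atTop
      (𝓝 D))
    (hD' : Tendsto (fun n : ℕ => (1 / ((n : ℝ) + 1))⁻¹ •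
      (transl (1 / ((n : ℝ) + 1)) (compR g u) - compR g u)) atTop (𝓝 D')) :
    D' =ᵐ[volume] fun x => deriv g (u x) * D x := by
  obtain ⟨n1, hn1, h1⟩ := (tendstoInMeasure_of_tendsto_Lp hD).exists_seq_tendsto_ae
  obtain ⟨n2, hn2, h2⟩ := (tendstoInMeasure_of_tendsto_Lp
    (hD'.comp hn1.tendsto_atTop)).exists_seq_tendsto_ae
  have hq : ∀ (w : RealL2) (h : ℝ), ∀ᵐ x, (h⁻¹ • (transl h w - w) : RealL2) x
      = h⁻¹ * (w (x + h) - w x) := by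
    intro w h
    filter_upwards [Lp.coeFn_smul h⁻¹ (transl h w - w), Lp.coeFn_sub (transl h w) w,
      transl_coe h w] with x h3 h4 h5
    rw [h3, Pi.smul_apply, h4, Pi.sub_apply, h5, smul_eq_mul]
  have hcu := compR_coe hg.continuous g0 hL hu
  filter_upwards [h1, h2, ae_all_iff.2 fun n : ℕ => hq u (1 / ((n : ℝ) + 1)),
    ae_all_iff.2 fun n : ℕ => hq (compR g u) (1 / ((n : ℝ) + 1)), hcu,
    ae_all_iff.2 fun n : ℕ => ae_transl (1 / ((n : ℝ) + 1)) hcu] with x a1 a2 a3 a4 a5 a6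
  simp only [Function.comp_def, a4, a5, a6] at a2
  simp only [a3] at a1
  replace a1 := a1.comp hn2.tendsto_atTop
  simp only [Function.comp_def] at a1
  set h : ℕ → ℝ := fun i => 1 / ((n1 (n2 i) : ℝ) + 1) with hh
  have hpos : ∀ i, 0 < h i := fun i => by positivity
  have h0 : Tendsto h atTop (𝓝 0) := tendsto_one_div_add_atTop_nhds_zero_nat.comp
    (hn1.tendsto_atTop.comp hn2.tendsto_atTop)
  have hlim : Tendsto (fun i => u (x + h i) - u x) atTop (𝓝 0) := by
    have := h0.mul a1
    rw [zero_mul] at this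
    refine this.congr fun i => ?_
    rw [← mul_assoc, mul_inv_cancel₀ (hpos i).ne', one_mul]
  have hd : HasDerivAt g (deriv g (u x)) (u x) :=
    (hg.differentiable one_ne_zero).differentiableAt.hasDerivAt
  have h3 := (hasFDerivWithinAt_univ.2 hd.hasFDerivAt).lim (c := fun i => (h i)⁻¹)
    (d := fun i => u (x + h i) - u x) (l := atTop) (v := D x) hlim
    (Eventually.of_forall fun _ => mem_univ _) a1
  simp only [add_sub_cancel, smul_eq_mul] at h3
  have h4 := tendsto_nhds_unique a2 h3
  rw [h4]; simp [mul_comm]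

/-- A function is in `H^r` if its derivative is in `H^{r-1}`. -/
lemma mem_sobBall_of_deriv {r A B : ℝ} (hr : 1 ≤ r) {F F' : ComplexL2} (hF : ‖F‖ ≤ A)
    (hF' : F' ∈ SobBall (r - 1) B)
    (h : F' =ᵐ[volume] fun ξ => ((2 * Real.pi * ξ : ℝ) * Complex.I) * F ξ) :
    F ∈ SobBall r (2 ^ (r / 2) * A + 2 * B) := by
  have hA : 0 ≤ A := (norm_nonneg _).trans hF
  have hB := sobBall_nonneg hF'
  obtain ⟨X, hX, hXF⟩ := hF'
  rw [mem_sobBall_iff (by linarith) (by positivity)]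
  have hb := bddR_jb (σ := -(r - 1)) (by linarith)
  have hpt : ∀ᵐ ξ, ‖(jb r ξ : ℂ) * F ξ‖ ≤ ‖2 ^ (r / 2) * ‖F ξ‖ + 2 * ‖X ξ‖‖ := by
    filter_upwards [h, mulR_coe hb X] with ξ h1 h2
    rw [hXF, h1] at h2
    have h3 : |2 * Real.pi * ξ| * ‖F ξ‖ = jb (-(r - 1)) ξ * ‖X ξ‖ := by
      have := congrArg norm h2
      simpa only [norm_mul, Complex.norm_real, Complex.norm_I, mul_one, Real.norm_eq_abs,
        abs_of_pos (jb_pos _ ξ), abs_mul] using this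
    have h4 : jb (r - 1) ξ * (|2 * Real.pi * ξ| * ‖F ξ‖) = ‖X ξ‖ := by
      rw [h3, ← mul_assoc, mul_comm (jb (r - 1) ξ), jb_neg_mul, one_mul]
    rw [norm_mul, Complex.norm_real, Real.norm_of_nonneg (jb_pos _ _).le,
      Real.norm_of_nonneg (by positivity)]
    -- Low frequencies are controlled by `F` itself, high ones by its derivative.
    rcases le_total |2 * Real.pi * ξ| 1 with h5 | h5
    · have h6 : jb r ξ ≤ 2 ^ (r / 2) := by
        rw [jb_rpow]
        apply Real.rpow_le_rpow (by positivity) _ (by linarith)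
        have : (2 * Real.pi * ξ) ^ 2 ≤ 1 := by rwa [sq_le_one_iff_abs_le_one]
        linarith
      have := mul_le_mul_of_nonneg_right h6 (norm_nonneg (F ξ))
      linarith [norm_nonneg (X ξ)]
    · have h6 : jb r ξ ≤ jb (r - 1) ξ * (2 * |2 * Real.pi * ξ|) := by
        have : jb r ξ = jb (r - 1) ξ * jb 1 ξ := by rw [← jb_add]; congr 1; ring
        rw [this]
        apply mul_le_mul_of_nonneg_left _ (jb_pos _ _).le
        linarith [jb_one_le ξ]
      have := mul_le_mul_of_nonneg_right h6 (norm_nonneg (F ξ))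
      have h7 : (0 : ℝ) ≤ 2 ^ (r / 2) * ‖F ξ‖ := by positivity
      nlinarith
  refine (eLpNorm_mono_ae hpt).trans ?_
  have m1 : AEStronglyMeasurable (fun ξ => 2 ^ (r / 2) * ‖F ξ‖) volume :=
    (Lp.memLp F).1.norm.const_mul _
  have m2 : AEStronglyMeasurable (fun ξ => 2 * ‖X ξ‖) volume := (Lp.memLp X).1.norm.const_mul _
  refine (eLpNorm_add_le m1 m2 (by norm_num)).trans ?_
  have e : ∀ (c : ℝ) (G : ComplexL2) (K : ℝ), 0 ≤ c → ‖G‖ ≤ K →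
      eLpNorm (fun ξ => c * ‖G ξ‖) 2 volume ≤ ENNReal.ofReal (c * K) := by
    intro c G K hc hG
    change eLpNorm (c • fun ξ => ‖G ξ‖) 2 volume ≤ _
    rw [eLpNorm_const_smul, eLpNorm_norm, ← Lp.enorm_def, ← ofReal_norm, ← ofReal_norm,
      ← ENNReal.ofReal_mul (norm_nonneg _), Real.norm_of_nonneg hc]
    exact ENNReal.ofReal_le_ofReal (mul_le_mul_of_nonneg_left hG hc)
  rw [ENNReal.ofReal_add (by positivity) (by positivity)]
  exact add_le_add (e _ F A (by positivity) hF) (e 2 X B (by norm_num) hX)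

lemma deriv_mem_sobBall {r M : ℝ} (hr : 1 ≤ r) {F F' : ComplexL2} (hF : F ∈ SobBall r M)
    (h : F' =ᵐ[volume] fun ξ => ((2 * Real.pi * ξ : ℝ) * Complex.I) * F ξ) :
    F' ∈ SobBall (r - 1) M := by
  have hM := sobBall_nonneg hF
  rw [mem_sobBall_iff (by linarith) hM] at hF
  rw [mem_sobBall_iff (by linarith) hM]
  refine (eLpNorm_mono_ae ?_).trans hF
  filter_upwards [h] with ξ h1
  have e : jb r ξ = jb (r - 1) ξ * jb 1 ξ := by rw [← jb_add]; congr 1; ring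
  rw [h1, e]
  rw [norm_mul, norm_mul, norm_mul, Complex.norm_I, mul_one, norm_mul, Complex.norm_real,
    Complex.norm_real, Complex.norm_real, Real.norm_of_nonneg (mul_pos (jb_pos _ ξ)
      (jb_pos 1 ξ)).le,
    Real.norm_of_nonneg (jb_pos _ ξ).le, Real.norm_eq_abs, ← mul_assoc]
  exact mul_le_mul_of_nonneg_right
    (mul_le_mul_of_nonneg_left (abs_le_jb_one ξ) (jb_pos (r - 1) ξ).le) (norm_nonneg _)

/-- Composition with a `C^n` function that vanishes at `0` is bounded on bounded sets of `H^r`, if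
`1 ≤ r ≤ n`. Induction on `n`: the derivative of `g ∘ u` is `(g' ∘ u - g'(0)) u' + g'(0) u'`, to
which the product estimate applies. -/
theorem exists_compR_mem_sobBall (n : ℕ) : ∀ g : ℝ → ℝ, ContDiff ℝ n g → g 0 = 0 → ∀ r : ℝ,
    1 ≤ r → r ≤ n → ∀ M, ∃ C, ∀ u : RealL2, fr u ∈ SobBall r M →
      fr (compR g u) ∈ SobBall r C := by
  induction n with
  | zero =>
    intro g _ _ r h1 h2
    simp only [Nat.cast_zero] at h2
    linarith
  | succ n ih =>
    intro g hg g0 r hr hrn M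
    have hg1 : ContDiff ℝ 1 g := hg.of_le (by norm_cast; omega)
    obtain ⟨Cs, hCs, hsob⟩ := exists_ae_abs_le (r := r) (by linarith)
    obtain ⟨L, hL0, hL⟩ := exists_lipOn hg1 (Cs * M)
    rcases hr.eq_or_lt with rfl | hr1
    · exact ⟨L * M, fun u hu => compR_mem_sobBall_one hg1.continuous g0 hL0 hL (hsob M u hu) hu⟩
    have hn1 : (1 : ℝ) ≤ n := by
      have : (1 : ℝ) < (n + 1 : ℕ) := lt_of_lt_of_le hr1 hrn
      have : 1 < n + 1 := by exact_mod_cast this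
      exact_mod_cast Nat.lt_succ_iff.1 this
    have hgd : ContDiff ℝ n (deriv g) := by
      have : ContDiff ℝ ((n : WithTop ℕ∞) + 1) g := by exact_mod_cast hg
      exact (contDiff_succ_iff_deriv.1 this).2.2
    -- As `g'` need not vanish at `0`, the constant `g'(0)` is split off.
    set g1 : ℝ → ℝ := fun p => deriv g p - deriv g 0 with hg1def
    have hg1c : ContDiff ℝ n g1 := hgd.sub contDiff_const
    have hg11 : ContDiff ℝ 1 g1 := hg1c.of_le (by exact_mod_cast hn1)
    obtain ⟨L1, _, hL1⟩ := exists_lipOn hg11 (Cs * M)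
    -- The product estimate needs more than half a derivative of `g1 ∘ u`, which `r - 1` may fail
    -- to provide; order `1` is available as `1 ≤ r`.
    set r' := max 1 (r - 1) with hr'
    have hr'n : r' ≤ n := max_le hn1 (by push_cast at hrn; linarith)
    obtain ⟨Cf, hCf⟩ := ih g1 hg1c (sub_self _) r' (le_max_left _ _) hr'n M
    obtain ⟨K, hK0, hK⟩ := exists_product_mem_sobBall (a := r - 1) (r := r') (by linarith)
      (le_max_right _ _) (lt_of_lt_of_le (by norm_num) (le_max_left _ _))
    refine ⟨2 ^ (r / 2) * (L * M) + 2 * (K * Cf * M + |deriv g 0| * M), fun u hu => ?_⟩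
    have hub := hsob M u hu
    have hu1 : fr u ∈ SobBall 1 M := sobBall_mono zero_le_one hr le_rfl hu
    have hur' : fr u ∈ SobBall r' M :=
      sobBall_mono (le_trans zero_le_one (le_max_left _ _)) (max_le hr (by linarith)) le_rfl hu
    obtain ⟨D, hD, hDlim⟩ := exists_deriv hu1
    obtain ⟨D', hD', hDlim'⟩ := exists_deriv
      (compR_mem_sobBall_one hg1.continuous g0 hL0 hL hub hu1)
    have hchain := chain_rule hg1 g0 hL hub hDlim hDlim'
    have hDs : fr D ∈ SobBall (r - 1) M := deriv_mem_sobBall hr hu hD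
    have hp0 : fr (D' - deriv g 0 • D) ∈ SobBall (r - 1) (K * Cf * M) := by
      refine hK Cf M (compR g1 u) D _ (hCf u hur') hDs ?_
      filter_upwards [hchain, compR_coe hg11.continuous (sub_self _) hL1 hub,
        Lp.coeFn_sub D' (deriv g 0 • D), Lp.coeFn_smul (deriv g 0) D] with x h1 h2 h3 h4
      rw [h3, Pi.sub_apply, h4, Pi.smul_apply, h1, h2, hg1def, smul_eq_mul]; ring
    have hD's : fr D' ∈ SobBall (r - 1) (K * Cf * M + |deriv g 0| * M) := by
      have e : fr D' = fr (D' - deriv g 0 • D) + deriv g 0 • fr D := by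
        rw [LinearIsometry.map_sub, LinearIsometry.map_smul, sub_add_cancel]
      rw [e]
      exact sobBall_add hp0 (sobBall_rsmul _ hDs)
    refine mem_sobBall_of_deriv hr ?_ hD's hD'
    rw [fr.norm_map]
    refine (norm_compR_le hg1.continuous g0 hL hub).trans ?_
    have := norm_le_of_mem_sobBall zero_le_one hu1
    rw [fr.norm_map] at this
    gcongr

/-! ### Ordinary differential equations whose field is tame on Sobolev balls -/

section Projection

variable {H : Type*} [NormedAddCommGroup H] [InnerProductSpace ℝ H] [CompleteSpace H]

/-- A nonempty closed convex set of a Hilbert space is a nonexpansive retract. -/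
lemma exists_nonexpansive_retraction {K : Set H} (ne : K.Nonempty) (hc : IsClosed K)
    (hK : Convex ℝ K) : ∃ P : H → H, (∀ x, P x ∈ K) ∧ (∀ x ∈ K, P x = x) ∧
      ∀ x y, ‖P x - P y‖ ≤ ‖x - y‖ := by
  choose P hP h using exists_norm_eq_iInf_of_complete_convex ne hc.isComplete hK
  have hi : ∀ u, ∀ w ∈ K, inner ℝ (u - P u) (w - P u) ≤ 0 := fun u =>
    (norm_eq_iInf_iff_real_inner_le_zero hK (hP u)).1 (h u)
  refine ⟨P, hP, fun x hx => ?_, fun x y => ?_⟩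
  · have h1 := hi x x hx
    rw [real_inner_self_eq_norm_sq] at h1
    have h2 : ‖x - P x‖ = 0 := by nlinarith [norm_nonneg (x - P x)]
    exact (sub_eq_zero.1 (norm_eq_zero.1 h2)).symm
  · have h1 := hi x (P y) (hP y)
    have h2 := hi y (P x) (hP x)
    have h3 : ‖P x - P y‖ ^ 2 ≤ inner ℝ (x - y) (P x - P y) := by
      rw [← real_inner_self_eq_norm_sq]
      have e : inner ℝ (x - y) (P x - P y) - inner ℝ (P x - P y) (P x - P y)
          = -(inner ℝ (x - P x) (P y - P x) + inner ℝ (y - P y) (P x - P y)) := by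
        simp only [inner_sub_left, inner_sub_right]; ring
      linarith
    have h4 := real_inner_le_norm (x - y) (P x - P y)
    by_contra hlt
    push Not at hlt
    nlinarith [norm_nonneg (x - y), norm_nonneg (P x - P y)]

end Projection

/-- A time dependent vector field on `L²` which maps bounded sets of the Sobolev space of order `r`
to bounded sets, is Lipschitz continuous on them for the `L²` norm, and is continuous in time. -/
structure TameField (r : ℝ) (Φ : ℝ → ComplexL2 → ComplexL2) : Prop where
  bounded : ∀ M, ∃ C, 0 ≤ C ∧ ∀ t, ∀ W ∈ SobBall r M, Φ t W ∈ SobBall r C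
  lipschitz : ∀ M, ∃ L, 0 ≤ L ∧ ∀ t, ∀ W ∈ SobBall r M, ∀ W' ∈ SobBall r M,
    ‖Φ t W - Φ t W'‖ ≤ L * ‖W - W'‖
  continuous : ∀ M, ∀ W ∈ SobBall r M, Continuous fun t => Φ t W

/-- `W` solves `W' = Φ(t, W)`, `W(0) = W₀` on `[0,T]`, and stays in a bounded set of the Sobolev
space of order `r`. -/
structure IsSol (r : ℝ) (Φ : ℝ → ComplexL2 → ComplexL2) (W₀ : ComplexL2) (T : ℝ)
    (W : ℝ → ComplexL2) : Prop where
  initial : W 0 = W₀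
  bounded : ∃ M, ∀ t ∈ Icc 0 T, W t ∈ SobBall r M
  deriv : ∀ t ∈ Icc 0 T, HasDerivWithinAt W (Φ t (W t)) (Icc 0 T) t

lemma hasDerivWithinAt_Ici {H : Type*} [NormedAddCommGroup H] [NormedSpace ℝ H]
    {f : ℝ → H} {f' : H} {a b t : ℝ}
    (h : HasDerivWithinAt f f' (Icc a b) t) (ht : t ∈ Ico a b) :
    HasDerivWithinAt f f' (Ici t) t :=
  h.mono_of_mem_nhdsWithin (Icc_mem_nhdsGE_of_mem ht)

/-- The mean value inequality in a Sobolev norm, for a function which is differentiable in `L²`. -/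
lemma mem_sobBall_of_hasDerivWithinAt {r : ℝ} (hr : 0 ≤ r) {W W' : ℝ → ComplexL2} {a b M C : ℝ}
    (hW : ∀ t ∈ Icc a b, HasDerivWithinAt W (W' t) (Icc a b) t) (hM : W a ∈ SobBall r M)
    (hC : ∀ t ∈ Icc a b, W' t ∈ SobBall r C) {t : ℝ} (ht : t ∈ Icc a b) :
    W t ∈ SobBall r (M + C * (t - a)) := by
  rw [mem_sobBall_iff_cut hr]
  intro n
  have h1 := (mem_sobBall_iff_cut hr _).1 hM n
  have h2 := norm_image_sub_le_of_norm_deriv_le_segment' (f := fun t => mulR (cutJb r n) (W t))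
    (f' := fun t => mulR (cutJb r n) (W' t)) (C := C) (a := a) (b := b)
    (fun x hx =>
      ((mulR (cutJb r n)).restrictScalars ℝ).hasFDerivAt.comp_hasDerivWithinAt x (hW x hx))
    (fun x hx => (mem_sobBall_iff_cut hr _).1 (hC x (Ico_subset_Icc_self hx)) n) t ht
  have h3 := norm_le_norm_add_norm_sub' (mulR (cutJb r n) (W t)) (mulR (cutJb r n) (W a))
  linarith

lemma mem_sobBall_sub_of_hasDerivWithinAt {r : ℝ} (hr : 0 ≤ r) {W W' : ℝ → ComplexL2} {a b C : ℝ}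
    (hW : ∀ t ∈ Icc a b, HasDerivWithinAt W (W' t) (Icc a b) t)
    (hC : ∀ t ∈ Icc a b, W' t ∈ SobBall r C) {t : ℝ} (ht : t ∈ Icc a b) :
    W t - W a ∈ SobBall r (C * (t - a)) := by
  have h := mem_sobBall_of_hasDerivWithinAt hr (W := fun t => W t - W a) (M := 0)
    (fun t ht => (hW t ht).sub_const _) ⟨0, by simp, by simp⟩ hC ht
  simpa using h

variable {r : ℝ} {Φ : ℝ → ComplexL2 → ComplexL2} {W₀ : ComplexL2}

lemma IsSol.mono {T T' : ℝ} {W : ℝ → ComplexL2} (h : IsSol r Φ W₀ T W) (hT : T' ≤ T) :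
    IsSol r Φ W₀ T' W := by
  obtain ⟨M, hM⟩ := h.bounded
  have hs : Icc 0 T' ⊆ Icc 0 T := Icc_subset_Icc_right hT
  exact ⟨h.initial, ⟨M, fun t ht => hM t (hs ht)⟩, fun t ht => (h.deriv t (hs ht)).mono hs⟩

lemma IsSol.congr {T : ℝ} {W W' : ℝ → ComplexL2} (hT : 0 ≤ T) (h : IsSol r Φ W₀ T W)
    (he : ∀ t ∈ Icc 0 T, W' t = W t) : IsSol r Φ W₀ T W' := by
  obtain ⟨M, hM⟩ := h.bounded
  refine ⟨by rw [he 0 ⟨le_rfl, hT⟩, h.initial], ⟨M, fun t ht => by rw [he t ht]; exact hM t ht⟩,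
    fun t ht => ?_⟩
  rw [he t ht]
  exact (h.deriv t ht).congr_of_mem he ht

lemma IsSol.continuousOn {T : ℝ} {W : ℝ → ComplexL2} (h : IsSol r Φ W₀ T W) :
    ContinuousOn W (Icc 0 T) := fun t ht => (h.deriv t ht).continuousWithinAt

lemma IsSol.unique (hr : 0 ≤ r) (hΦ : TameField r Φ) {T : ℝ} {W W' : ℝ → ComplexL2}
    (h : IsSol r Φ W₀ T W) (h' : IsSol r Φ W₀ T W') : EqOn W W' (Icc 0 T) := by
  obtain ⟨M, hM⟩ := h.bounded
  obtain ⟨M', hM'⟩ := h'.bounded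
  obtain ⟨L, hL0, hL⟩ := hΦ.lipschitz (max M M')
  refine ODE_solution_unique_of_mem_Icc_right (v := Φ) (s := fun _ => SobBall r (max M M'))
    (K := ⟨L, hL0⟩) (fun t _ => LipschitzOnWith.of_dist_le_mul fun x hx y hy => ?_)
    h.continuousOn (fun t ht => hasDerivWithinAt_Ici (h.deriv t (Ico_subset_Icc_self ht)) ht)
    (fun t ht => sobBall_mono hr le_rfl (le_max_left _ _) (hM t (Ico_subset_Icc_self ht)))
    h'.continuousOn (fun t ht => hasDerivWithinAt_Ici (h'.deriv t (Ico_subset_Icc_self ht)) ht)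
    (fun t ht => sobBall_mono hr le_rfl (le_max_right _ _) (hM' t (Ico_subset_Icc_self ht)))
    (h.initial.trans h'.initial.symm)
  rw [dist_eq_norm, dist_eq_norm]
  exact hL t x hx y hy

/-- Solutions of the equation whose field has been truncated outside a Sobolev ball. -/
lemma exists_truncated (hΦ : TameField r Φ) {P : ComplexL2 → ComplexL2} {M : ℝ}
    (hP : ∀ x, P x ∈ SobBall r M) (hP' : ∀ x y, ‖P x - P y‖ ≤ ‖x - y‖) (hr : 0 ≤ r)
    (W₀ : ComplexL2) {T : ℝ} (hT : 0 ≤ T) :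
    ∃ X : ℝ → ComplexL2, X 0 = W₀ ∧
      ∀ t ∈ Icc 0 T, HasDerivWithinAt X (Φ t (P (X t))) (Icc 0 T) t := by
  obtain ⟨C, hC0, hC⟩ := hΦ.bounded M
  obtain ⟨L, hL0, hL⟩ := hΦ.lipschitz M
  have hpl : IsPicardLindelof (fun t x => Φ t (P x)) (tmin := 0) (tmax := T) ⟨0, le_rfl, hT⟩ W₀
      ⟨C * T, mul_nonneg hC0 hT⟩ 0 ⟨C, hC0⟩ ⟨L, hL0⟩ := by
    refine ⟨fun t _ => LipschitzOnWith.of_dist_le_mul fun x _ y _ => ?_,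
      fun x _ => (hΦ.continuous M _ (hP x)).continuousOn,
      fun t _ x _ => norm_le_of_mem_sobBall hr (hC t _ (hP x)), ?_⟩
    · rw [dist_eq_norm, dist_eq_norm]
      exact (hL t _ (hP x) _ (hP y)).trans (mul_le_mul_of_nonneg_left (hP' x y) hL0)
    · simp only [sub_zero, sub_self, max_eq_left hT, NNReal.coe_zero]
      exact le_rfl
  exact hpl.exists_eq_forall_mem_Icc_hasDerivWithinAt₀

lemma isSol_zero {M : ℝ} (hW₀ : W₀ ∈ SobBall r M) : IsSol r Φ W₀ 0 fun _ => W₀ := by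
  refine ⟨rfl, ⟨M, fun _ _ => hW₀⟩, fun t ht => ?_⟩
  rw [Icc_self] at ht ⊢
  rw [mem_singleton_iff.1 ht]
  exact hasDerivWithinAt_iff_hasFDerivWithinAt.2 .singleton

/-- The time by which a solution can be extended depends only on its Sobolev norm. -/
lemma exists_extension (hr : 0 ≤ r) (hΦ : TameField r Φ) (M : ℝ) : ∃ δ > 0, ∀ W₀ T W, 0 ≤ T →
    IsSol r Φ W₀ T W → (∀ t ∈ Icc 0 T, W t ∈ SobBall r M) →
      ∃ X, IsSol r Φ W₀ (T + δ) X := by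
  obtain ⟨C, hC0, hC⟩ := hΦ.bounded (M + 1)
  obtain ⟨L, hL0, hL⟩ := hΦ.lipschitz (M + 1)
  refine ⟨1 / (C + 1), by positivity, fun W₀ T W hT hW hM => ?_⟩
  set δ := 1 / (C + 1) with hδ
  have hδ0 : 0 < δ := by positivity
  have hCδ : C * δ ≤ 1 := by rw [hδ, mul_one_div, div_le_one (by positivity)]; linarith
  have hM1 : SobBall r M ⊆ SobBall r (M + 1) := sobBall_mono hr le_rfl (by linarith)
  -- The field is composed with the retraction onto the ball of radius `M + 1`, so that it is
  -- globally Lipschitz continuous. Up to time `δ` after `T` the solution does not leave this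
  -- ball, and there the retraction does nothing.
  obtain ⟨P, hP1, hP2, hP3⟩ := exists_nonexpansive_retraction (K := SobBall r (M + 1))
    ⟨_, hM1 (hM 0 ⟨le_rfl, hT⟩)⟩ (isClosed_sobBall hr) convex_sobBall
  obtain ⟨X, hX0, hX⟩ := exists_truncated hΦ hP1 hP3 hr W₀ (T := T + δ) (by positivity)
  have hsub : Icc 0 T ⊆ Icc 0 (T + δ) := Icc_subset_Icc_right (by linarith)
  have hXd : ∀ t ∈ Icc 0 T, HasDerivWithinAt X (Φ t (P (X t))) (Icc 0 T) t := fun t ht =>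
    (hX t (hsub ht)).mono hsub
  have heq : EqOn X W (Icc 0 T) := by
    refine ODE_solution_unique_of_mem_Icc_right (v := fun t x => Φ t (P x)) (s := fun _ => univ)
      (K := ⟨L, hL0⟩) (fun t _ => LipschitzOnWith.of_dist_le_mul fun x _ y _ => ?_)
      (fun t ht => (hXd t ht).continuousWithinAt)
      (fun t ht => hasDerivWithinAt_Ici (hXd t (Ico_subset_Icc_self ht)) ht)
      (fun t _ => mem_univ _) hW.continuousOn
      (fun t ht => ?_)
      (fun t _ => mem_univ _) (hX0.trans hW.initial.symm)
    · rw [dist_eq_norm, dist_eq_norm]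
      exact (hL t _ (hP1 x) _ (hP1 y)).trans (mul_le_mul_of_nonneg_left (hP3 x y) hL0)
    · have ht' := Ico_subset_Icc_self ht
      rw [hP2 _ (hM1 (hM t ht'))]
      exact hasDerivWithinAt_Ici (hW.deriv t ht') ht
  have hmem : ∀ t ∈ Icc 0 (T + δ), X t ∈ SobBall r (M + 1) := by
    intro t ht
    rcases le_total t T with h | h
    · rw [heq ⟨ht.1, h⟩]; exact hM1 (hM t ⟨ht.1, h⟩)
    · have hsub' : Icc T (T + δ) ⊆ Icc 0 (T + δ) := Icc_subset_Icc_left hT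
      have hT' : T ∈ Icc 0 T := ⟨hT, le_rfl⟩
      have := mem_sobBall_of_hasDerivWithinAt hr (a := T) (b := T + δ) (M := M) (C := C)
        (fun t ht => (hX t (hsub' ht)).mono hsub') (by rw [heq hT']; exact hM T hT')
        (fun t ht => hC t _ (hP1 _)) ⟨h, ht.2⟩
      refine sobBall_mono hr le_rfl ?_ this
      have h1 : C * (t - T) ≤ C * δ := mul_le_mul_of_nonneg_left (by linarith [ht.2]) hC0
      linarith
  refine ⟨X, hX0, ⟨M + 1, hmem⟩, fun t ht => ?_⟩
  have h := hX t ht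
  rwa [hP2 _ (hmem t ht)] at h

/-- If the equation has no global solution, then it has a solution on a maximal interval `[0,T)`,
which is not bounded in the Sobolev space of order `r`. -/
theorem exists_maximal_isSol (hr : 0 ≤ r) (hΦ : TameField r Φ) {M₀ : ℝ} (hW₀ : W₀ ∈ SobBall r M₀)
    {B : ℝ} (hB : ∀ T W, IsSol r Φ W₀ T W → T ≤ B) :
    ∃ T > 0, ∃ W, (∀ T' < T, IsSol r Φ W₀ T' W) ∧ ∀ M, ¬ ∀ t ∈ Ico 0 T, W t ∈ SobBall r M := by
  set S : Set ℝ := {T | 0 ≤ T ∧ ∃ W, IsSol r Φ W₀ T W} with hS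
  have hbdd : BddAbove S := ⟨B, fun T ⟨_, W, h⟩ => hB T W h⟩
  have h0 : (0 : ℝ) ∈ S := ⟨le_rfl, _, isSol_zero hW₀⟩
  set T := sSup S with hT
  have hlt : ∀ T' < T, ∃ W, IsSol r Φ W₀ T' W := by
    intro T' h
    obtain ⟨T₁, ⟨_, W, hW⟩, h2⟩ := exists_lt_of_lt_csSup ⟨0, h0⟩ h
    exact ⟨W, hW.mono h2.le⟩
  have hT0 : 0 < T := by
    obtain ⟨δ, hδ, h⟩ := exists_extension hr hΦ M₀
    obtain ⟨X, hX⟩ := h W₀ 0 _ le_rfl (isSol_zero hW₀) (fun _ _ => hW₀)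
    exact lt_of_lt_of_le (by linarith) (le_csSup hbdd ⟨by linarith, X, hX⟩)
  have hmid : ∀ t : ℝ, ∃ W, t < T → IsSol r Φ W₀ ((t + T) / 2) W := by
    intro t
    by_cases h : t < T
    · obtain ⟨W, hW⟩ := hlt ((t + T) / 2) (by linarith)
      exact ⟨W, fun _ => hW⟩
    · exact ⟨fun _ => 0, fun h' => absurd h' h⟩
  -- The solutions on the intervals `[0, T']` agree where they are defined; `V t` is one that
  -- exists beyond `t`.
  choose V hV using hmid
  have hsol0 : ∀ T' < T, 0 ≤ T' → IsSol r Φ W₀ T' fun t => V t t := by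
    intro T' h h0'
    refine ((hV T' h).mono (by linarith)).congr h0' fun t ht => ?_
    have h1 : t < T := lt_of_le_of_lt ht.2 h
    exact ((hV t h1).mono (by linarith)).unique hr hΦ
      ((hV T' h).mono (T' := t) (by linarith [ht.2])) ⟨ht.1, le_rfl⟩
  have hsol : ∀ T' < T, IsSol r Φ W₀ T' fun t => V t t := fun T' h =>
    (hsol0 (max T' 0) (max_lt h hT0) (le_max_right _ _)).mono (le_max_left _ _)
  refine ⟨T, hT0, fun t => V t t, hsol, fun M hM => ?_⟩
  obtain ⟨δ, hδ, h⟩ := exists_extension hr hΦ M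
  -- Starting from a time closer to `T` than `δ`, the solution would extend beyond `T`.
  set T' := max 0 (T - δ / 2)
  have hT' : T' < T := max_lt hT0 (by linarith)
  obtain ⟨X, hX⟩ := h W₀ T' _ (le_max_left _ _) (hsol T' hT') fun t ht =>
    hM t ⟨ht.1, lt_of_le_of_lt ht.2 hT'⟩
  have h1 : T' + δ ≤ T := le_csSup hbdd ⟨by positivity, X, hX⟩
  linarith [le_max_right 0 (T - δ / 2)]

/-- Grönwall's inequality in a Sobolev norm. The norm need not be known to depend continuously on
time: the best constant `m` in `‖W(t)‖ ≤ m exp (2 L t)` is halved by integration. -/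
theorem IsSol.growth (hr : 0 ≤ r) {T L C M₀ : ℝ} {W : ℝ → ComplexL2} (h : IsSol r Φ W₀ T W)
    (hL : 0 < L) (hC : 0 ≤ C) (hW₀ : W₀ ∈ SobBall r M₀)
    (hΦ : ∀ t ∈ Icc 0 T, ∀ m, W t ∈ SobBall r m → Φ t (W t) ∈ SobBall r (L * m + C)) :
    ∀ t ∈ Icc 0 T, W t ∈ SobBall r (2 * (M₀ + C * T) * Real.exp (2 * L * t)) := by
  intro t₀ ht₀
  have hT : 0 ≤ T := ht₀.1.trans ht₀.2
  have hM₀ := sobBall_nonneg hW₀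
  set A := M₀ + C * T with hA
  -- By the mean value inequality, since `L m ∫₀ᵗ exp (2 L τ) dτ ≤ (m / 2) exp (2 L t)`.
  have step : ∀ m, 0 ≤ m → (∀ t ∈ Icc 0 T, W t ∈ SobBall r (m * Real.exp (2 * L * t))) →
      ∀ t ∈ Icc 0 T, W t ∈ SobBall r ((A + m / 2) * Real.exp (2 * L * t)) := by
    intro m hm0 hm t ht
    rw [mem_sobBall_iff_cut hr]
    intro n
    have hd : ∀ x ∈ Icc 0 T, HasDerivWithinAt (fun t => mulR (cutJb r n) (W t))
        (mulR (cutJb r n) (Φ x (W x))) (Icc 0 T) x := fun x hx =>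
      ((mulR (cutJb r n)).restrictScalars ℝ).hasFDerivAt.comp_hasDerivWithinAt x (h.deriv x hx)
    have hBd : ∀ x, HasDerivAt (fun t => M₀ + C * t + m / 2 * Real.exp (2 * L * t))
        (C + m / 2 * (Real.exp (2 * L * x) * (2 * L))) x := by
      intro x
      have h1 : HasDerivAt (fun t : ℝ => 2 * L * t) (2 * L) x := by
        simpa using (hasDerivAt_id x).const_mul (2 * L)
      have h2 : HasDerivAt (fun t : ℝ => M₀ + C * t) C x := by
        simpa using ((hasDerivAt_id x).const_mul C).const_add M₀
      exact h2.add (h1.exp.const_mul (m / 2))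
    have h0 := (mem_sobBall_iff_cut hr _).1 hW₀ n
    have key := image_norm_le_of_norm_deriv_right_le_deriv_boundary
      (fun x hx => (hd x hx).continuousWithinAt)
      (fun x hx => hasDerivWithinAt_Ici (hd x (Ico_subset_Icc_self hx)) hx) (B := fun t =>
        M₀ + C * t + m / 2 * Real.exp (2 * L * t)) (B' := fun x =>
        C + m / 2 * (Real.exp (2 * L * x) * (2 * L))) (by
          rw [h.initial]; simp; linarith) hBd (fun x hx => by
          have hx' := Ico_subset_Icc_self hx
          refine ((mem_sobBall_iff_cut hr _).1 (hΦ x hx' _ (hm x hx')) n).trans (le_of_eq ?_)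
          ring) ht
    refine key.trans ?_
    have h1 : 1 ≤ Real.exp (2 * L * t) := Real.one_le_exp (mul_nonneg (by linarith) ht.1)
    have h2 : C * t ≤ C * T := mul_le_mul_of_nonneg_left ht.2 hC
    have h3 : 0 ≤ A := by positivity
    nlinarith
  obtain ⟨m₀, hm₀⟩ := h.bounded
  have hm₀0 : 0 ≤ m₀ := sobBall_nonneg (hm₀ t₀ ht₀)
  have hA0 : 0 ≤ A := by positivity
  have iter : ∀ k : ℕ, ∀ t ∈ Icc 0 T,
      W t ∈ SobBall r ((2 * A + m₀ * (1 / 2) ^ k) * Real.exp (2 * L * t)) := by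
    intro k
    induction k with
    | zero =>
      intro t ht
      refine sobBall_mono hr le_rfl ?_ (hm₀ t ht)
      have h1 : 1 ≤ Real.exp (2 * L * t) := Real.one_le_exp (mul_nonneg (by linarith) ht.1)
      rw [pow_zero]; nlinarith
    | succ k ih =>
      have h1 := step _ (by positivity) ih
      intro t ht
      have h2 := h1 t ht
      have e : A + (2 * A + m₀ * (1 / 2) ^ k) / 2 = 2 * A + m₀ * (1 / 2) ^ (k + 1) := by
        rw [pow_succ]; ring
      rwa [e] at h2
  rw [mem_sobBall_iff_cut hr]
  intro n
  have hlim : Tendsto (fun k : ℕ => (2 * A + m₀ * (1 / 2 : ℝ) ^ k) * Real.exp (2 * L * t₀)) atTop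
      (𝓝 ((2 * A + m₀ * 0) * Real.exp (2 * L * t₀))) :=
    (((tendsto_pow_atTop_nhds_zero_of_lt_one (by norm_num) (by norm_num)).const_mul m₀).const_add
      (2 * A)).mul_const _
  rw [mul_zero, add_zero] at hlim
  exact ge_of_tendsto' hlim fun k => (mem_sobBall_iff_cut hr _).1 (iter k t₀ ht₀) n

/-! ### The first order form of the equation -/

/-- The assumptions on the parameters, the symbol and the nonlinearity. -/
structure WaveData (ρ s c₁ c₂ : ℝ) (l g : ℝ → ℝ) : Prop where
  two_le : 2 ≤ ρ
  half_lt : 1 / 2 < s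
  c₁_pos : 0 < c₁
  c₂_pos : 0 < c₂
  meas : Measurable l
  even : ∀ η, l (-η) = l η
  lower : ∀ η, c₁ ^ 2 * (1 + η ^ 2) ^ (ρ / 2) ≤ l η
  upper : ∀ η, l η ≤ c₂ ^ 2 * (1 + η ^ 2) ^ (ρ / 2)
  contDiff : ContDiff ℝ ((⌊s⌋₊ + 1 : ℕ) : WithTop ℕ∞) g
  zero : g 0 = 0

/-- The regularity `κ = max (s - ρ/2) 0` in which `(K u, Λ⁻¹ u_t)` is controlled. -/
def kap (ρ s : ℝ) : ℝ := max (s - ρ / 2) 0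

/-- The symbol `√l` as a function of the frequency `ξ`. -/
def sl (l : ℝ → ℝ) (ξ : ℝ) : ℝ := sqrtSymbol l (2 * Real.pi * ξ)

/-- The dispersion relation `ω = |η| √l`. -/
def om (l : ℝ → ℝ) (ξ : ℝ) : ℝ := |2 * Real.pi * ξ| * sl l ξ

/-- The symbol `(1 + η²)^{1/2} / √l`. -/
def su (l : ℝ → ℝ) (ξ : ℝ) : ℝ := jb 1 ξ / sl l ξ

/-- The symbol `|η| / (1 + η²)^{1/2}`. -/
def ab (ξ : ℝ) : ℝ := |2 * Real.pi * ξ| * jb (-1) ξ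

/-- The symbol of the group `exp (i t ω)`. -/
def rotSym (l : ℝ → ℝ) (t ξ : ℝ) : ℂ := Complex.exp ((t * om l ξ : ℝ) * Complex.I)

/-- The group `exp (i t ω)`. -/
def rot (l : ℝ → ℝ) (t : ℝ) : ComplexL2 →L[ℂ] ComplexL2 := mulL2 (rotSym l t)

/-- The function `u` as a function of the unknown `y = (1 + η²)^{-1/2} (√l û + i |η|⁻¹ v̂)`. -/
def uOf (l : ℝ → ℝ) (y : ComplexL2) : RealL2 := reInv (mulR (su l) y)

/-- The nonlinear term of the equation `y' = -i ω y + N(y)`. -/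
def nonlin (l g : ℝ → ℝ) (y : ComplexL2) : ComplexL2 :=
  -(Complex.I • mulR ab (fr (compR g (uOf l y))))

/-- The field of the equation for `W = exp (i t ω) y`. -/
def field (l g : ℝ → ℝ) (t : ℝ) (W : ComplexL2) : ComplexL2 :=
  rot l t (nonlin l g (rot l (-t) W))

lemma kap_nonneg (ρ s : ℝ) : 0 ≤ kap ρ s := le_max_right _ _

lemma kap_add_one_nonneg (ρ s : ℝ) : 0 ≤ kap ρ s + 1 := by linarith [kap_nonneg ρ s]

lemma bddR_order (ρ s : ℝ) : BddR (jb (-(kap ρ s + 1))) :=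
  bddR_jb (neg_nonpos.2 (kap_add_one_nonneg ρ s))

lemma bddR_kap (ρ s : ℝ) : BddR (jb (-(kap ρ s))) := bddR_jb (neg_nonpos.2 (kap_nonneg ρ s))

lemma measurable_ab : Measurable ab :=
  (measurable_const.mul measurable_id).norm.mul (measurable_jb _)

lemma ab_nonneg (ξ : ℝ) : 0 ≤ ab ξ := mul_nonneg (abs_nonneg _) (jb_pos _ _).le

lemma ab_le_one (ξ : ℝ) : ab ξ ≤ 1 := by
  have h1 := mul_le_mul_of_nonneg_right (abs_le_jb_one ξ) (jb_pos (-1) ξ).le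
  have h2 := jb_neg_mul 1 ξ
  rw [ab]; linarith

lemma abs_ab_le_one (ξ : ℝ) : |ab ξ| ≤ 1 := by
  rw [abs_of_nonneg (ab_nonneg ξ)]; exact ab_le_one ξ

lemma bddR_ab : BddR ab := ⟨measurable_ab, 1, abs_ab_le_one⟩

lemma ab_even (ξ : ℝ) : ab (-ξ) = ab ξ := by simp [ab]

lemma norm_rotSym (l : ℝ → ℝ) (t ξ : ℝ) : ‖rotSym l t ξ‖ = 1 := Complex.norm_exp_ofReal_mul_I _

namespace WaveData

variable {ρ s c₁ c₂ : ℝ} {l g : ℝ → ℝ} (h : WaveData ρ s c₁ c₂ l g)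
include h

lemma g_one : ContDiff ℝ 1 g := h.contDiff.of_le (by norm_cast; omega)

lemma kap_add_one_le : kap ρ s + 1 ≤ (⌊s⌋₊ + 1 : ℕ) := by
  have := h.two_le
  push_cast
  have h1 : s < ⌊s⌋₊ + 1 := Nat.lt_floor_add_one s
  have h2 : kap ρ s ≤ ⌊s⌋₊ := max_le (by linarith) (Nat.cast_nonneg _)
  linarith

lemma meas_sl : Measurable (sl l) :=
  (h.meas.comp (measurable_const.mul measurable_id)).sqrt

lemma sl_even (ξ : ℝ) : sl l (-ξ) = sl l ξ := by
  simp [sl, sqrtSymbol, h.even]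

lemma le_sl (ξ : ℝ) : c₁ * jb (ρ / 2) ξ ≤ sl l ξ := by
  have h0 := h.c₁_pos
  have := jb_pos (ρ / 2) ξ
  apply Real.le_sqrt_of_sq_le
  rw [mul_pow, sq (jb _ _), ← jb_add, add_halves]
  exact h.lower _

lemma sl_le (ξ : ℝ) : sl l ξ ≤ c₂ * jb (ρ / 2) ξ := by
  have h0 := h.c₂_pos
  have := jb_pos (ρ / 2) ξ
  apply Real.sqrt_le_iff.2 ⟨by positivity, _⟩
  rw [mul_pow, sq (jb _ _), ← jb_add, add_halves]
  exact h.upper _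

lemma sl_pos (ξ : ℝ) : 0 < sl l ξ :=
  lt_of_lt_of_le (mul_pos h.c₁_pos (jb_pos _ _)) (h.le_sl ξ)

lemma sl_ne (ξ : ℝ) : sl l ξ ≠ 0 := (h.sl_pos ξ).ne'

lemma sl_sq (ξ : ℝ) : sl l ξ ^ 2 = l (2 * Real.pi * ξ) :=
  Real.sq_sqrt (le_trans (by have := h.c₁_pos; positivity) (h.lower _))

lemma jb_one_le_sl (ξ : ℝ) : c₁ * jb 1 ξ ≤ sl l ξ :=
  (mul_le_mul_of_nonneg_left (jb_mono (by linarith [h.two_le]) ξ) h.c₁_pos.le).trans (h.le_sl ξ)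

lemma meas_om : Measurable (om l) :=
  (measurable_const.mul measurable_id).norm.mul h.meas_sl

lemma om_nonneg (ξ : ℝ) : 0 ≤ om l ξ := mul_nonneg (abs_nonneg _) (h.sl_pos ξ).le

lemma om_even (ξ : ℝ) : om l (-ξ) = om l ξ := by simp [om, h.sl_even]

lemma meas_su : Measurable (su l) := (measurable_jb 1).div h.meas_sl

lemma su_pos (ξ : ℝ) : 0 < su l ξ := div_pos (jb_pos _ _) (h.sl_pos ξ)

lemma su_even (ξ : ℝ) : su l (-ξ) = su l ξ := by simp [su, h.sl_even]

lemma su_le_jb (ξ : ℝ) : su l ξ ≤ c₁⁻¹ * jb (1 - ρ / 2) ξ := by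
  have := h.c₁_pos
  rw [su, div_le_iff₀ (h.sl_pos ξ)]
  have e : jb 1 ξ = c₁⁻¹ * jb (1 - ρ / 2) ξ * (c₁ * jb (ρ / 2) ξ) := by
    have : jb 1 ξ = jb (1 - ρ / 2) ξ * jb (ρ / 2) ξ := by rw [← jb_add]; congr 1; ring
    rw [this]; field_simp
  rw [e]
  exact mul_le_mul_of_nonneg_left (h.le_sl ξ)
    (mul_nonneg (inv_nonneg.2 this.le) (jb_pos _ _).le)

lemma su_le (ξ : ℝ) : |su l ξ| ≤ c₁⁻¹ := by
  rw [abs_of_pos (h.su_pos ξ)]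
  refine (h.su_le_jb ξ).trans ?_
  have := jb_le_one (σ := 1 - ρ / 2) (by linarith [h.two_le]) ξ
  have h1 := inv_nonneg.2 h.c₁_pos.le
  nlinarith

lemma bddR_su : BddR (su l) := ⟨h.meas_su, _, h.su_le⟩

lemma meas_rotSym (t : ℝ) : Measurable (rotSym l t) :=
  Complex.measurable_exp.comp
    ((Complex.measurable_ofReal.comp (h.meas_om.const_mul t)).mul_const _)

lemma bddSym_rotSym (t : ℝ) : BddSym (rotSym l t) :=
  ⟨h.meas_rotSym t, 1, fun ξ => (norm_rotSym l t ξ).le⟩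

lemma norm_rot (t : ℝ) (F : ComplexL2) : ‖rot l t F‖ = ‖F‖ :=
  mulL2_norm_eq (h.meas_rotSym t) (norm_rotSym l t) F

lemma rot_rot (t t' : ℝ) (F : ComplexL2) : rot l t (rot l t' F) = rot l (t + t') F := by
  rw [rot, rot, mulL2_mul (h.bddSym_rotSym t) (h.bddSym_rotSym t'), rot]
  refine congrFun (congrArg _ (mulL2_congr fun ξ => ?_)) F
  rw [rotSym, rotSym, ← Complex.exp_add, rotSym]
  push_cast; ring_nf

omit h in
lemma rot_zero (F : ComplexL2) : rot l 0 F = F := by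
  have : rot l 0 = mulL2 fun _ => 1 := mulL2_congr fun ξ => by simp [rotSym]
  rw [this, mulL2_one]

lemma rot_neg_rot (t : ℝ) (F : ComplexL2) : rot l (-t) (rot l t F) = F := by
  rw [h.rot_rot, neg_add_cancel, rot_zero]

lemma rot_rot_neg (t : ℝ) (F : ComplexL2) : rot l t (rot l (-t) F) = F := by
  rw [h.rot_rot, add_neg_cancel, rot_zero]

lemma inner_rot (t : ℝ) (F G : ComplexL2) : inner ℝ (rot l t F) (rot l t G) = inner ℝ F G :=
  inner_mulL2_unit (h.meas_rotSym t) (norm_rotSym l t) F G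

lemma mulR_rot {b : ℝ → ℝ} (hb : BddR b) (t : ℝ) (F : ComplexL2) :
    mulR b (rot l t F) = rot l t (mulR b F) := mulR_comm hb (h.bddSym_rotSym t) F

lemma rot_mem {r M t : ℝ} (hr : 0 ≤ r) {F : ComplexL2} (hF : F ∈ SobBall r M) :
    rot l t F ∈ SobBall r M := by
  have := sobBall_mulL2 hr (h.meas_rotSym t) (fun ξ => (norm_rotSym l t ξ).le) hF
  rwa [one_mul] at this

lemma continuous_rot (F : ComplexL2) : Continuous fun t => rot l t F := by
  rw [continuous_iff_continuousAt]
  intro t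
  refine tendsto_mulL2 (C := 1) h.meas_rotSym (h.meas_rotSym t)
    (Eventually.of_forall fun t ξ => (norm_rotSym l t ξ).le) (fun ξ => (norm_rotSym l t ξ).le)
    (fun ξ => ?_) F
  have : Continuous fun t => rotSym l t ξ := by unfold rotSym; fun_prop
  exact this.continuousAt

lemma tendsto_rot {ι : Type*} {L : Filter ι} {t : ι → ℝ} {t₀ : ℝ} {F : ι → ComplexL2}
    {F₀ : ComplexL2} (ht : Tendsto t L (𝓝 t₀)) (hF : Tendsto F L (𝓝 F₀)) :
    Tendsto (fun i => rot l (t i) (F i)) L (𝓝 (rot l t₀ F₀)) := by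
  have h1 : Tendsto (fun i => rot l (t i) F₀) L (𝓝 (rot l t₀ F₀)) :=
    ((h.continuous_rot F₀).tendsto t₀).comp ht
  refine tendsto_of_tendsto_of_dist h1 ?_
  have h2 := (tendsto_iff_norm_sub_tendsto_zero.1 hF)
  refine h2.congr fun i => ?_
  rw [dist_comm, dist_eq_norm, ← map_sub, h.norm_rot]

lemma fr_uOf_mem {r M : ℝ} (hr : 0 ≤ r) {y : ComplexL2} (hy : y ∈ SobBall r M) :
    fr (uOf l y) ∈ SobBall r (c₁⁻¹ * M) :=
  sobBall_fr_reInv hr (sobBall_mulR hr h.meas_su h.su_le hy)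

omit h in
lemma nonlin_mem {r C : ℝ} (hr : 0 ≤ r) {y : ComplexL2}
    (hy : fr (compR g (uOf l y)) ∈ SobBall r C) : nonlin l g y ∈ SobBall r C := by
  have h1 := sobBall_smul (-Complex.I) (sobBall_mulR hr measurable_ab abs_ab_le_one hy)
  rw [norm_neg, Complex.norm_I, one_mul, one_mul, neg_smul] at h1
  exact h1

lemma norm_uOf_sub_le (y y' : ComplexL2) : ‖uOf l y - uOf l y'‖ ≤ c₁⁻¹ * ‖y - y'‖ := by
  rw [uOf, uOf, ← map_sub, ← map_sub]
  exact (norm_reInv_le _).trans (mulR_norm_le h.meas_su h.su_le _)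

omit h in
lemma norm_nonlin_sub_le (y y' : ComplexL2) :
    ‖nonlin l g y - nonlin l g y'‖ ≤ ‖compR g (uOf l y) - compR g (uOf l y')‖ := by
  rw [nonlin, nonlin, ← fr.norm_map, LinearIsometry.map_sub, neg_sub_neg, ← smul_sub, ← map_sub,
    norm_smul, Complex.norm_I, one_mul, ← norm_neg, ← map_neg, neg_sub]
  exact (mulR_norm_le measurable_ab abs_ab_le_one _).trans (by rw [one_mul])

lemma exists_nonlin_lipschitz (M : ℝ) : ∃ L, 0 ≤ L ∧ ∀ y ∈ SobBall (kap ρ s + 1) M,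
    ∀ y' ∈ SobBall (kap ρ s + 1) M, ‖nonlin l g y - nonlin l g y'‖ ≤ L * ‖y - y'‖ := by
  have hk := kap_nonneg ρ s
  obtain ⟨C, hC, hsob⟩ := exists_ae_abs_le (r := kap ρ s + 1) (by linarith)
  obtain ⟨L, hL0, hL⟩ := exists_lipOn h.g_one (C * (c₁⁻¹ * M))
  refine ⟨L * c₁⁻¹, mul_nonneg hL0 (inv_nonneg.2 h.c₁_pos.le), fun y hy y' hy' => ?_⟩
  refine (norm_nonlin_sub_le y y').trans ?_
  refine (norm_compR_sub_le h.g_one.continuous h.zero hL (hsob _ _ (h.fr_uOf_mem (by linarith) hy))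
    (hsob _ _ (h.fr_uOf_mem (by linarith) hy'))).trans ?_
  rw [mul_assoc]
  exact mul_le_mul_of_nonneg_left (h.norm_uOf_sub_le y y') hL0

lemma exists_nonlin_bounded (M : ℝ) : ∃ C, 0 ≤ C ∧ ∀ y ∈ SobBall (kap ρ s + 1) M,
    nonlin l g y ∈ SobBall (kap ρ s + 1) C := by
  have hk := kap_nonneg ρ s
  obtain ⟨C, hC⟩ := exists_compR_mem_sobBall _ g h.contDiff h.zero (kap ρ s + 1) (by linarith)
    h.kap_add_one_le (c₁⁻¹ * M)
  refine ⟨max C 0, le_max_right _ _, fun y hy => nonlin_mem (by linarith) ?_⟩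
  exact sobBall_mono (by linarith) le_rfl (le_max_left _ _)
    (hC _ (h.fr_uOf_mem (by linarith) hy))

/-- The field maps bounded sets of the Sobolev space of order `κ + 1` to bounded sets, because
`1 ≤ κ + 1 ≤ ⌊s⌋ + 1`, the number of derivatives of `g`; it is Lipschitz continuous in `L²` on
them, because `u` is bounded there. -/
theorem tameField : TameField (kap ρ s + 1) (field l g) := by
  have hk : 0 ≤ kap ρ s + 1 := by linarith [kap_nonneg ρ s]
  refine ⟨fun M => ?_, fun M => ?_, fun M W hW => ?_⟩
  · obtain ⟨C, hC0, hC⟩ := h.exists_nonlin_bounded M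
    exact ⟨C, hC0, fun t W hW => h.rot_mem hk (hC _ (h.rot_mem hk hW))⟩
  · obtain ⟨L, hL0, hL⟩ := h.exists_nonlin_lipschitz M
    refine ⟨L, hL0, fun t W hW W' hW' => ?_⟩
    rw [field, field, ← map_sub, h.norm_rot]
    refine (hL _ (h.rot_mem hk hW) _ (h.rot_mem hk hW')).trans ?_
    rw [← map_sub, h.norm_rot]
  · obtain ⟨L, hL0, hL⟩ := h.exists_nonlin_lipschitz M
    rw [continuous_iff_continuousAt]
    intro t
    refine h.tendsto_rot tendsto_id ?_
    rw [tendsto_iff_norm_sub_tendsto_zero]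
    have h1 : Tendsto (fun τ => L * ‖rot l (-τ) W - rot l (-t) W‖) (𝓝 t) (𝓝 (L * 0)) := by
      refine Tendsto.const_mul L (tendsto_iff_norm_sub_tendsto_zero.1 ?_)
      exact ((h.continuous_rot W).comp continuous_neg).tendsto t
    rw [mul_zero] at h1
    exact squeeze_zero (fun _ => norm_nonneg _)
      (fun τ => hL _ (h.rot_mem hk hW) _ (h.rot_mem hk hW)) h1

end WaveData

/-! ### Differentiability of weighted trajectories -/

open Classical in
/-- The function `(1 + η²)^{r/2} F`, for `F` in the weighted space of order `r`; otherwise `0`. -/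
def sobTop (r : ℝ) (F : ComplexL2) : ComplexL2 :=
  if h : ∃ Y, mulR (jb (-r)) Y = F then h.choose else 0

lemma mulR_sobTop {r M : ℝ} {F : ComplexL2} (hF : F ∈ SobBall r M) :
    mulR (jb (-r)) (sobTop r F) = F := by
  obtain ⟨Y, _, hY⟩ := hF
  have h : ∃ Y, mulR (jb (-r)) Y = F := ⟨Y, hY⟩
  rw [sobTop, dif_pos h]
  exact h.choose_spec

lemma sobTop_eq {r : ℝ} (hr : 0 ≤ r) {F Y : ComplexL2} (h : mulR (jb (-r)) Y = F) :
    sobTop r F = Y :=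
  mulR_jb_injective hr ((mulR_sobTop ⟨Y, le_rfl, h⟩).trans h.symm)

lemma norm_sobTop_le {r M : ℝ} (hr : 0 ≤ r) {F : ComplexL2} (hF : F ∈ SobBall r M) :
    ‖sobTop r F‖ ≤ M := by
  obtain ⟨Y, hY, h⟩ := hF
  rwa [sobTop_eq hr h]

/-- If `V` is Lipschitz continuous at `t`, then the operators `A` for which `A V` is differentiable
at `t`, with derivative `A V'`, form a closed set for the operator norm. -/
lemma hasDerivWithinAt_of_approx {E G : Type*} [NormedAddCommGroup E] [NormedSpace ℝ E]
    [NormedAddCommGroup G] [NormedSpace ℝ G] {V : ℝ → E} {V' : E} {S : Set ℝ} {t K : ℝ}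
    (hV : ∀ z ∈ S, ‖V z - V t‖ ≤ K * |z - t|) {A : E →L[ℝ] G}
    (hA : ∀ ε > 0, ∃ B : E →L[ℝ] G, (∀ x, ‖A x - B x‖ ≤ ε * ‖x‖) ∧
      HasDerivWithinAt (fun z => B (V z)) (B V') S t) :
    HasDerivWithinAt (fun z => A (V z)) (A V') S t := by
  rw [hasDerivWithinAt_iff_isLittleO, Asymptotics.isLittleO_iff]
  intro c hc
  set ε := c / 2 / (|K| + ‖V'‖ + 1) with hε
  have hε0 : 0 < ε := by positivity
  obtain ⟨B, hAB, hB⟩ := hA ε hε0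
  rw [hasDerivWithinAt_iff_isLittleO, Asymptotics.isLittleO_iff] at hB
  filter_upwards [hB (half_pos hc), self_mem_nhdsWithin] with z hz hzS
  have e : A (V z) - A (V t) - (z - t) • A V'
      = (B (V z) - B (V t) - (z - t) • B V')
        + (A (V z - V t - (z - t) • V') - B (V z - V t - (z - t) • V')) := by
    simp only [map_sub, map_smul]; abel
  rw [e]
  refine (norm_add_le _ _).trans ?_
  have h1 : ‖V z - V t - (z - t) • V'‖ ≤ (|K| + ‖V'‖) * |z - t| := by
    refine (norm_sub_le _ _).trans ?_
    rw [norm_smul, Real.norm_eq_abs, add_mul]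
    have h2 := hV z hzS
    have h3 : K * |z - t| ≤ |K| * |z - t| :=
      mul_le_mul_of_nonneg_right (le_abs_self K) (abs_nonneg _)
    linarith
  have h2 := (hAB (V z - V t - (z - t) • V')).trans (mul_le_mul_of_nonneg_left h1 hε0.le)
  have h3 : ε * ((|K| + ‖V'‖) * |z - t|) ≤ c / 2 * |z - t| := by
    rw [← mul_assoc]
    refine mul_le_mul_of_nonneg_right ?_ (abs_nonneg _)
    have h4 : ε * (|K| + ‖V'‖ + 1) = c / 2 := div_mul_cancel₀ _ (by positivity)
    nlinarith
  rw [Real.norm_eq_abs] at hz ⊢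
  linarith

lemma bddR_indicator {b : ℝ → ℝ} (hb : BddR b) {A : Set ℝ} (hA : MeasurableSet A) :
    BddR (indicator A b) := by
  refine hb.of_le (hb.1.indicator hA) fun ξ => ?_
  by_cases h : ξ ∈ A
  · rw [indicator_of_mem h]
  · rw [indicator_of_notMem h, abs_zero]; exact abs_nonneg _

section Weak

variable {r : ℝ} {W W' : ℝ → ComplexL2} {a b C M M' : ℝ}

lemma norm_sobTop_sub_le (hr : 0 ≤ r)
    (hW : ∀ t ∈ Icc a b, HasDerivWithinAt W (W' t) (Icc a b) t)
    (hM : ∀ t ∈ Icc a b, W t ∈ SobBall r M) (hC : ∀ t ∈ Icc a b, W' t ∈ SobBall r C)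
    {x z : ℝ} (hx : x ∈ Icc a b) (hz : z ∈ Icc a b) :
    ‖sobTop r (W z) - sobTop r (W x)‖ ≤ C * |z - x| := by
  wlog hxz : x ≤ z generalizing x z
  · rw [norm_sub_rev, abs_sub_comm]
    exact this hz hx (le_of_not_ge hxz)
  have hsub : Icc x b ⊆ Icc a b := Icc_subset_Icc_left hx.1
  obtain ⟨D, hD, hDe⟩ := mem_sobBall_sub_of_hasDerivWithinAt hr (a := x) (b := b)
    (fun t ht => (hW t (hsub ht)).mono hsub) (fun t ht => hC t (hsub ht)) ⟨hxz, hz.2⟩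
  have : sobTop r (W z) - sobTop r (W x) = D := by
    apply mulR_jb_injective hr
    rw [map_sub, mulR_sobTop (hM z hz), mulR_sobTop (hM x hx), hDe]
  rw [this, abs_of_nonneg (sub_nonneg.2 hxz)]
  exact hD

lemma mulR_indicator_jb (b' : ℝ → ℝ) (hb : BddR b') (n : ℕ) {F : ComplexL2}
    (hF : F ∈ SobBall r M) (hr : 0 ≤ r) :
    mulR (indicator (Icc (-(n : ℝ)) n) b') (sobTop r F) = mulR b' (mulR (cutJb r n) F) := by
  conv_rhs => rw [← mulR_sobTop hF, mulR_mulR (bddR_cutJb r n) (bddR_jb (neg_nonpos.2 hr)),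
    mulR_mulR hb ((bddR_cutJb r n).mul (bddR_jb (neg_nonpos.2 hr)))]
  refine congrFun (congrArg _ (mulR_congr fun ξ => ?_)) _
  rw [cutJb]
  by_cases h : ξ ∈ Icc (-(n : ℝ)) n
  · rw [indicator_of_mem h, indicator_of_mem h, mul_comm (jb r ξ), jb_neg_mul, mul_one]
  · rw [indicator_of_notMem h, indicator_of_notMem h, zero_mul, mul_zero]

lemma hasDerivWithinAt_indicator (hr : 0 ≤ r)
    (hW : ∀ t ∈ Icc a b, HasDerivWithinAt W (W' t) (Icc a b) t)
    (hM : ∀ t ∈ Icc a b, W t ∈ SobBall r M) (hC : ∀ t ∈ Icc a b, W' t ∈ SobBall r C)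
    {b' : ℝ → ℝ} (hb : BddR b') (n : ℕ) {t : ℝ} (ht : t ∈ Icc a b) :
    HasDerivWithinAt (fun z => mulR (indicator (Icc (-(n : ℝ)) n) b') (sobTop r (W z)))
      (mulR (indicator (Icc (-(n : ℝ)) n) b') (sobTop r (W' t))) (Icc a b) t := by
  rw [mulR_indicator_jb b' hb n (hC t ht) hr]
  have h1 := (((mulR b').comp (mulR (cutJb r n))).restrictScalars
    ℝ).hasFDerivAt.comp_hasDerivWithinAt t (hW t ht)
  exact h1.congr_of_mem (fun z hz => mulR_indicator_jb b' hb n (hM z hz) hr) ht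

/-- A Lipschitz trajectory in a Sobolev space which is differentiable in `L²` is differentiable in
every weaker Sobolev norm. -/
lemma hasDerivWithinAt_mulR_sobTop (hr : 0 ≤ r)
    (hW : ∀ t ∈ Icc a b, HasDerivWithinAt W (W' t) (Icc a b) t)
    (hM : ∀ t ∈ Icc a b, W t ∈ SobBall r M) (hC : ∀ t ∈ Icc a b, W' t ∈ SobBall r C)
    {b' : ℝ → ℝ} (hb : BddR b') {D : ℝ} (hD : ∀ ξ, |b' ξ| * |ξ| ≤ D) {t : ℝ} (ht : t ∈ Icc a b) :
    HasDerivWithinAt (fun z => mulR b' (sobTop r (W z))) (mulR b' (sobTop r (W' t)))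
      (Icc a b) t := by
  refine hasDerivWithinAt_of_approx (A := (mulR b').restrictScalars ℝ)
    (fun z hz => norm_sobTop_sub_le hr hW hM hC ht hz) fun ε hε => ?_
  obtain ⟨n, hn⟩ := exists_nat_gt (D / ε)
  have hD0 : 0 ≤ D := by simpa using hD 0
  have hn0 : (0 : ℝ) < n := lt_of_le_of_lt (by positivity) hn
  refine ⟨(mulR (indicator (Icc (-(n : ℝ)) n) b')).restrictScalars ℝ, fun x => ?_,
    hasDerivWithinAt_indicator hr hW hM hC hb n ht⟩
  have hi := bddR_indicator hb (measurableSet_Icc (a := -(n : ℝ)) (b := n))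
  apply norm_le_of_ae_le
  filter_upwards [mulR_coe hb x, mulR_coe hi x,
    Lp.coeFn_sub (mulR b' x) (mulR (indicator (Icc (-(n : ℝ)) n) b') x)] with ξ h1 h2 h3
  simp only [ContinuousLinearMap.coe_restrictScalars']
  rw [h3, Pi.sub_apply, h1, h2, ← sub_mul, norm_mul, ← Complex.ofReal_sub, Complex.norm_real]
  refine mul_le_mul_of_nonneg_right ?_ (norm_nonneg _)
  by_cases h : ξ ∈ Icc (-(n : ℝ)) n
  · rw [indicator_of_mem h, sub_self, norm_zero]; exact hε.le
  · rw [indicator_of_notMem h, sub_zero, Real.norm_eq_abs]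
    have h4 : (n : ℝ) < |ξ| := by
      by_contra h5
      exact h (abs_le.1 (not_lt.1 h5))
    have h5 : D < n * ε := (div_lt_iff₀ hε).1 hn
    have h6 := hD ξ
    by_contra h7
    push Not at h7
    nlinarith [abs_nonneg (b' ξ)]

/-- A Lipschitz trajectory in a Sobolev space which is differentiable in `L²` is weakly
differentiable in that Sobolev space. -/
lemma hasDerivWithinAt_inner_sobTop (hr : 0 ≤ r)
    (hW : ∀ t ∈ Icc a b, HasDerivWithinAt W (W' t) (Icc a b) t)
    (hM : ∀ t ∈ Icc a b, W t ∈ SobBall r M) (hC : ∀ t ∈ Icc a b, W' t ∈ SobBall r C)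
    (F : ComplexL2) {t : ℝ} (ht : t ∈ Icc a b) :
    HasDerivWithinAt (fun z => inner ℝ F (sobTop r (W z))) (inner ℝ F (sobTop r (W' t)))
      (Icc a b) t := by
  refine hasDerivWithinAt_of_approx (A := innerSL ℝ F)
    (fun z hz => norm_sobTop_sub_le hr hW hM hC ht hz) fun ε hε => ?_
  have hone : BddR fun _ => (1 : ℝ) := ⟨measurable_const, 1, by simp⟩
  have hlim : Tendsto (fun n : ℕ => mulR (indicator (Icc (-(n : ℝ)) n) fun _ => 1) F) atTop
      (𝓝 F) := by
    have := tendsto_mulL2 (L := atTop) (C := 1)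
      (m := fun (n : ℕ) ξ => ((indicator (Icc (-(n : ℝ)) n) (fun _ => (1 : ℝ)) ξ : ℝ) : ℂ))
      (m₀ := fun _ => ((1 : ℝ) : ℂ))
      (fun n => (bddR_indicator hone measurableSet_Icc).sym.1) measurable_const
      (Eventually.of_forall fun n ξ => ?_) (by simp)
      (fun ξ => (Complex.continuous_ofReal.tendsto _).comp (tendsto_indicator_Icc (fun _ => 1) ξ)) F
    · have e := mulR_one F
      rw [mulR] at e
      rwa [e] at this
    · rw [Complex.norm_real]
      refine (norm_indicator_le_norm_self _ _).trans ?_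
      simp
  obtain ⟨n, hn⟩ := (Metric.tendsto_atTop.1 hlim ε hε)
  have hn' := hn n le_rfl
  refine ⟨innerSL ℝ (mulR (indicator (Icc (-(n : ℝ)) n) fun _ => 1) F), fun x => ?_, ?_⟩
  · rw [← sub_apply, ← map_sub]
    simp only [innerSL_apply_apply]
    refine (norm_inner_le_norm _ _).trans (mul_le_mul_of_nonneg_right ?_ (norm_nonneg _))
    rw [← dist_eq_norm, dist_comm]; exact hn'.le
  · simp only [innerSL_apply_apply, inner_mulR (bddR_indicator hone measurableSet_Icc)]
    exact (innerSL ℝ F).hasFDerivAt.comp_hasDerivWithinAt t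
      (hasDerivWithinAt_indicator hr hW hM hC hone n ht)

end Weak

/-! ### Trajectories of the first order equation -/

/-- The unknown `y` in terms of `W = exp (i t ω) y`. -/
def yOf (l : ℝ → ℝ) (W : ℝ → ComplexL2) (t : ℝ) : ComplexL2 := rot l (-t) (W t)

/-- The function `(1 + η²)^{r/2} y`. -/
def YOf (r : ℝ) (l : ℝ → ℝ) (W : ℝ → ComplexL2) (t : ℝ) : ComplexL2 :=
  rot l (-t) (sobTop r (W t))

/-- The function `(1 + η²)^{r/2} N(y)`. -/
def NOf (r : ℝ) (l g : ℝ → ℝ) (W : ℝ → ComplexL2) (t : ℝ) : ComplexL2 :=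
  sobTop r (nonlin l g (yOf l W t))

/-- The Fourier transform of the real part of the inverse Fourier transform. -/
def frRe (F : ComplexL2) : ComplexL2 := fr (reInv F)

/-- The Fourier transform of the imaginary part of the inverse Fourier transform. -/
def frIm (F : ComplexL2) : ComplexL2 := fr (reInv (-(Complex.I • F)))

lemma frRe_add_frIm (F : ComplexL2) : frRe F + Complex.I • frIm F = F := (fr_decomp F).symm

lemma frRe_mulR {b : ℝ → ℝ} (hb : BddR b) (he : ∀ ξ, b (-ξ) = b ξ) (F : ComplexL2) :
    frRe (mulR b F) = mulR b (frRe F) := fr_reInv_mulR hb he F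

lemma frIm_mulR {b : ℝ → ℝ} (hb : BddR b) (he : ∀ ξ, b (-ξ) = b ξ) (F : ComplexL2) :
    frIm (mulR b F) = mulR b (frIm F) := by
  rw [frIm, ← map_smul, ← map_neg]
  exact frRe_mulR hb he _

lemma frRe_add (F G : ComplexL2) : frRe (F + G) = frRe F + frRe G := by
  rw [frRe, map_add, LinearIsometry.map_add]; rfl

lemma frIm_add (F G : ComplexL2) : frIm (F + G) = frIm F + frIm G := by
  rw [frIm, smul_add, neg_add, map_add, LinearIsometry.map_add]; rfl

lemma frRe_negI (F : ComplexL2) : frRe (-(Complex.I • F)) = frIm F := rfl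

lemma frIm_negI (F : ComplexL2) : frIm (-(Complex.I • F)) = -frRe F := by
  rw [frIm, smul_neg, neg_neg, smul_smul, Complex.I_mul_I, neg_one_smul, map_neg,
    LinearIsometry.map_neg]; rfl

lemma frRe_fr (f : RealL2) : frRe (fr f) = fr f := by rw [frRe, reInv_fr]

lemma frIm_fr (f : RealL2) : frIm (fr f) = 0 := by
  rw [frIm, map_neg, reInv_I_fr, neg_zero, LinearIsometry.map_zero]

lemma continuous_frRe : Continuous frRe := fr.continuous.comp reInv.continuous

lemma continuous_frIm : Continuous frIm :=
  fr.continuous.comp (reInv.continuous.comp (by fun_prop))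

lemma inner_fr_I_fr (f f' : RealL2) : inner ℝ (fr f) (Complex.I • fr f') = 0 := by
  have h := norm_sq_decomp (fr f + Complex.I • fr f')
  have e1 : reInv (fr f + Complex.I • fr f') = f := by
    rw [map_add, reInv_fr, reInv_I_fr, add_zero]
  have e2 : reInv (-(Complex.I • (fr f + Complex.I • fr f'))) = f' := by
    rw [smul_add, smul_smul, Complex.I_mul_I, neg_one_smul, neg_add, neg_neg, map_add, map_neg,
      reInv_I_fr, neg_zero, zero_add, reInv_fr]
  rw [e1, e2, norm_add_sq_real, norm_smul, Complex.norm_I, one_mul, fr.norm_map, fr.norm_map] at h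
  linarith

lemma inner_I_smul (F G : ComplexL2) :
    inner ℝ (Complex.I • F) (Complex.I • G) = inner ℝ F G := by
  have h : ∀ H : ComplexL2, Complex.I • H = mulL2 (fun _ => Complex.I) H := by
    intro H
    apply Lp.ext
    filter_upwards [Lp.coeFn_smul Complex.I H,
      mulL2_coe (m := fun _ => Complex.I) ⟨measurable_const, 1, by simp⟩ H] with ξ h1 h2
    rw [h1, h2]; rfl
  rw [h, h]
  exact inner_mulL2_unit measurable_const (by simp) F G

lemma norm_exp_sub_exp_le (a b : ℝ) :
    ‖Complex.exp ((a : ℝ) * Complex.I) - Complex.exp ((b : ℝ) * Complex.I)‖ ≤ |a - b| := by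
  have e : Complex.exp ((a : ℝ) * Complex.I) - Complex.exp ((b : ℝ) * Complex.I)
      = Complex.exp ((b : ℝ) * Complex.I) * (Complex.exp (Complex.I * ((a - b : ℝ) : ℂ)) - 1) := by
    rw [mul_sub, ← Complex.exp_add, mul_one]
    push_cast; ring_nf
  rw [e, norm_mul, Complex.norm_exp_ofReal_mul_I, one_mul]
  exact Real.norm_exp_I_mul_ofReal_sub_one_le

namespace WaveData

variable {ρ s c₁ c₂ : ℝ} {l g : ℝ → ℝ} (h : WaveData ρ s c₁ c₂ l g)
include h

/-- The derivative of `exp (-i t ω) V` in a weak norm. -/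
lemma tendsto_rot_slope {b : ℝ → ℝ} (hb : BddR b) (hbo : BddR fun ξ => b ξ * om l ξ) (t : ℝ)
    (S : Set ℝ) (V : ComplexL2) :
    Tendsto (fun z => (z - t)⁻¹ • (rot l (-z) (mulR b V) - rot l (-t) (mulR b V)))
      (𝓝[S \ {t}] t)
      (𝓝 (-(Complex.I • mulR (fun ξ => b ξ * om l ξ) (rot l (-t) V)))) := by
  obtain ⟨hbom, C, hC⟩ := hbo
  have hbo : BddR fun ξ => b ξ * om l ξ := ⟨hbom, C, hC⟩
  set m : ℝ → ℝ → ℂ := fun z ξ =>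
    ((z - t)⁻¹ : ℝ) * ((rotSym l (-z) ξ - rotSym l (-t) ξ) * (b ξ : ℂ)) with hm
  set m₀ : ℝ → ℂ := fun ξ => -(Complex.I * (((b ξ * om l ξ : ℝ) : ℂ) * rotSym l (-t) ξ)) with hm₀
  have mm : ∀ z, Measurable (m z) := fun z =>
    (((h.meas_rotSym _).sub (h.meas_rotSym _)).mul hb.sym.1).const_mul _
  have mm₀ : Measurable m₀ := ((hbo.sym.1.mul (h.meas_rotSym _)).const_mul _).neg
  have bm : ∀ z ξ, ‖m z ξ‖ ≤ C := by
    intro z ξ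
    rcases eq_or_ne z t with rfl | hzt
    · simp only [hm, sub_self, inv_zero, Complex.ofReal_zero, zero_mul, norm_zero]
      exact (abs_nonneg _).trans (hC 0)
    have h1 := norm_exp_sub_exp_le (-z * om l ξ) (-t * om l ξ)
    simp only [hm, norm_mul, Complex.norm_real, Real.norm_eq_abs, abs_inv]
    rw [inv_mul_le_iff₀ (abs_pos.2 (sub_ne_zero.2 hzt))]
    have h2 : |-z * om l ξ - -t * om l ξ| = |z - t| * om l ξ := by
      rw [← sub_mul, abs_mul, abs_of_nonneg (h.om_nonneg ξ), ← abs_neg]; congr 2; ring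
    rw [h2] at h1
    have h3 := hC ξ
    rw [abs_mul, abs_of_nonneg (h.om_nonneg ξ)] at h3
    refine (mul_le_mul_of_nonneg_right h1 (abs_nonneg (b ξ))).trans ?_
    rw [mul_assoc, mul_comm (om l ξ)]
    exact mul_le_mul_of_nonneg_left h3 (abs_nonneg _)
  have bm₀ : ∀ ξ, ‖m₀ ξ‖ ≤ C := by
    intro ξ
    simp only [hm₀, norm_neg, norm_mul, Complex.norm_I, one_mul, norm_rotSym, mul_one,
      Complex.norm_real, Real.norm_eq_abs]
    have := hC ξ
    rwa [abs_mul] at this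
  have hlim := tendsto_mulL2 (L := 𝓝[S \ {t}] t) mm mm₀ (Eventually.of_forall bm) bm₀
    (fun ξ => ?_) V
  · refine (hlim.congr' ?_).trans (le_of_eq (congrArg _ ?_))
    · filter_upwards with z
      apply Lp.ext
      filter_upwards [mulL2_coe (BddSym.mk' (mm z) (bm z)) V, mulR_coe hb V,
        mulL2_coe (h.bddSym_rotSym (-z)) (mulR b V), mulL2_coe (h.bddSym_rotSym (-t)) (mulR b V),
        Lp.coeFn_smul (z - t)⁻¹ (rot l (-z) (mulR b V) - rot l (-t) (mulR b V)),
        Lp.coeFn_sub (rot l (-z) (mulR b V)) (rot l (-t) (mulR b V))] with ξ h1 h2 h3 h4 h5 h6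
      rw [h1, h5, Pi.smul_apply, h6, Pi.sub_apply, rot, rot, h3, h4, h2, Complex.real_smul]
      simp only [hm]; ring
    · apply Lp.ext
      filter_upwards [mulL2_coe (BddSym.mk' mm₀ bm₀) V,
        mulL2_coe (h.bddSym_rotSym (-t)) V, mulR_coe hbo (rot l (-t) V),
        Lp.coeFn_neg (Complex.I • mulR (fun ξ => b ξ * om l ξ) (rot l (-t) V)),
        Lp.coeFn_smul Complex.I (mulR (fun ξ => b ξ * om l ξ) (rot l (-t) V))] with ξ h1 h2 h3 h4 h5
      rw [h1, h4, Pi.neg_apply, h5, Pi.smul_apply, h3, rot, h2, smul_eq_mul]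
      simp only [hm₀]; ring
  · have hd : HasDerivAt (fun z : ℝ => rotSym l (-z) ξ)
        (-(Complex.I * om l ξ) * rotSym l (-t) ξ) t := by
      have h2 : HasDerivAt (fun z : ℝ => ((-z * om l ξ : ℝ) : ℂ) * Complex.I)
          (((-1 * om l ξ : ℝ) : ℂ) * Complex.I) t :=
        (((hasDerivAt_id t).neg.mul_const (om l ξ)).ofReal_comp).mul_const _
      convert h2.cexp using 1
      · rfl
      rw [show rotSym l (-t) ξ = Complex.exp (((-t * om l ξ : ℝ) : ℂ) * Complex.I) from rfl]
      push_cast; ring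
    have h3 := hasDerivWithinAt_iff_tendsto_slope.1 (hd.hasDerivWithinAt (s := S))
    have h4 := h3.mul_const (b ξ : ℂ)
    refine (h4.congr fun z => ?_).trans (le_of_eq (congrArg _ ?_))
    · simp only [hm, slope_def_module, Complex.real_smul, mul_assoc]
    · simp only [hm₀]; push_cast; ring

variable {W₀ : ComplexL2} {T : ℝ} {W : ℝ → ComplexL2}
  (hW : IsSol (kap ρ s + 1) (field l g) W₀ T W)
include hW

lemma exists_traj_bound : ∃ M C, ∀ t ∈ Icc 0 T, W t ∈ SobBall (kap ρ s + 1) M ∧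
    nonlin l g (yOf l W t) ∈ SobBall (kap ρ s + 1) C ∧
    field l g t (W t) ∈ SobBall (kap ρ s + 1) C := by
  obtain ⟨M, hM⟩ := hW.bounded
  obtain ⟨C, _, hC⟩ := h.exists_nonlin_bounded M
  refine ⟨M, C, fun t ht => ?_⟩
  have h1 := hC _ (h.rot_mem (kap_add_one_nonneg ρ s) (t := -t) (hM t ht))
  exact ⟨hM t ht, h1, h.rot_mem (kap_add_one_nonneg ρ s) h1⟩

lemma mulR_YOf {t : ℝ} (ht : t ∈ Icc 0 T) :
    mulR (jb (-(kap ρ s + 1))) (YOf (kap ρ s + 1) l W t) = yOf l W t := by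
  obtain ⟨M, C, hM⟩ := h.exists_traj_bound hW
  rw [YOf, h.mulR_rot (bddR_order ρ s), mulR_sobTop (hM t ht).1, yOf]

lemma mulR_NOf {t : ℝ} (ht : t ∈ Icc 0 T) :
    mulR (jb (-(kap ρ s + 1))) (NOf (kap ρ s + 1) l g W t) = nonlin l g (yOf l W t) := by
  obtain ⟨M, C, hM⟩ := h.exists_traj_bound hW
  exact mulR_sobTop (hM t ht).2.1

lemma sobTop_field {t : ℝ} (ht : t ∈ Icc 0 T) :
    sobTop (kap ρ s + 1) (field l g t (W t)) = rot l t (NOf (kap ρ s + 1) l g W t) := by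
  apply sobTop_eq (kap_add_one_nonneg ρ s)
  rw [h.mulR_rot (bddR_order ρ s), h.mulR_NOf hW ht]; rfl

omit hW in
lemma rot_YOf (t : ℝ) : rot l t (YOf (kap ρ s + 1) l W t) = sobTop (kap ρ s + 1) (W t) :=
  h.rot_rot_neg t _

/-- A trajectory is differentiable in every norm in which `ω y` is bounded. -/
lemma hasDerivWithinAt_YOf {b : ℝ → ℝ} (hb : BddR b) (hbo : BddR fun ξ => b ξ * om l ξ) {t : ℝ}
    (ht : t ∈ Icc 0 T) :
    HasDerivWithinAt (fun z => mulR b (YOf (kap ρ s + 1) l W z))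
      (-(Complex.I • mulR (fun ξ => b ξ * om l ξ) (YOf (kap ρ s + 1) l W t))
        + mulR b (NOf (kap ρ s + 1) l g W t)) (Icc 0 T) t := by
  obtain ⟨M, C, hM⟩ := h.exists_traj_bound hW
  set r := kap ρ s + 1
  -- The weight `b` decays at least like `1 / |ξ|`, because `ω ≥ c₁ |η|`.
  have hD : ∃ D, ∀ ξ, |b ξ| * |ξ| ≤ D := by
    obtain ⟨_, D, hD⟩ := hbo
    refine ⟨c₁⁻¹ * D, fun ξ => ?_⟩
    have h1 := hD ξ
    rw [abs_mul, abs_of_nonneg (h.om_nonneg ξ), om] at h1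
    have h2 : c₁ ≤ sl l ξ :=
      (le_mul_of_one_le_right h.c₁_pos.le (one_le_jb (by linarith [h.two_le]) ξ)).trans (h.le_sl ξ)
    have h3 : |ξ| ≤ |2 * Real.pi * ξ| := by
      rw [abs_mul]
      refine le_mul_of_one_le_left (abs_nonneg _) ?_
      rw [abs_of_pos Real.two_pi_pos]; linarith [Real.pi_gt_three]
    rw [inv_mul_eq_div, le_div_iff₀ h.c₁_pos]
    refine le_trans ?_ h1
    rw [mul_assoc]
    exact mul_le_mul_of_nonneg_left (mul_le_mul h3 h2 h.c₁_pos.le (abs_nonneg _)) (abs_nonneg _)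
  obtain ⟨D, hD⟩ := hD
  have hG := hasDerivWithinAt_mulR_sobTop (kap_add_one_nonneg ρ s) hW.deriv
    (fun t ht => (hM t ht).1)
    (fun t ht => (hM t ht).2.2) hb hD ht
  rw [h.sobTop_field hW ht] at hG
  have hGc := hG.continuousWithinAt
  rw [hasDerivWithinAt_iff_tendsto_slope] at hG ⊢
  have hz : Tendsto (fun z : ℝ => -z) (𝓝[Icc 0 T \ {t}] t) (𝓝 (-t)) :=
    (continuous_neg.tendsto t).mono_left nhdsWithin_le_nhds
  have h1 := h.tendsto_rot hz hG
  rw [h.mulR_rot hb, h.rot_neg_rot] at h1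
  have h2 := (h.tendsto_rot_slope hb hbo t (Icc 0 T) (sobTop r (W t))).add h1
  refine h2.congr fun z => ?_
  rw [slope_def_module, slope_def_module, YOf, YOf, h.mulR_rot hb, h.mulR_rot hb,
    ContinuousLinearMap.map_smul_of_tower, ← smul_add, map_sub]
  congr 1
  abel

lemma continuousOn_YOf : ContinuousOn (YOf (kap ρ s + 1) l W) (Icc 0 T) := by
  obtain ⟨M, C, hM⟩ := h.exists_traj_bound hW
  intro t ht
  refine h.tendsto_rot ((continuous_neg.tendsto t).mono_left nhdsWithin_le_nhds) ?_
  rw [tendsto_iff_norm_sub_tendsto_zero]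
  have h1 : Tendsto (fun z => C * |z - t|) (𝓝[Icc 0 T] t) (𝓝 0) := by
    have : Continuous fun z : ℝ => C * |z - t| := by fun_prop
    have h2 := this.tendsto t
    simp only [sub_self, abs_zero, mul_zero] at h2
    exact h2.mono_left nhdsWithin_le_nhds
  refine squeeze_zero' (Eventually.of_forall fun _ => norm_nonneg _) ?_ h1
  filter_upwards [self_mem_nhdsWithin] with z hz
  exact norm_sobTop_sub_le (kap_add_one_nonneg ρ s) hW.deriv (fun t ht => (hM t ht).1)
    (fun t ht => (hM t ht).2.2) ht hz

/-- The square of a weighted norm of a trajectory is differentiable, even if the trajectory is only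
weakly differentiable for that norm. The group drops out, as it is unitary. -/
lemma hasDerivWithinAt_norm_sq {b : ℝ → ℝ} (hb : BddR b) {t : ℝ} (ht : t ∈ Icc 0 T) :
    HasDerivWithinAt (fun z => ‖mulR b (YOf (kap ρ s + 1) l W z)‖ ^ 2)
      (2 * inner ℝ (mulR b (YOf (kap ρ s + 1) l W t)) (mulR b (NOf (kap ρ s + 1) l g W t)))
      (Icc 0 T) t := by
  obtain ⟨M, C, hM⟩ := h.exists_traj_bound hW
  set r := kap ρ s + 1
  -- Expansion about `V(t)`: the linear part is differentiable since `V` is weakly differentiable,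
  -- and the quadratic part is `O(|z - t|²)` since `V` is Lipschitz continuous.
  set V : ℝ → ComplexL2 := fun z => sobTop r (W z) with hV
  have hlip : ∀ z ∈ Icc 0 T, ‖V z - V t‖ ≤ C * |z - t| := fun z hz =>
    norm_sobTop_sub_le (kap_add_one_nonneg ρ s) hW.deriv (fun t ht => (hM t ht).1)
      (fun t ht => (hM t ht).2.2) ht hz
  obtain ⟨_, B, hB⟩ := id hb
  have hw := hasDerivWithinAt_inner_sobTop (kap_add_one_nonneg ρ s) hW.deriv
    (fun t ht => (hM t ht).1)
    (fun t ht => (hM t ht).2.2) (mulR b (mulR b (V t))) ht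
  rw [h.sobTop_field hW ht, inner_mulR hb] at hw
  have e1 : ∀ z, ‖mulR b (YOf r l W z)‖ ^ 2 = ‖mulR b (V t)‖ ^ 2
      + 2 * (inner ℝ (mulR b (mulR b (V t))) (V z) - inner ℝ (mulR b (mulR b (V t))) (V t))
      + ‖mulR b (V z - V t)‖ ^ 2 := by
    intro z
    have e3 := real_inner_comm (mulR b (V z)) (mulR b (V t))
    rw [YOf, h.mulR_rot hb, h.norm_rot, inner_mulR hb (mulR b (V t)) (V z),
      inner_mulR hb (mulR b (V t)) (V t), map_sub, norm_sub_sq_real, real_inner_self_eq_norm_sq]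
    change ‖mulR b (V z)‖ ^ 2 = _
    linarith
  have e2 : inner ℝ (mulR b (V t)) (mulR b (rot l t (NOf r l g W t)))
      = inner ℝ (mulR b (YOf r l W t)) (mulR b (NOf r l g W t)) := by
    rw [hV]
    simp only
    rw [← h.rot_YOf, h.mulR_rot hb, h.mulR_rot hb, h.inner_rot]
  have hq : HasDerivWithinAt (fun z => ‖mulR b (V z - V t)‖ ^ 2) 0 (Icc 0 T) t := by
    rw [hasDerivWithinAt_iff_isLittleO]
    have : (fun z : ℝ => (z - t) ^ 2) =o[𝓝[Icc 0 T] t] fun z => z - t := by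
      have h1 := (Asymptotics.isLittleO_pow_sub_sub t (m := 2) (by norm_num))
      exact (h1.mono nhdsWithin_le_nhds).congr_left fun z => by rw [Real.norm_eq_abs, sq_abs]
    refine Asymptotics.IsBigO.trans_isLittleO ?_ this
    refine Asymptotics.IsBigO.of_bound ((B * C) ^ 2) ?_
    filter_upwards [self_mem_nhdsWithin] with z hz
    simp only [sub_self, map_zero, norm_zero, smul_zero, sub_zero, Real.norm_eq_abs, abs_pow,
      abs_norm, ne_eq, OfNat.ofNat_ne_zero, not_false_eq_true, zero_pow]
    rw [← mul_pow]
    refine pow_le_pow_left₀ (norm_nonneg _) ?_ 2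
    have hB0 : 0 ≤ B := (abs_nonneg _).trans (hB 0)
    refine (mulR_norm_le hb.1 hB _).trans ?_
    rw [mul_assoc]
    exact mul_le_mul_of_nonneg_left (hlip z hz) hB0
  have hfin := ((hw.sub_const (inner ℝ (mulR b (mulR b (V t))) (V t))).const_mul 2).const_add
    (‖mulR b (V t)‖ ^ 2) |>.add hq
  rw [add_zero, e2] at hfin
  exact hfin.congr_of_mem (fun z _ => e1 z) ht

end WaveData

/-! ### Conservation of energy -/

section Primitive

variable {g : ℝ → ℝ} {R L : ℝ}

lemma hasDerivAt_primitiveG (hg : Continuous g) (p : ℝ) : HasDerivAt (primitiveG g) (g p) p :=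
  intervalIntegral.integral_hasDerivAt_right (hg.intervalIntegrable _ _)
    hg.stronglyMeasurable.stronglyMeasurableAtFilter hg.continuousAt

lemma continuous_primitiveG (hg : Continuous g) : Continuous (primitiveG g) :=
  continuous_iff_continuousAt.2 fun p => (hasDerivAt_primitiveG hg p).continuousAt

@[simp] lemma primitiveG_zero : primitiveG g 0 = 0 := by simp [primitiveG]

lemma abs_primitiveG_sub_le (hg : Continuous g) (hL0 : 0 ≤ L) (hL : LipOn g R L) {p q : ℝ}
    (hp : |p| ≤ R) (hq : |q| ≤ R) :
    |primitiveG g q - primitiveG g p - g p * (q - p)| ≤ L * (q - p) ^ 2 := by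
  have hmem : ∀ x ∈ uIcc p q, |x| ≤ R := fun x hx =>
    abs_le.2 ((convex_Icc (-R) R).ordConnected.uIcc_subset (abs_le.1 hp) (abs_le.1 hq) hx)
  have h := (convex_uIcc p q).norm_image_sub_le_of_norm_hasDerivWithin_le (𝕜 := ℝ)
    (f := fun x => primitiveG g x - g p * x) (f' := fun x => g x - g p * 1) (C := L * |q - p|)
    (fun x _ => ((hasDerivAt_primitiveG hg x).sub
      ((hasDerivAt_id x).const_mul (g p))).hasDerivWithinAt)
    (fun x hx => by
      rw [mul_one, Real.norm_eq_abs]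
      refine (hL x p (hmem x hx) hp).trans (mul_le_mul_of_nonneg_left ?_ hL0)
      exact abs_sub_left_of_mem_uIcc hx)
    left_mem_uIcc right_mem_uIcc
  rw [Real.norm_eq_abs, Real.norm_eq_abs] at h
  have e : primitiveG g q - g p * q - (primitiveG g p - g p * p)
      = primitiveG g q - primitiveG g p - g p * (q - p) := by ring
  rw [e, mul_assoc, ← sq, sq_abs] at h
  exact h

lemma integrable_primitiveG (hg : Continuous g) (g0 : g 0 = 0) (hL0 : 0 ≤ L) (hL : LipOn g R L)
    {u : RealL2} (hu : ∀ᵐ x, |u x| ≤ R) : Integrable fun x => primitiveG g (u x) := by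
  have h1 : Integrable fun x => L * (u x) ^ 2 := ((Lp.memLp u).integrable_sq).const_mul L
  refine h1.mono ((continuous_primitiveG hg).comp_aestronglyMeasurable (Lp.memLp u).1) ?_
  filter_upwards [hu] with x hx
  have := abs_primitiveG_sub_le hg hL0 hL (p := 0) (by simpa using (abs_nonneg _).trans hx) hx
  simp only [primitiveG_zero, g0, sub_zero, zero_mul] at this
  rw [Real.norm_eq_abs, Real.norm_eq_abs]
  exact this.trans (le_abs_self _)

lemma abs_integral_primitiveG_sub_le (hg : Continuous g) (g0 : g 0 = 0) (hL0 : 0 ≤ L)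
    (hL : LipOn g R L) {u w : RealL2} (hu : ∀ᵐ x, |u x| ≤ R) (hw : ∀ᵐ x, |w x| ≤ R) :
    |(∫ x, primitiveG g (w x)) - (∫ x, primitiveG g (u x)) - inner ℝ (compR g u) (w - u)|
      ≤ L * ‖w - u‖ ^ 2 := by
  have i1 := integrable_primitiveG hg g0 hL0 hL hu
  have i2 := integrable_primitiveG hg g0 hL0 hL hw
  have i3 := L2.integrable_inner (𝕜 := ℝ) (compR g u) (w - u)
  have i4 : Integrable fun x => primitiveG g (w x) - primitiveG g (u x) := i2.sub i1
  rw [L2.inner_def, ← integral_sub i2 i1, ← integral_sub i4 i3,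
    ← real_inner_self_eq_norm_sq, L2.inner_def, ← integral_const_mul, ← Real.norm_eq_abs]
  refine norm_integral_le_of_norm_le ((L2.integrable_inner (𝕜 := ℝ) (w - u) (w - u)).const_mul L) ?_
  filter_upwards [hu, hw, compR_coe hg g0 hL hu, Lp.coeFn_sub w u] with x h1 h2 h3 h4
  have h5 := abs_primitiveG_sub_le hg hL0 hL h1 h2
  rw [h3, h4, Pi.sub_apply, Real.norm_eq_abs]
  simp only [RCLike.inner_apply, conj_trivial]
  rw [← sq, mul_comm (w x - u x) (g (u x))]
  exact h5

end Primitive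

/-- The function `u` along a trajectory. -/
def uAt (l : ℝ → ℝ) (W : ℝ → ComplexL2) (t : ℝ) : RealL2 := uOf l (yOf l W t)

/-- The function `K u + i Λ⁻¹ u_t` on the Fourier side. -/
def ZOf (k : ℝ) (l : ℝ → ℝ) (W : ℝ → ComplexL2) (t : ℝ) : ComplexL2 :=
  mulR (jb (-k)) (YOf (k + 1) l W t)

/-- The function `K u` along a trajectory. -/
def AOf (k : ℝ) (l : ℝ → ℝ) (W : ℝ → ComplexL2) (t : ℝ) : RealL2 := reInv (ZOf k l W t)

/-- The function `Λ⁻¹ u_t` along a trajectory. -/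
def qOf (k : ℝ) (l : ℝ → ℝ) (W : ℝ → ComplexL2) (t : ℝ) : RealL2 :=
  reInv (-(Complex.I • ZOf k l W t))

lemma frRe_nonlin (l g : ℝ → ℝ) (y : ComplexL2) : frRe (nonlin l g y) = 0 := by
  rw [nonlin, frRe_negI, frIm_mulR bddR_ab ab_even, frIm_fr, map_zero]

lemma frIm_nonlin (l g : ℝ → ℝ) (y : ComplexL2) :
    frIm (nonlin l g y) = -mulR ab (fr (compR g (uOf l y))) := by
  rw [nonlin, frIm_negI, frRe_mulR bddR_ab ab_even, frRe_fr]

/-- `frRe` is bounded and real linear, and hence commutes with derivatives. -/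
lemma hasDerivWithinAt_frRe {f : ℝ → ComplexL2} {f' : ComplexL2} {S : Set ℝ} {t : ℝ}
    (hf : HasDerivWithinAt f f' S t) : HasDerivWithinAt (fun z => frRe (f z)) (frRe f') S t :=
  (fr.toContinuousLinearMap.comp reInv).hasFDerivAt.comp_hasDerivWithinAt t hf

lemma hasDerivWithinAt_frIm {f : ℝ → ComplexL2} {f' : ComplexL2} {S : Set ℝ} {t : ℝ}
    (hf : HasDerivWithinAt f f' S t) : HasDerivWithinAt (fun z => frIm (f z)) (frIm f') S t :=
  hasDerivWithinAt_frRe (hf.const_smul Complex.I).neg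

namespace WaveData

variable {ρ s c₁ c₂ : ℝ} {l g : ℝ → ℝ} (h : WaveData ρ s c₁ c₂ l g)
  {W₀ : ComplexL2} {T : ℝ} {W : ℝ → ComplexL2}
  (hW : IsSol (kap ρ s + 1) (field l g) W₀ T W)
include h

lemma fr_uAt (hW : IsSol (kap ρ s + 1) (field l g) W₀ T W) {t : ℝ} (ht : t ∈ Icc 0 T) :
    fr (uAt l W t) = mulR (fun ξ => su l ξ * jb (-(kap ρ s + 1)) ξ)
      (frRe (YOf (kap ρ s + 1) l W t)) := by
  rw [← mulR_mulR h.bddR_su (bddR_order ρ s), ← frRe_mulR (bddR_order ρ s) (jb_even _),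
    ← frRe_mulR h.bddR_su h.su_even, h.mulR_YOf hW ht]
  rfl

include hW

lemma frRe_NOf {t : ℝ} (ht : t ∈ Icc 0 T) : frRe (NOf (kap ρ s + 1) l g W t) = 0 := by
  apply mulR_jb_injective (kap_add_one_nonneg ρ s)
  rw [← frRe_mulR (bddR_order ρ s) (jb_even _), h.mulR_NOf hW ht, frRe_nonlin, map_zero]

lemma mulR_frIm_NOf {t : ℝ} (ht : t ∈ Icc 0 T) :
    mulR (jb (-(kap ρ s + 1))) (frIm (NOf (kap ρ s + 1) l g W t))
      = -mulR ab (fr (compR g (uAt l W t))) := by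
  rw [← frIm_mulR (bddR_order ρ s) (jb_even _), h.mulR_NOf hW ht, frIm_nonlin]; rfl

/-- `(K u)' = ω Λ⁻¹ u_t` in every norm in which the right hand side makes sense. -/
lemma hasDerivWithinAt_frRe_YOf {b : ℝ → ℝ} (hb : BddR b) (he : ∀ ξ, b (-ξ) = b ξ)
    (hbo : BddR fun ξ => b ξ * om l ξ) {t : ℝ} (ht : t ∈ Icc 0 T) :
    HasDerivWithinAt (fun z => mulR b (frRe (YOf (kap ρ s + 1) l W z)))
      (mulR (fun ξ => b ξ * om l ξ) (frIm (YOf (kap ρ s + 1) l W t))) (Icc 0 T) t := by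
  have h1 := hasDerivWithinAt_frRe (h.hasDerivWithinAt_YOf hW hb hbo ht)
  rw [frRe_add, frRe_negI, frIm_mulR hbo (fun ξ => by rw [he, h.om_even]), frRe_mulR hb he,
    h.frRe_NOf hW ht, map_zero, add_zero] at h1
  simpa only [frRe_mulR hb he] using h1

/-- `(Λ⁻¹ u_t)' = - ω K u - Λ g(u)` in every norm in which the right hand side makes sense. -/
lemma hasDerivWithinAt_frIm_YOf {b : ℝ → ℝ} (hb : BddR b) (he : ∀ ξ, b (-ξ) = b ξ)
    (hbo : BddR fun ξ => b ξ * om l ξ) {t : ℝ} (ht : t ∈ Icc 0 T) :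
    HasDerivWithinAt (fun z => mulR b (frIm (YOf (kap ρ s + 1) l W z)))
      (-mulR (fun ξ => b ξ * om l ξ) (frRe (YOf (kap ρ s + 1) l W t))
        + mulR b (frIm (NOf (kap ρ s + 1) l g W t))) (Icc 0 T) t := by
  have h1 := hasDerivWithinAt_frIm (h.hasDerivWithinAt_YOf hW hb hbo ht)
  rw [frIm_add, frIm_negI, frRe_mulR hbo (fun ξ => by rw [he, h.om_even]), frIm_mulR hb he] at h1
  simpa only [frIm_mulR hb he] using h1

omit h hW in
lemma fr_AOf (t : ℝ) :
    fr (AOf (kap ρ s) l W t) = mulR (jb (-(kap ρ s))) (frRe (YOf (kap ρ s + 1) l W t)) :=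
  frRe_mulR (bddR_kap ρ s) (jb_even _) _

omit h hW in
lemma fr_qOf (t : ℝ) :
    fr (qOf (kap ρ s) l W t) = mulR (jb (-(kap ρ s))) (frIm (YOf (kap ρ s + 1) l W t)) :=
  frIm_mulR (bddR_kap ρ s) (jb_even _) _

omit h hW in
lemma norm_ZOf_sq (t : ℝ) :
    ‖ZOf (kap ρ s) l W t‖ ^ 2 = ‖AOf (kap ρ s) l W t‖ ^ 2 + ‖qOf (kap ρ s) l W t‖ ^ 2 :=
  norm_sq_decomp _

lemma continuousOn_AOf : ContinuousOn (AOf (kap ρ s) l W) (Icc 0 T) :=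
  (reInv.continuous.comp (mulR _).continuous).comp_continuousOn (h.continuousOn_YOf hW)

lemma continuousOn_qOf : ContinuousOn (qOf (kap ρ s) l W) (Icc 0 T) := by
  have : Continuous fun Y : ComplexL2 => reInv (-(Complex.I • mulR (jb (-(kap ρ s))) Y)) := by
    fun_prop
  exact this.comp_continuousOn (h.continuousOn_YOf hW)

/-- A bound for `u` and `g(u)` along a trajectory. -/
lemma exists_uAt_bound : ∃ R M C, ∀ t ∈ Icc 0 T, (∀ᵐ x, |uAt l W t x| ≤ R) ∧
    fr (uAt l W t) ∈ SobBall (kap ρ s + 1) M ∧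
    fr (compR g (uAt l W t)) ∈ SobBall (kap ρ s + 1) C := by
  obtain ⟨M, hM⟩ := hW.bounded
  have hk := kap_nonneg ρ s
  obtain ⟨C, hC⟩ := exists_compR_mem_sobBall _ g h.contDiff h.zero (kap ρ s + 1) (by linarith)
    h.kap_add_one_le (c₁⁻¹ * M)
  obtain ⟨K, _, hK⟩ := exists_ae_abs_le (r := kap ρ s + 1) (by linarith)
  refine ⟨K * (c₁⁻¹ * M), c₁⁻¹ * M, C, fun t ht => ?_⟩
  have h1 := h.fr_uOf_mem (kap_add_one_nonneg ρ s)
    (h.rot_mem (kap_add_one_nonneg ρ s) (t := -t) (hM t ht))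
  exact ⟨hK _ _ h1, h1, hC _ h1⟩

omit hW in
lemma su_order_om (ξ : ℝ) : jb (-1) ξ * (su l ξ * jb (-(kap ρ s + 1)) ξ) * om l ξ
    = ab ξ * jb (-(kap ρ s)) ξ := by
  have e : jb (-(kap ρ s + 1)) ξ = jb (-(kap ρ s)) ξ * jb (-1) ξ := by rw [← jb_add]; congr 1; ring
  have h1 := h.sl_ne ξ
  have h2 := jb_neg_mul 1 ξ
  rw [e, su, om, ab]
  field_simp
  linear_combination (jb (-1) ξ) * jb (-kap ρ s) ξ * |2 * Real.pi * ξ| * h2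

/-- `u' = Λ q` in `H^{-1}`, where `q = Λ⁻¹ u_t`. -/
lemma hasDerivWithinAt_uAt {t : ℝ} (ht : t ∈ Icc 0 T) :
    HasDerivWithinAt (fun z => mulR (jb (-1)) (fr (uAt l W z)))
      (mulR ab (fr (qOf (kap ρ s) l W t))) (Icc 0 T) t := by
  have b1 : BddR (jb (-1)) := bddR_jb (by norm_num)
  have hb : BddR fun ξ => jb (-1) ξ * (su l ξ * jb (-(kap ρ s + 1)) ξ) :=
    b1.mul (h.bddR_su.mul (bddR_order ρ s))
  have hbo : BddR fun ξ => jb (-1) ξ * (su l ξ * jb (-(kap ρ s + 1)) ξ) * om l ξ := by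
    simp only [h.su_order_om]; exact bddR_ab.mul (bddR_kap ρ s)
  have h1 := h.hasDerivWithinAt_frRe_YOf hW hb (fun ξ => by simp [h.su_even]) hbo ht
  rw [mulR_congr h.su_order_om, ← mulR_mulR bddR_ab (bddR_kap ρ s), ← fr_qOf] at h1
  refine h1.congr_of_mem (fun z hz => ?_) ht
  rw [h.fr_uAt hW hz, mulR_mulR b1 (h.bddR_su.mul (bddR_order ρ s))]

/-- A difference of values of `u` in terms of the one of `K u`: thus `u` is continuous in `H¹`. -/
lemma fr_uAt_sub {t z : ℝ} (ht : t ∈ Icc 0 T) (hz : z ∈ Icc 0 T) :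
    fr (uAt l W z) - fr (uAt l W t)
      = mulR (jb (-1)) (mulR (su l) (fr (AOf (kap ρ s) l W z) - fr (AOf (kap ρ s) l W t))) := by
  have b1 : BddR (jb (-1)) := bddR_jb (by norm_num)
  rw [h.fr_uAt hW hz, h.fr_uAt hW ht, ← map_sub, fr_AOf, fr_AOf, ← map_sub,
    mulR_mulR h.bddR_su (bddR_kap ρ s), mulR_mulR b1 (h.bddR_su.mul (bddR_kap ρ s))]
  refine congrFun (congrArg _ (mulR_congr fun ξ => ?_)) _
  have e : jb (-(kap ρ s + 1)) ξ = jb (-(kap ρ s)) ξ * jb (-1) ξ := by rw [← jb_add]; congr 1; ring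
  rw [e]; ring

/-- Interpolation of `L²` between `H⁻¹` and `H¹`. -/
lemma norm_uAt_sub_sq_le {t z : ℝ} (ht : t ∈ Icc 0 T) (hz : z ∈ Icc 0 T) :
    ‖uAt l W z - uAt l W t‖ ^ 2
      ≤ ‖mulR (jb (-1)) (fr (uAt l W z)) - mulR (jb (-1)) (fr (uAt l W t))‖
        * (c₁⁻¹ * ‖AOf (kap ρ s) l W z - AOf (kap ρ s) l W t‖) := by
  have b1 : BddR (jb (-1)) := bddR_jb (by norm_num)
  rw [← map_sub, ← fr.norm_map, LinearIsometry.map_sub, ← real_inner_self_eq_norm_sq]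
  nth_rewrite 2 [h.fr_uAt_sub hW ht hz]
  rw [← inner_mulR b1]
  refine (real_inner_le_norm _ _).trans (mul_le_mul_of_nonneg_left ?_ (norm_nonneg _))
  refine (mulR_norm_le h.meas_su h.su_le _).trans (le_of_eq ?_)
  rw [← LinearIsometry.map_sub, fr.norm_map]

/-- The derivative of the potential energy. The remainder of the linearization is at most
quadratic in the `L²` norm of the increment of `u`, which by interpolation is the product of its
`H⁻¹` norm, of order `|z - t|`, and of its `H¹` norm, which tends to `0`. -/
lemma hasDerivWithinAt_integral_primitiveG {t : ℝ} (ht : t ∈ Icc 0 T) :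
    HasDerivWithinAt (fun z => ∫ x, primitiveG g (uAt l W z x))
      (inner ℝ (sobTop 1 (fr (compR g (uAt l W t)))) (mulR ab (fr (qOf (kap ρ s) l W t))))
      (Icc 0 T) t := by
  obtain ⟨R, M, C, hb⟩ := h.exists_uAt_bound hW
  obtain ⟨L, hL0, hL⟩ := exists_lipOn h.g_one R
  have b1 : BddR (jb (-1)) := bddR_jb (by norm_num)
  have hk := kap_nonneg ρ s
  set Γ := sobTop 1 (fr (compR g (uAt l W t))) with hΓ
  have hΓe : mulR (jb (-1)) Γ = fr (compR g (uAt l W t)) :=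
    mulR_sobTop (sobBall_mono zero_le_one (by linarith) le_rfl (hb t ht).2.2)
  set X : ℝ → ComplexL2 := fun z => mulR (jb (-1)) (fr (uAt l W z)) with hX
  have hXd := h.hasDerivWithinAt_uAt hW ht
  have hlin : HasDerivWithinAt (fun z => inner ℝ Γ (X z))
      (inner ℝ Γ (mulR ab (fr (qOf (kap ρ s) l W t)))) (Icc 0 T) t :=
    (innerSL ℝ Γ).hasFDerivAt.comp_hasDerivWithinAt t hXd
  -- The remainder of the linearization at `u(t)`.
  set rem : ℝ → ℝ := fun z => (∫ x, primitiveG g (uAt l W z x))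
    - (∫ x, primitiveG g (uAt l W t x)) - (inner ℝ Γ (X z) - inner ℝ Γ (X t)) with hrem
  have hremle : ∀ z ∈ Icc 0 T, |rem z| ≤ L * (‖X z - X t‖
      * (c₁⁻¹ * ‖AOf (kap ρ s) l W z - AOf (kap ρ s) l W t‖)) := by
    intro z hz
    have h1 := abs_integral_primitiveG_sub_le h.g_one.continuous h.zero hL0 hL (hb t ht).1
      (hb z hz).1
    have e : inner ℝ (compR g (uAt l W t)) (uAt l W z - uAt l W t)
        = inner ℝ Γ (X z) - inner ℝ Γ (X t) := by
      rw [← fr.inner_map_map, ← hΓe, inner_mulR b1, LinearIsometry.map_sub, map_sub,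
        inner_sub_right]
    rw [e] at h1
    exact h1.trans (mul_le_mul_of_nonneg_left (h.norm_uAt_sub_sq_le hW ht hz) hL0)
  have hremd : HasDerivWithinAt rem 0 (Icc 0 T) t := by
    rw [hasDerivWithinAt_iff_isLittleO]
    have rem0 : rem t = 0 := by simp [hrem]
    simp only [rem0, sub_zero, smul_zero]
    have hO : (fun z => X z - X t) =O[𝓝[Icc 0 T] t] fun z => z - t :=
      hXd.hasFDerivWithinAt.isBigO_sub
    have ho : (fun z => L * (c₁⁻¹ * ‖AOf (kap ρ s) l W z - AOf (kap ρ s) l W t‖))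
        =o[𝓝[Icc 0 T] t] fun _ => (1 : ℝ) := by
      rw [Asymptotics.isLittleO_one_iff]
      have h1 := tendsto_iff_norm_sub_tendsto_zero.1 (h.continuousOn_AOf hW t ht)
      simpa using (h1.const_mul c₁⁻¹).const_mul L
    have h2 := ho.mul_isBigO hO.norm_norm
    simp only [one_mul] at h2
    refine Asymptotics.IsBigO.trans_isLittleO ?_ (h2.trans_isBigO
      (Asymptotics.isBigO_refl _ _).norm_left)
    refine Asymptotics.IsBigO.of_bound 1 ?_
    filter_upwards [self_mem_nhdsWithin] with z hz
    rw [one_mul, Real.norm_eq_abs]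
    refine (hremle z hz).trans ((le_of_eq ?_).trans (le_abs_self _))
    ring
  have hfin := ((hlin.sub_const (inner ℝ Γ (X t))).add hremd).add_const
    (∫ x, primitiveG g (uAt l W t x))
  rw [add_zero] at hfin
  refine hfin.congr_of_mem (fun z _ => ?_) ht
  simp only [hrem, Pi.add_apply]; ring

/-- The nonlinear term of the first order equation is `-i Λ g(u)`, in terms of the top order
coordinates. -/
lemma mulR_frIm_NOf_kap {t : ℝ} (ht : t ∈ Icc 0 T) :
    mulR (jb (-(kap ρ s))) (frIm (NOf (kap ρ s + 1) l g W t))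
      = -mulR ab (sobTop 1 (fr (compR g (uAt l W t)))) := by
  obtain ⟨R, M, C, hb⟩ := h.exists_uAt_bound hW
  have b1 : BddR (jb (-1)) := bddR_jb (by norm_num)
  have hk := kap_nonneg ρ s
  apply mulR_jb_injective zero_le_one
  have e := h.mulR_frIm_NOf hW ht
  rw [mulR_mulR b1 (bddR_kap ρ s), map_neg, mulR_mulR b1 bddR_ab]
  rw [← mulR_sobTop (sobBall_mono zero_le_one (by linarith) le_rfl (hb t ht).2.2 :
    fr (compR g (uAt l W t)) ∈ SobBall 1 C), mulR_mulR bddR_ab b1] at e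
  rw [mulR_congr (c := fun ξ => ab ξ * jb (-1) ξ) fun ξ => mul_comm _ _, ← e]
  refine congrFun (congrArg _ (mulR_congr fun ξ => ?_)) _
  rw [← jb_add]; congr 1; ring

/-- Conservation of energy. The terms `⟨K u, ω Λ⁻¹ u_t⟩` cancel because the group is unitary; the
work of the nonlinear term, up to the sign, is the derivative of the potential energy. -/
theorem energy_eq {t : ℝ} (ht : t ∈ Icc 0 T) :
    ‖ZOf (kap ρ s) l W t‖ ^ 2 + 2 * ∫ x, primitiveG g (uAt l W t x)
      = ‖ZOf (kap ρ s) l W 0‖ ^ 2 + 2 * ∫ x, primitiveG g (uAt l W 0 x) := by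
  have hd : ∀ t ∈ Icc 0 T, HasDerivWithinAt (fun t => ‖ZOf (kap ρ s) l W t‖ ^ 2
      + 2 * ∫ x, primitiveG g (uAt l W t x)) 0 (Icc 0 T) t := by
    intro t ht
    have h1 := h.hasDerivWithinAt_norm_sq hW (bddR_kap ρ s) ht
    have h2 := (h.hasDerivWithinAt_integral_primitiveG hW ht).const_mul 2
    have h3 := h1.add h2
    refine h3.congr_deriv ?_
    have e1 : mulR (jb (-(kap ρ s))) (NOf (kap ρ s + 1) l g W t)
        = Complex.I • mulR (jb (-(kap ρ s))) (frIm (NOf (kap ρ s + 1) l g W t)) := by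
      conv_lhs => rw [← frRe_add_frIm (NOf (kap ρ s + 1) l g W t), h.frRe_NOf hW ht, zero_add]
      rw [map_smul]
    have e2 : mulR (jb (-(kap ρ s))) (YOf (kap ρ s + 1) l W t)
        = fr (AOf (kap ρ s) l W t) + Complex.I • fr (qOf (kap ρ s) l W t) :=
      (frRe_add_frIm (ZOf (kap ρ s) l W t)).symm
    have e3 : mulR (jb (-(kap ρ s))) (frIm (NOf (kap ρ s + 1) l g W t))
        = fr (reInv (-(Complex.I • mulR (jb (-(kap ρ s))) (NOf (kap ρ s + 1) l g W t)))) :=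
      (frIm_mulR (bddR_kap ρ s) (jb_even _) _).symm
    rw [e2, e1, inner_add_left, inner_I_smul]
    nth_rewrite 1 [e3]
    -- The pairing of the real part `K u` with the purely imaginary nonlinear term vanishes; what
    -- is left is `-⟨Λ⁻¹ u_t, Λ g(u)⟩`.
    rw [inner_fr_I_fr, zero_add, h.mulR_frIm_NOf_kap hW ht, inner_neg_right,
      ← inner_mulR bddR_ab, real_inner_comm]
    ring
  exact constant_of_has_deriv_right_zero (fun x hx => (hd x hx).continuousWithinAt)
    (fun x hx => hasDerivWithinAt_Ici (hd x (Ico_subset_Icc_self hx)) hx) t ht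

end WaveData

/-! ### Levine's concavity argument -/

/-- Levine's concavity argument: `H^{-ν}` is concave, and hence `H / H'` decreases at least at the
rate `ν`. -/
lemma levine_bound {ν T : ℝ} (hν : 0 < ν) (hT : 0 ≤ T) {H D S : ℝ → ℝ}
    (hH : ∀ t ∈ Icc 0 T, HasDerivWithinAt H (D t) (Icc 0 T) t)
    (hD : ∀ t ∈ Icc 0 T, HasDerivWithinAt D (S t) (Icc 0 T) t) (hD0 : 0 < D 0)
    (hS : ∀ t ∈ Icc 0 T, 0 ≤ S t) (hH0 : 0 ≤ H T)
    (hHS : ∀ t ∈ Icc 0 T, (1 + ν) * D t ^ 2 ≤ H t * S t) : T ≤ H 0 / (ν * D 0) := by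
  have hsub := interior_subset (s := Icc (0 : ℝ) T)
  have hmono : MonotoneOn D (Icc 0 T) :=
    monotoneOn_of_hasDerivWithinAt_nonneg (convex_Icc 0 T)
      (fun t ht => (hD t ht).continuousWithinAt)
      (fun t ht => (hD t (hsub ht)).mono hsub) fun t ht => hS t (hsub ht)
  have h0 : (0 : ℝ) ∈ Icc 0 T := ⟨le_rfl, hT⟩
  have h1 : T ∈ Icc 0 T := ⟨hT, le_rfl⟩
  have hpos : ∀ t ∈ Icc 0 T, 0 < D t := fun t ht => hD0.trans_le (hmono h0 ht ht.1)
  have hf : ∀ t ∈ Icc 0 T, HasDerivWithinAt (fun t => H t / D t + ν * t)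
      ((D t * D t - H t * S t) / D t ^ 2 + ν * 1) (Icc 0 T) t := fun t ht =>
    ((hH t ht).div (hD t ht) (hpos t ht).ne').add ((hasDerivWithinAt_id t _).const_mul ν)
  have hanti : AntitoneOn (fun t => H t / D t + ν * t) (Icc 0 T) := by
    refine antitoneOn_of_hasDerivWithinAt_nonpos (convex_Icc 0 T)
      (fun t ht => (hf t ht).continuousWithinAt) (fun t ht => (hf t (hsub ht)).mono hsub)
      fun t ht => ?_
    have ht' := hsub ht
    have h2 := pow_pos (hpos t ht') 2
    have h3 : (D t * D t - H t * S t) / D t ^ 2 ≤ -ν := by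
      rw [div_le_iff₀ h2]
      have := hHS t ht'
      nlinarith
    linarith
  have h2 := hanti h0 h1 hT
  simp only [mul_zero, add_zero] at h2
  have h3 : 0 ≤ H T / D T := div_nonneg hH0 (hpos T h1).le
  rw [mul_comm ν, ← div_div, le_div_iff₀ hν]
  linarith

lemma exists_primitive {E : Type*} [NormedAddCommGroup E] [NormedSpace ℝ E] [CompleteSpace E]
    {q : ℝ → E} {T : ℝ} (hT : 0 ≤ T) (hq : ContinuousOn q (Icc 0 T)) (P₀ : E) :
    ∃ P : ℝ → E, P 0 = P₀ ∧ ∀ t ∈ Icc 0 T, HasDerivWithinAt P (q t) (Icc 0 T) t := by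
  set q' : ℝ → E := IccExtend hT ((Icc 0 T).domRestrict q)
  have hq' : Continuous q' := (continuousOn_iff_continuous_domRestrict.1 hq).Icc_extend'
  refine ⟨fun t => P₀ + ∫ x in (0 : ℝ)..t, q' x, by simp, fun t ht => ?_⟩
  have h1 := intervalIntegral.integral_hasDerivAt_right (hq'.intervalIntegrable 0 t)
    (hq'.stronglyMeasurable.stronglyMeasurableAtFilter) hq'.continuousAt
  have e : q' t = q t := IccExtend_of_mem hT _ ht
  rw [e] at h1
  exact (h1.const_add P₀).hasDerivWithinAt

/-- The product rule for `⟨P, q⟩` if `q` is continuous, but is differentiable only when paired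
with the one vector `P(t)`. -/
lemma hasDerivWithinAt_inner_of_continuous {E : Type*} [NormedAddCommGroup E]
    [InnerProductSpace ℝ E] {P q : ℝ → E} {P' : E} {m t : ℝ} {S : Set ℝ}
    (hP : HasDerivWithinAt P P' S t) (hq : ContinuousWithinAt q S t)
    (hm : HasDerivWithinAt (fun z => inner ℝ (P t) (q z)) m S t) :
    HasDerivWithinAt (fun z => inner ℝ (P z) (q z)) (inner ℝ P' (q t) + m) S t := by
  have h1 : HasDerivWithinAt (fun z => inner ℝ (P z - P t) (q z)) (inner ℝ P' (q t)) S t := by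
    rw [hasDerivWithinAt_iff_tendsto_slope] at hP ⊢
    have h2 := hP.inner (𝕜 := ℝ) (hq.tendsto.mono_left (nhdsWithin_mono t sdiff_subset))
    refine h2.congr fun z => ?_
    simp only [slope_def_module, sub_self, inner_zero_left, sub_zero, real_inner_smul_left,
      smul_eq_mul]
  refine (h1.add hm).congr (fun z _ => ?_) ?_
  · simp only [Pi.add_apply, inner_sub_left]; ring
  · simp

/-- The symbol `1 / (1 + ω)`. -/
def omInv (l : ℝ → ℝ) (ξ : ℝ) : ℝ := (1 + om l ξ)⁻¹

namespace WaveData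

variable {ρ s c₁ c₂ : ℝ} {l g : ℝ → ℝ} (h : WaveData ρ s c₁ c₂ l g)
include h

lemma omInv_pos (ξ : ℝ) : 0 < omInv l ξ := inv_pos.2 (by linarith [h.om_nonneg ξ])

lemma bddR_omInv : BddR (omInv l) := by
  refine ⟨(h.meas_om.const_add 1).inv, 1, fun ξ => ?_⟩
  rw [abs_of_pos (h.omInv_pos ξ)]
  exact inv_le_one_of_one_le₀ (by linarith [h.om_nonneg ξ])

lemma bddR_omInv_om : BddR fun ξ => omInv l ξ * om l ξ := by
  have h0 := h.om_nonneg
  refine ⟨h.bddR_omInv.1.mul h.meas_om, 1, fun ξ => ?_⟩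
  rw [abs_of_nonneg (mul_nonneg (h.omInv_pos ξ).le (h0 ξ)), omInv,
    inv_mul_le_iff₀ (by linarith [h0 ξ])]
  linarith

lemma omInv_even (ξ : ℝ) : omInv l (-ξ) = omInv l ξ := by rw [omInv, omInv, h.om_even]

variable {W₀ : ComplexL2} {T : ℝ} {W : ℝ → ComplexL2}
  (hW : IsSol (kap ρ s + 1) (field l g) W₀ T W)
include hW

/-- If `P = Λ⁻¹ u`, then `ω P = K u`. -/
lemma om_mul_fr {t : ℝ} (ht : t ∈ Icc 0 T) {P : RealL2}
    (hP : mulR ab (fr P) = mulR (jb (-1)) (fr (uAt l W t))) :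
    ∀ᵐ ξ, (om l ξ : ℂ) * fr P ξ = fr (AOf (kap ρ s) l W t) ξ := by
  have b1 : BddR (jb (-1)) := bddR_jb (by norm_num)
  have e1 := mulR_coe b1 (fr (uAt l W t))
  rw [h.fr_uAt hW ht] at hP e1
  rw [fr_AOf]
  filter_upwards [mulR_coe bddR_ab (fr P), e1, mulR_coe (h.bddR_su.mul (bddR_order ρ s))
    (frRe (YOf (kap ρ s + 1) l W t)), mulR_coe (bddR_kap ρ s) (frRe (YOf (kap ρ s + 1) l W t))]
    with ξ h1 h2 h3 h4
  rw [hP, h2, h3] at h1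
  rw [h4]
  have e : jb (-(kap ρ s + 1)) ξ = jb (-(kap ρ s)) ξ * jb (-1) ξ := by rw [← jb_add]; congr 1; ring
  rw [e] at h1
  have h5 : (jb (-1) ξ : ℂ) ≠ 0 := by exact_mod_cast jb_ne _ ξ
  have h6 : ((sl l ξ : ℝ) : ℂ) ≠ 0 := by exact_mod_cast h.sl_ne ξ
  have h7 : (jb (-1) ξ : ℂ) * (jb 1 ξ : ℂ) = 1 := by exact_mod_cast jb_neg_mul 1 ξ
  rw [ab, su] at h1
  rw [om]
  push_cast at h1 ⊢
  field_simp at h1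
  linear_combination (-1 : ℂ) * h1
    + (jb (-(kap ρ s)) ξ : ℂ) * (frRe (YOf (kap ρ s + 1) l W t) ξ) * h7

lemma mulR_omInv_fr {t : ℝ} (ht : t ∈ Icc 0 T) {P : RealL2}
    (hP : mulR ab (fr P) = mulR (jb (-1)) (fr (uAt l W t))) :
    mulR (omInv l) (fr P + fr (AOf (kap ρ s) l W t)) = fr P ∧
    mulR (fun ξ => omInv l ξ * om l ξ) (fr P + fr (AOf (kap ρ s) l W t))
      = fr (AOf (kap ρ s) l W t) := by
  have h0 := h.om_mul_fr hW ht hP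
  have key : ∀ ξ, (omInv l ξ : ℂ) * (1 + (om l ξ : ℂ)) = 1 := by
    intro ξ
    have : (1 + om l ξ) ≠ 0 := by linarith [h.om_nonneg ξ]
    exact_mod_cast inv_mul_cancel₀ this
  constructor
  · apply Lp.ext
    filter_upwards [mulR_coe h.bddR_omInv (fr P + fr (AOf (kap ρ s) l W t)),
      Lp.coeFn_add (fr P) (fr (AOf (kap ρ s) l W t)), h0] with ξ h1 h2 h3
    rw [h1, h2, Pi.add_apply, ← h3]
    linear_combination fr P ξ * key ξ
  · apply Lp.ext
    filter_upwards [mulR_coe h.bddR_omInv_om (fr P + fr (AOf (kap ρ s) l W t)),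
      Lp.coeFn_add (fr P) (fr (AOf (kap ρ s) l W t)), h0] with ξ h1 h2 h3
    rw [h1, h2, Pi.add_apply, ← h3]
    push_cast
    linear_combination (om l ξ : ℂ) * fr P ξ * key ξ

/-- The derivative of `⟨P(t), q⟩`, where `P = Λ⁻¹ u` and `q = Λ⁻¹ u_t`. The function `P(t)` is so
regular that the weak norm in which `q` is differentiable suffices. -/
lemma hasDerivWithinAt_inner_qOf {t : ℝ} (ht : t ∈ Icc 0 T) {P : RealL2}
    (hP : mulR ab (fr P) = mulR (jb (-1)) (fr (uAt l W t))) :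
    HasDerivWithinAt (fun z => inner ℝ P (qOf (kap ρ s) l W z))
      (-‖AOf (kap ρ s) l W t‖ ^ 2 - inner ℝ (uAt l W t) (compR g (uAt l W t))) (Icc 0 T) t := by
  obtain ⟨R, M, C, hbd⟩ := h.exists_uAt_bound hW
  have b1 : BddR (jb (-1)) := bddR_jb (by norm_num)
  obtain ⟨hP1, hP2⟩ := h.mulR_omInv_fr hW ht hP
  -- As `ω P = K u ∈ L²`, the function `F = (1 + ω) P` is in `L²`, and
  -- `⟨P, q⟩ = ⟨F, (1 + ω)⁻¹ q⟩`, where `(1 + ω)⁻¹ q` is differentiable in `L²`.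
  set F := fr P + fr (AOf (kap ρ s) l W t) with hF
  have hb : BddR fun ξ => omInv l ξ * jb (-(kap ρ s)) ξ := h.bddR_omInv.mul (bddR_kap ρ s)
  have hcomm : ∀ ξ, omInv l ξ * jb (-(kap ρ s)) ξ * om l ξ
      = omInv l ξ * om l ξ * jb (-(kap ρ s)) ξ := fun ξ => by ring
  have hbo : BddR fun ξ => omInv l ξ * jb (-(kap ρ s)) ξ * om l ξ := by
    simp only [hcomm]; exact h.bddR_omInv_om.mul (bddR_kap ρ s)
  have hd := h.hasDerivWithinAt_frIm_YOf hW hb (fun ξ => by simp [h.omInv_even]) hbo ht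
  have hd2 : HasDerivWithinAt (fun z => inner ℝ F (mulR (fun ξ => omInv l ξ * jb (-(kap ρ s)) ξ)
      (frIm (YOf (kap ρ s + 1) l W z)))) _ (Icc 0 T) t :=
    (innerSL ℝ F).hasFDerivAt.comp_hasDerivWithinAt t hd
  have e1 : ∀ z, inner ℝ P (qOf (kap ρ s) l W z) = inner ℝ F
      (mulR (fun ξ => omInv l ξ * jb (-(kap ρ s)) ξ) (frIm (YOf (kap ρ s + 1) l W z))) := by
    intro z
    rw [← fr.inner_map_map, fr_qOf, ← mulR_mulR h.bddR_omInv (bddR_kap ρ s),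
      ← inner_mulR h.bddR_omInv, hP1]
  simp only [e1]
  refine hd2.congr_deriv ?_
  simp only [innerSL_apply_apply]
  rw [mulR_congr hcomm, ← mulR_mulR h.bddR_omInv_om (bddR_kap ρ s),
    ← mulR_mulR h.bddR_omInv (bddR_kap ρ s), ← fr_AOf, h.mulR_frIm_NOf_kap hW ht, map_neg,
    inner_add_right, inner_neg_right, inner_neg_right, ← inner_mulR h.bddR_omInv_om, hP2,
    ← inner_mulR h.bddR_omInv, hP1, ← inner_mulR bddR_ab, hP, inner_mulR b1,
    mulR_sobTop (sobBall_mono zero_le_one (by linarith [kap_nonneg ρ s]) le_rfl (hbd t ht).2.2),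
    fr.inner_map_map, real_inner_self_eq_norm_sq, fr.inner_map_map]
  ring

/-- The structural condition on `g`, integrated over `x`. -/
lemma inner_compR_le {ν : ℝ} (hgG : ∀ p, p * g p ≤ 2 * (1 + 2 * ν) * primitiveG g p) {t : ℝ}
    (ht : t ∈ Icc 0 T) : inner ℝ (uAt l W t) (compR g (uAt l W t))
      ≤ 2 * (1 + 2 * ν) * ∫ x, primitiveG g (uAt l W t x) := by
  obtain ⟨R, M, C, hbd⟩ := h.exists_uAt_bound hW
  obtain ⟨L, hL0, hL⟩ := exists_lipOn h.g_one R
  rw [L2.inner_def, ← integral_const_mul]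
  refine integral_mono_ae (L2.integrable_inner (𝕜 := ℝ) _ _)
    ((integrable_primitiveG h.g_one.continuous h.zero hL0 hL (hbd t ht).1).const_mul _) ?_
  filter_upwards [compR_coe h.g_one.continuous h.zero hL (hbd t ht).1] with x hx
  simp only [hx, RCLike.inner_apply, conj_trivial]
  rw [mul_comm]
  exact hgG _

/-- The function `Λ⁻¹ u` along a trajectory. -/
lemma exists_lambdaInv (hT : 0 ≤ T) {P₀ : RealL2}
    (hP₀ : mulR ab (fr P₀) = mulR (jb (-1)) (fr (uOf l W₀))) :
    ∃ P : ℝ → RealL2, P 0 = P₀ ∧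
      (∀ t ∈ Icc 0 T, HasDerivWithinAt P (qOf (kap ρ s) l W t) (Icc 0 T) t) ∧
      ∀ t ∈ Icc 0 T, mulR ab (fr (P t)) = mulR (jb (-1)) (fr (uAt l W t)) := by
  obtain ⟨P, hP0, hP⟩ := exists_primitive hT (h.continuousOn_qOf hW) P₀
  refine ⟨P, hP0, hP, fun t ht => ?_⟩
  set f : ℝ → ComplexL2 := fun t => mulR ab (fr (P t)) - mulR (jb (-1)) (fr (uAt l W t)) with hf
  have hd : ∀ t ∈ Icc 0 T, HasDerivWithinAt f 0 (Icc 0 T) t := by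
    intro t ht
    have h1 : HasDerivWithinAt (fun z => mulR ab (fr (P z)))
        (mulR ab (fr (qOf (kap ρ s) l W t))) (Icc 0 T) t :=
      (((mulR ab).restrictScalars ℝ).comp
        fr.toContinuousLinearMap).hasFDerivAt.comp_hasDerivWithinAt t (hP t ht)
    have h2 := h1.sub (h.hasDerivWithinAt_uAt hW ht)
    rwa [sub_self] at h2
  have h0 : f 0 = 0 := by
    simp only [hf, hP0, uAt, yOf, neg_zero]
    rw [rot_zero, hW.initial, hP₀, sub_self]
  have h1 := constant_of_has_deriv_right_zero (fun x hx => (hd x hx).continuousWithinAt)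
    (fun x hx => hasDerivWithinAt_Ici (hd x (Ico_subset_Icc_self hx)) hx) t ht
  rw [h0] at h1
  exact sub_eq_zero.1 h1

omit hW in
/-- The existence time is bounded if the energy is negative. -/
theorem exists_time_bound {ν : ℝ} (hν : 0 < ν)
    (hgG : ∀ p, p * g p ≤ 2 * (1 + 2 * ν) * primitiveG g p) {P₀ : RealL2}
    (hP₀ : mulR ab (fr P₀) = mulR (jb (-1)) (fr (uOf l W₀)))
    (hE : ‖mulR (jb (-(kap ρ s))) (sobTop (kap ρ s + 1) W₀)‖ ^ 2
      + 2 * ∫ x, primitiveG g (uOf l W₀ x) < 0) :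
    ∃ B, ∀ T W, IsSol (kap ρ s + 1) (field l g) W₀ T W → T ≤ B := by
  set Z₀ := mulR (jb (-(kap ρ s))) (sobTop (kap ρ s + 1) W₀) with hZ₀
  set q₀ : RealL2 := reInv (-(Complex.I • Z₀)) with hq₀
  -- With `β = -E(0)` and a large time shift `t₀`, so that `H'(0) > 0`, the functional is
  -- `H(t) = ‖P(t)‖² + β (t + t₀)²`, where `P = Λ⁻¹ u`.
  set β : ℝ := -(‖Z₀‖ ^ 2 + 2 * ∫ x, primitiveG g (uOf l W₀ x)) with hβ
  have hβ0 : 0 < β := by rw [hβ]; linarith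
  obtain ⟨t₀, ht₀⟩ : ∃ t₀ : ℝ, 0 < 2 * inner ℝ P₀ q₀ + 2 * β * t₀ := by
    refine ⟨(1 - inner ℝ P₀ q₀) / β, ?_⟩
    have : 2 * β * ((1 - inner ℝ P₀ q₀) / β) = 2 * (1 - inner ℝ P₀ q₀) := by field_simp
    rw [this]; linarith
  refine ⟨(‖P₀‖ ^ 2 + β * t₀ ^ 2) / (ν * (2 * inner ℝ P₀ q₀ + 2 * β * t₀)), fun T W hW => ?_⟩
  rcases le_or_gt T 0 with hT | hT
  · exact hT.trans (by positivity)
  obtain ⟨P, hP0, hPd, hPu⟩ := h.exists_lambdaInv hW hT.le hP₀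
  set q := qOf (kap ρ s) l W with hq
  set A := AOf (kap ρ s) l W with hA
  have hW0 : yOf l W 0 = W₀ := by rw [yOf, neg_zero, rot_zero, hW.initial]
  have hZ0 : ZOf (kap ρ s) l W 0 = Z₀ := by
    rw [ZOf, YOf, neg_zero, rot_zero, hW.initial]
  have hq0 : q 0 = q₀ := by rw [hq, qOf, hZ0]
  have hH : ∀ t ∈ Icc 0 T, HasDerivWithinAt (fun t => ‖P t‖ ^ 2 + β * (t + t₀) ^ 2)
      (2 * inner ℝ (P t) (q t) + 2 * β * (t + t₀)) (Icc 0 T) t := by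
    intro t ht
    have h1 := (hPd t ht).norm_sq
    have h2 : HasDerivWithinAt (fun t => β * (t + t₀) ^ 2) (2 * β * (t + t₀)) (Icc 0 T) t := by
      have h3 := ((((hasDerivAt_id t).add_const t₀).pow 2).const_mul β).hasDerivWithinAt (s :=
        Icc 0 T)
      refine h3.congr_deriv ?_
      simp; ring
    exact h1.add h2
  have hD : ∀ t ∈ Icc 0 T, HasDerivWithinAt
      (fun t => 2 * inner ℝ (P t) (q t) + 2 * β * (t + t₀))
      (2 * (inner ℝ (q t) (q t) + (-‖A t‖ ^ 2 - inner ℝ (uAt l W t) (compR g (uAt l W t))))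
        + 2 * β) (Icc 0 T) t := by
    intro t ht
    have h1 := hasDerivWithinAt_inner_of_continuous (hPd t ht) (h.continuousOn_qOf hW t ht)
      (h.hasDerivWithinAt_inner_qOf hW ht (hPu t ht))
    have h2 : HasDerivWithinAt (fun t => 2 * β * (t + t₀)) (2 * β) (Icc 0 T) t := by
      simpa using (((hasDerivAt_id t).add_const t₀).const_mul (2 * β)).hasDerivWithinAt (s :=
        Icc 0 T)
    exact (h1.const_mul 2).add h2
  -- A lower bound of `H''`: the structural condition bounds `⟨u, g(u)⟩` by the potential energy,
  -- and conservation of energy expresses this by `K u`, `q` and `β`.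
  have hS : ∀ t ∈ Icc 0 T, 4 * (1 + ν) * (‖q t‖ ^ 2 + β) ≤
      2 * (inner ℝ (q t) (q t) + (-‖A t‖ ^ 2 - inner ℝ (uAt l W t) (compR g (uAt l W t))))
        + 2 * β := by
    intro t ht
    have h1 := h.inner_compR_le hW hgG ht
    have h2 := h.energy_eq hW ht
    rw [WaveData.norm_ZOf_sq, hZ0, uAt, uAt, hW0] at h2
    rw [real_inner_self_eq_norm_sq]
    have h3 : 2 * ∫ x, primitiveG g (uAt l W t x) = -β - ‖A t‖ ^ 2 - ‖q t‖ ^ 2 := by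
      change _ = _ at h2
      rw [hβ]; simp only [uAt]; linarith
    have h4 : 2 * (1 + 2 * ν) * ∫ x, primitiveG g (uAt l W t x)
        = (1 + 2 * ν) * (-β - ‖A t‖ ^ 2 - ‖q t‖ ^ 2) := by rw [← h3]; ring
    rw [h4] at h1
    nlinarith [sq_nonneg ‖A t‖]
  have key := levine_bound hν hT.le hH hD (by rw [hP0, hq0, zero_add]; exact ht₀)
    (fun t ht => le_trans (by positivity) (hS t ht)) (by positivity) fun t ht => ?_
  · rw [hP0, hq0, zero_add] at key; exact key
  · refine le_trans ?_ (mul_le_mul_of_nonneg_left (hS t ht) (by positivity))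
    -- `H'² ≤ 4 H (‖q‖² + β)`, by the Cauchy-Schwarz inequality in `L² × ℝ` for the vectors
    -- `(P, √β (t + t₀))` and `(q, √β)`.
    have h1 := abs_real_inner_le_norm (P t) (q t)
    have h2 : (inner ℝ (P t) (q t) + β * (t + t₀)) ^ 2
        ≤ (‖P t‖ ^ 2 + β * (t + t₀) ^ 2) * (‖q t‖ ^ 2 + β) := by
      have h3 : inner ℝ (P t) (q t) ^ 2 ≤ ‖P t‖ ^ 2 * ‖q t‖ ^ 2 := by
        rw [← mul_pow, ← sq_abs]
        exact pow_le_pow_left₀ (abs_nonneg _) h1 2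
      have h4 : 2 * (inner ℝ (P t) (q t)) * (t + t₀) ≤ ‖P t‖ ^ 2 + ‖q t‖ ^ 2 * (t + t₀) ^ 2 := by
        have h5 : inner ℝ (P t) (q t) * (t + t₀) ≤ ‖P t‖ * (‖q t‖ * |t + t₀|) := by
          refine (le_abs_self _).trans ?_
          rw [abs_mul, ← mul_assoc]
          exact mul_le_mul_of_nonneg_right h1 (abs_nonneg _)
        have h6 : (‖q t‖ * |t + t₀|) ^ 2 = ‖q t‖ ^ 2 * (t + t₀) ^ 2 := by rw [mul_pow, sq_abs]
        nlinarith [sq_nonneg (‖P t‖ - ‖q t‖ * |t + t₀|)]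
      nlinarith
    have e : (1 + ν) * (2 * inner ℝ (P t) (q t) + 2 * β * (t + t₀)) ^ 2
        = 4 * (1 + ν) * (inner ℝ (P t) (q t) + β * (t + t₀)) ^ 2 := by ring
    rw [e]
    have h7 := mul_le_mul_of_nonneg_left h2 (by positivity : 0 ≤ 4 * (1 + ν))
    linarith

end WaveData

/-! ### Trajectories solve the Cauchy problem -/

lemma memH_and_normH_eq {σ : ℝ} {f : 𝓢'(ℝ, ℂ)} {F : ℝ → ℂ} (hf : HasFourier f F) {w : ComplexL2}
    (hw : w =ᵐ[volume] fun ξ => (jb σ ξ : ℂ) * F ξ) : MemH σ f ∧ normH σ f = ‖w‖ₑ := by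
  rw [memH_iff hf, normH_eq hf, ← eLpNorm_congr_ae hw, ← Lp.enorm_def]
  exact ⟨(Lp.memLp w).ae_eq hw, rfl⟩

/-- The time derivative of `u` along a trajectory. -/
def vAt (l : ℝ → ℝ) (W : ℝ → ComplexL2) (t : ℝ) : 𝓢'(ℝ, ℂ) :=
  distOf (mulR ab (frIm (yOf l W t)))

/-- The symbol which maps `(1 + η²)^{(κ+1)/2} y` to `(1 + η²)^{σ/2} u`. -/
def uSym (ρ s σ : ℝ) (l : ℝ → ℝ) (ξ : ℝ) : ℝ := jb σ ξ * (su l ξ * jb (-(kap ρ s + 1)) ξ)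

/-- The symbol which maps `(1 + η²)^{(κ+1)/2} y` to `(1 + η²)^{(s-1-ρ/2)/2} u_t`. -/
def vSym (ρ s : ℝ) (ξ : ℝ) : ℝ :=
  jb (s - 1 - ρ / 2) ξ * (jb 2 ξ * (ab ξ * jb (-(kap ρ s + 1)) ξ))

lemma bddR_vSym (ρ s : ℝ) : BddR (vSym ρ s) := by
  refine ⟨(measurable_jb _).mul ((measurable_jb _).mul (measurable_ab.mul (measurable_jb _))), 1,
    fun ξ => ?_⟩
  have e : vSym ρ s ξ = ab ξ * jb (s - ρ / 2 - kap ρ s) ξ := by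
    have : jb (s - ρ / 2 - kap ρ s) ξ
        = jb (s - 1 - ρ / 2) ξ * (jb 2 ξ * jb (-(kap ρ s + 1)) ξ) := by
      rw [← jb_add, ← jb_add]; congr 1; ring
    rw [vSym, this]; ring
  have hk : s - ρ / 2 ≤ kap ρ s := le_max_left _ _
  have h1 := jb_le_one (σ := s - ρ / 2 - kap ρ s) (by linarith) ξ
  rw [e, abs_mul, abs_of_pos (jb_pos _ _)]
  exact mul_le_one₀ (abs_ab_le_one ξ) (jb_pos _ _).le h1

namespace WaveData

variable {ρ s c₁ c₂ : ℝ} {l g : ℝ → ℝ} (h : WaveData ρ s c₁ c₂ l g)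
include h

lemma uSym_even (σ ξ : ℝ) : uSym ρ s σ l (-ξ) = uSym ρ s σ l ξ := by simp [uSym, h.su_even]

lemma bddR_uSym {σ : ℝ} (hσ : σ ≤ s) : BddR (uSym ρ s σ l) := by
  have hc := h.c₁_pos
  refine ⟨(measurable_jb _).mul (h.meas_su.mul (measurable_jb _)), c₁⁻¹, fun ξ => ?_⟩
  have p1 := jb_pos σ ξ
  have p2 := jb_pos (-(kap ρ s + 1)) ξ
  rw [uSym, abs_of_pos (mul_pos p1 (mul_pos (h.su_pos ξ) p2))]
  have h1 := h.su_le_jb ξ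
  have h2 : jb σ ξ * (jb (1 - ρ / 2) ξ * jb (-(kap ρ s + 1)) ξ) ≤ 1 := by
    rw [← jb_add, ← jb_add]
    apply jb_le_one
    have : s - ρ / 2 ≤ kap ρ s := le_max_left _ _
    linarith
  calc jb σ ξ * (su l ξ * jb (-(kap ρ s + 1)) ξ)
      ≤ jb σ ξ * (c₁⁻¹ * jb (1 - ρ / 2) ξ * jb (-(kap ρ s + 1)) ξ) := by gcongr
    _ = c₁⁻¹ * (jb σ ξ * (jb (1 - ρ / 2) ξ * jb (-(kap ρ s + 1)) ξ)) := by ring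
    _ ≤ c₁⁻¹ * 1 := by gcongr
    _ = c₁⁻¹ := mul_one _

lemma uSym_mul_om (ξ : ℝ) : uSym ρ s (s - 1 - ρ / 2) l ξ * om l ξ = vSym ρ s ξ := by
  have h1 := h.sl_ne ξ
  have e : jb 2 ξ = jb 1 ξ * jb 1 ξ := by rw [← jb_add]; norm_num
  have h2 := jb_neg_mul 1 ξ
  have h3 : jb 1 ξ / sl l ξ * sl l ξ = jb 1 ξ := div_mul_cancel₀ _ h1
  rw [uSym, vSym, su, om, ab, e]
  linear_combination jb (s - 1 - ρ / 2) ξ * jb (-(kap ρ s + 1)) ξ * |2 * Real.pi * ξ|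
    * (h3 - jb 1 ξ * h2)

variable {W₀ : ComplexL2} {T : ℝ} {W : ℝ → ComplexL2}
  (hW : IsSol (kap ρ s + 1) (field l g) W₀ T W)
include hW

lemma hasFourier_vAt {t : ℝ} (ht : t ∈ Icc 0 T) : HasFourier (vAt l W t) fun ξ =>
    (jb 2 ξ : ℂ) * mulR (fun ξ => ab ξ * jb (-(kap ρ s + 1)) ξ) (frIm (YOf (kap ρ s + 1) l W t))
      ξ := by
  rw [← mulR_mulR bddR_ab (bddR_order ρ s), ← frIm_mulR (bddR_order ρ s) (jb_even _),
    h.mulR_YOf hW ht]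
  exact hasFourier_distOf _

lemma uSym_ae {σ : ℝ} (hσ : σ ≤ s) {t : ℝ} (ht : t ∈ Icc 0 T) :
    mulR (uSym ρ s σ l) (frRe (YOf (kap ρ s + 1) l W t)) =ᵐ[volume]
      fun ξ => (jb σ ξ : ℂ) * fr (uAt l W t) ξ := by
  rw [h.fr_uAt hW ht]
  filter_upwards [mulR_coe (h.bddR_uSym hσ) (frRe (YOf (kap ρ s + 1) l W t)),
    mulR_coe (h.bddR_su.mul (bddR_order ρ s)) (frRe (YOf (kap ρ s + 1) l W t))] with ξ h1 h2
  rw [h1, h2, uSym]; push_cast; ring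

omit h hW in
lemma vSym_ae (F : ComplexL2) :
    mulR (vSym ρ s) F =ᵐ[volume] fun ξ => (jb (s - 1 - ρ / 2) ξ : ℂ) * ((jb 2 ξ : ℂ) *
      mulR (fun ξ => ab ξ * jb (-(kap ρ s + 1)) ξ) F ξ) := by
  filter_upwards [mulR_coe (bddR_vSym ρ s) F, mulR_coe (bddR_ab.mul (bddR_order ρ s)) F]
    with ξ h1 h2
  rw [h1, h2, vSym]; push_cast; ring

lemma memH_uAt {t : ℝ} (ht : t ∈ Icc 0 T) : MemH s (uAt l W t).toDist :=
  (memH_and_normH_eq (hasFourier_toDist _) (h.uSym_ae hW le_rfl ht)).1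

lemma memH_vAt {t : ℝ} (ht : t ∈ Icc 0 T) : MemH (s - 1 - ρ / 2) (vAt l W t) :=
  (memH_and_normH_eq (h.hasFourier_vAt hW ht) (vSym_ae _)).1

lemma normH_uAt_sub {t z : ℝ} (ht : t ∈ Icc 0 T) (hz : z ∈ Icc 0 T) :
    normH s ((uAt l W z).toDist - (uAt l W t).toDist)
      = ‖mulR (uSym ρ s s l) (frRe (YOf (kap ρ s + 1) l W z))
        - mulR (uSym ρ s s l) (frRe (YOf (kap ρ s + 1) l W t))‖ₑ := by
  refine (memH_and_normH_eq ((hasFourier_toDist _).sub (hasFourier_toDist _)) ?_).2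
  filter_upwards [h.uSym_ae hW le_rfl ht, h.uSym_ae hW le_rfl hz,
    Lp.coeFn_sub (mulR (uSym ρ s s l) (frRe (YOf (kap ρ s + 1) l W z)))
      (mulR (uSym ρ s s l) (frRe (YOf (kap ρ s + 1) l W t)))] with ξ h1 h2 h3
  rw [h3, Pi.sub_apply, h1, h2, mul_sub]; rfl

lemma normH_vAt_sub {t z : ℝ} (ht : t ∈ Icc 0 T) (hz : z ∈ Icc 0 T) :
    normH (s - 1 - ρ / 2) (vAt l W z - vAt l W t)
      = ‖mulR (vSym ρ s) (frIm (YOf (kap ρ s + 1) l W z))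
        - mulR (vSym ρ s) (frIm (YOf (kap ρ s + 1) l W t))‖ₑ := by
  refine (memH_and_normH_eq ((h.hasFourier_vAt hW hz).sub (h.hasFourier_vAt hW ht)) ?_).2
  filter_upwards [vSym_ae (frIm (YOf (kap ρ s + 1) l W z)),
    vSym_ae (frIm (YOf (kap ρ s + 1) l W t)),
    Lp.coeFn_sub (mulR (vSym ρ s) (frIm (YOf (kap ρ s + 1) l W z)))
      (mulR (vSym ρ s) (frIm (YOf (kap ρ s + 1) l W t)))] with ξ h1 h2 h3
  rw [h3, Pi.sub_apply, h1, h2, mul_sub]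

lemma normH_slope {t z : ℝ} (ht : t ∈ Icc 0 T) (hz : z ∈ Icc 0 T) :
    normH (s - 1 - ρ / 2)
      ((((z - t)⁻¹ : ℝ) : ℂ) • ((uAt l W z).toDist - (uAt l W t).toDist) - vAt l W t)
      = ‖slope (fun z => mulR (uSym ρ s (s - 1 - ρ / 2) l) (frRe (YOf (kap ρ s + 1) l W z))) t z
        - mulR (vSym ρ s) (frIm (YOf (kap ρ s + 1) l W t))‖ₑ := by
  have hσ : s - 1 - ρ / 2 ≤ s := by linarith [h.two_le]
  refine (memH_and_normH_eq ((((hasFourier_toDist _).sub (hasFourier_toDist _)).smul _).sub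
    (h.hasFourier_vAt hW ht)) ?_).2
  set a := fun z => mulR (uSym ρ s (s - 1 - ρ / 2) l) (frRe (YOf (kap ρ s + 1) l W z)) with ha
  filter_upwards [h.uSym_ae hW hσ ht, h.uSym_ae hW hσ hz,
    vSym_ae (frIm (YOf (kap ρ s + 1) l W t)),
    Lp.coeFn_sub (slope a t z) (mulR (vSym ρ s) (frIm (YOf (kap ρ s + 1) l W t))),
    Lp.coeFn_smul (z - t)⁻¹ (a z - a t), Lp.coeFn_sub (a z) (a t)] with ξ h1 h2 h3 h4 h5 h6
  rw [h4, Pi.sub_apply, slope_def_module, h5, Pi.smul_apply, h6, Pi.sub_apply, h3]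
  simp only [ha]
  rw [h1, h2, Complex.real_smul]
  simp only [fr_apply]
  ring

lemma tendsto_normH_slope {t : ℝ} (ht : t ∈ Icc 0 T) :
    Tendsto (fun z => normH (s - 1 - ρ / 2)
      ((((z - t)⁻¹ : ℝ) : ℂ) • ((uAt l W z).toDist - (uAt l W t).toDist) - vAt l W t))
      (𝓝[Icc 0 T \ {t}] t) (𝓝 0) := by
  have hσ : s - 1 - ρ / 2 ≤ s := by linarith [h.two_le]
  have hbo : BddR fun ξ => uSym ρ s (s - 1 - ρ / 2) l ξ * om l ξ := by
    simp only [h.uSym_mul_om]; exact bddR_vSym ρ s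
  have hd := h.hasDerivWithinAt_frRe_YOf hW (h.bddR_uSym hσ) (h.uSym_even _) hbo ht
  rw [mulR_congr h.uSym_mul_om, hasDerivWithinAt_iff_tendsto_slope] at hd
  have h1 := (tendsto_iff_norm_sub_tendsto_zero.1 hd)
  have h2 := (ENNReal.continuous_ofReal.tendsto 0).comp h1
  rw [ENNReal.ofReal_zero] at h2
  refine h2.congr' ?_
  filter_upwards [self_mem_nhdsWithin] with z hz
  rw [h.normH_slope hW ht hz.1, Function.comp_apply, ofReal_norm]

omit h hW in
lemma _root_.tendsto_enorm_sub {S : Set ℝ} {t : ℝ} {f : ℝ → ComplexL2}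
    (hf : ContinuousWithinAt f S t) : Tendsto (fun z => ‖f z - f t‖ₑ) (𝓝[S] t) (𝓝 0) := by
  have h2 := (ENNReal.continuous_ofReal.tendsto 0).comp (tendsto_iff_norm_sub_tendsto_zero.1 hf)
  rw [ENNReal.ofReal_zero] at h2
  exact h2.congr fun z => by rw [Function.comp_apply, ofReal_norm]

lemma tendsto_normH_uAt {t : ℝ} (ht : t ∈ Icc 0 T) :
    Tendsto (fun z => normH s ((uAt l W z).toDist - (uAt l W t).toDist)) (𝓝[Icc 0 T] t) (𝓝 0) := by
  have hc : ContinuousOn (fun z => mulR (uSym ρ s s l) (frRe (YOf (kap ρ s + 1) l W z)))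
      (Icc 0 T) :=
    ((mulR _).continuous.comp continuous_frRe).comp_continuousOn (h.continuousOn_YOf hW)
  refine (tendsto_enorm_sub (hc t ht)).congr' ?_
  filter_upwards [self_mem_nhdsWithin] with z hz
  rw [h.normH_uAt_sub hW ht hz]

lemma tendsto_normH_vAt {t : ℝ} (ht : t ∈ Icc 0 T) :
    Tendsto (fun z => normH (s - 1 - ρ / 2) (vAt l W z - vAt l W t)) (𝓝[Icc 0 T] t) (𝓝 0) := by
  have hc : ContinuousOn (fun z => mulR (vSym ρ s) (frIm (YOf (kap ρ s + 1) l W z)))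
      (Icc 0 T) :=
    ((mulR _).continuous.comp continuous_frIm).comp_continuousOn (h.continuousOn_YOf hW)
  refine (tendsto_enorm_sub (hc t ht)).congr' ?_
  filter_upwards [self_mem_nhdsWithin] with z hz
  rw [h.normH_vAt_sub hW ht hz]

end WaveData

/-! ### The equation in the sense of distributions -/

lemma exists_schwartz_jb_mul (n : ℕ) (θ : 𝓢(ℝ, ℂ)) :
    ∃ χ : 𝓢(ℝ, ℂ), ∀ ξ, χ ξ = (jb (2 * n) ξ : ℂ) * θ ξ := by
  induction n with
  | zero => exact ⟨θ, fun ξ => by simp⟩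
  | succ n ih =>
    obtain ⟨χ, hχ⟩ := ih
    refine ⟨SchwartzMap.smulLeftCLM ℂ jbTwo χ, fun ξ => ?_⟩
    have e : jb (2 * ((n + 1 : ℕ) : ℝ)) ξ = jb (2 * n) ξ * jb 2 ξ := by
      rw [← jb_add]; congr 1; push_cast; ring
    rw [SchwartzMap.smulLeftCLM_apply_apply jbTwo_temperate, e, hχ, jb_two, jbTwo, smul_eq_mul]
    push_cast; ring

lemma memLp_mul_schwartz {b : ℝ → ℝ} (hb : Measurable b) {C σ : ℝ} (h : ∀ ξ, |b ξ| ≤ C * jb σ ξ)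
    (θ : 𝓢(ℝ, ℂ)) : MemLp (fun ξ => (b ξ : ℂ) * θ ξ) 2 volume := by
  obtain ⟨n, hn⟩ := exists_nat_ge (σ / 2)
  obtain ⟨χ, hχ⟩ := exists_schwartz_jb_mul n θ
  have hC : 0 ≤ C := by
    have h1 := (abs_nonneg _).trans (h 0)
    exact nonneg_of_mul_nonneg_left h1 (jb_pos _ _)
  refine (memLp_schwartz χ).of_le_mul (c := C) ((Complex.measurable_ofReal.comp
    hb).aestronglyMeasurable.mul θ.continuous.aestronglyMeasurable) (ae_of_all _ fun ξ => ?_)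
  rw [hχ, norm_mul, norm_mul, Complex.norm_real, Complex.norm_real, ← mul_assoc, Real.norm_eq_abs,
    Real.norm_of_nonneg (jb_pos _ _).le]
  refine mul_le_mul_of_nonneg_right ((h ξ).trans ?_) (norm_nonneg _)
  exact mul_le_mul_of_nonneg_left (jb_mono (by linarith) ξ) hC

lemma HasFourier.apply {f : 𝓢'(ℝ, ℂ)} {F : ℝ → ℂ} (h : HasFourier f F) (θ : 𝓢(ℝ, ℂ)) :
    f θ = ∫ ξ, F ξ * (𝓕⁻ θ) ξ := by
  rw [← (h (𝓕⁻ θ)).2]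
  change f θ = f (𝓕 (𝓕⁻ θ))
  rw [FourierTransform.fourier_fourierInv_eq]

lemma fourierInv_iteratedDeriv_two (θ : 𝓢(ℝ, ℂ)) : ∃ χ : 𝓢(ℝ, ℂ),
    (∀ x, (𝓕 χ) x = iteratedDeriv 2 θ x) ∧ ∀ ξ, χ ξ = ((-(2 * Real.pi * ξ) ^ 2 : ℝ) : ℂ) * (𝓕⁻ θ)
      ξ := by
  set D := SchwartzMap.derivCLM ℂ ℂ with hD
  have hDc : ∀ χ : 𝓢(ℝ, ℂ), ((D χ : 𝓢(ℝ, ℂ)) : ℝ → ℂ) = deriv χ := fun χ => by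
    ext x; simp [hD, SchwartzMap.derivCLM_apply]
  have hF : ∀ (χ : 𝓢(ℝ, ℂ)) (ξ : ℝ), (𝓕⁻ (D χ)) ξ = -(2 * Real.pi * Complex.I * ξ) * (𝓕⁻ χ) ξ := by
    intro χ ξ
    have h1 := congrFun (Real.fourier_deriv χ.integrable χ.differentiable
      (by rw [← hDc]; exact (D χ).integrable)) (-ξ)
    rw [SchwartzMap.fourierInv_coe, SchwartzMap.fourierInv_coe, Real.fourierInv_eq_fourier_neg,
      Real.fourierInv_eq_fourier_neg, hDc, h1, smul_eq_mul]
    push_cast; ring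
  refine ⟨𝓕⁻ (D (D θ)), fun x => ?_, fun ξ => ?_⟩
  · rw [FourierTransform.fourier_fourierInv_eq, hDc, hDc, iteratedDeriv_succ, iteratedDeriv_one]
  · rw [hF, hF]
    push_cast
    linear_combination (2 * Real.pi * ξ : ℂ) ^ 2 * (𝓕⁻ θ) ξ * Complex.I_sq

lemma pairGxx_eq {g : ℝ → ℝ} {R L : ℝ} (hg : Continuous g) (g0 : g 0 = 0) (hL : LipOn g R L)
    {u : RealL2} (hu : ∀ᵐ x, |u x| ≤ R) (θ : 𝓢(ℝ, ℂ)) :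
    pairGxx g u θ = ∫ ξ, fr (compR g u) ξ * (((-(2 * Real.pi * ξ) ^ 2 : ℝ) : ℂ) * (𝓕⁻ θ) ξ) := by
  obtain ⟨χ, h1, h2⟩ := fourierInv_iteratedDeriv_two θ
  simp only [← h2]
  rw [integral_fr_mul, pairGxx]
  apply integral_congr_ae
  filter_upwards [compR_coe hg g0 hL hu] with x hx
  rw [hx, h1]

/-- The functional `F ↦ ∫ F Ψ` on `L²`. -/
def pairL2 (Ψ : ComplexL2) : ComplexL2 →L[ℝ] ℂ := (innerSL ℂ (star Ψ)).restrictScalars ℝ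

lemma pairL2_apply (Ψ F : ComplexL2) : pairL2 Ψ F = ∫ ξ, F ξ * Ψ ξ := by
  change inner ℂ (star Ψ) F = _
  rw [L2.inner_def]
  apply integral_congr_ae
  filter_upwards [Lp.coeFn_star Ψ] with ξ h
  rw [h]
  simp

namespace WaveData

variable {ρ s c₁ c₂ : ℝ} {l g : ℝ → ℝ} (h : WaveData ρ s c₁ c₂ l g)
include h

lemma om_le (ξ : ℝ) : om l ξ ≤ c₂ * jb (1 + ρ / 2) ξ := by
  have e : c₂ * jb (1 + ρ / 2) ξ = jb 1 ξ * (c₂ * jb (ρ / 2) ξ) := by rw [jb_add]; ring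
  rw [e, om]
  exact mul_le_mul (abs_le_jb_one ξ) (h.sl_le ξ) (h.sl_pos ξ).le (jb_pos _ _).le

/-- The symbol `|η| (1 + η²)^{1/2} (1 + ω)` grows polynomially, so that its product with a test
function is in `L²`. -/
lemma memLp_pair (θ : 𝓢(ℝ, ℂ)) :
    MemLp (fun ξ => ((jb 2 ξ * ab ξ * (1 + om l ξ) : ℝ) : ℂ) * θ ξ) 2 volume := by
  refine memLp_mul_schwartz (b := fun ξ => jb 2 ξ * ab ξ * (1 + om l ξ))
    (((measurable_jb 2).mul measurable_ab).mul (h.meas_om.const_add 1))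
    (C := 1 + c₂) (σ := 2 + (1 + ρ / 2)) (fun ξ => ?_) θ
  have h0 := h.om_nonneg ξ
  have h1 := h.om_le ξ
  have h2 : 1 ≤ jb (1 + ρ / 2) ξ := one_le_jb (by linarith [h.two_le]) ξ
  have h3 := jb_pos 2 ξ
  rw [abs_of_nonneg (mul_nonneg (mul_nonneg h3.le (ab_nonneg ξ)) (by linarith)), jb_add]
  have h4 : ab ξ * (1 + om l ξ) ≤ 1 * ((1 + c₂) * jb (1 + ρ / 2) ξ) :=
    mul_le_mul (ab_le_one ξ) (by nlinarith) (by linarith) zero_le_one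
  calc jb 2 ξ * ab ξ * (1 + om l ξ) = jb 2 ξ * (ab ξ * (1 + om l ξ)) := by ring
    _ ≤ jb 2 ξ * (1 * ((1 + c₂) * jb (1 + ρ / 2) ξ)) := mul_le_mul_of_nonneg_left h4 h3.le
    _ = _ := by ring

variable {W₀ : ComplexL2} {T : ℝ} {W : ℝ → ComplexL2}
  (hW : IsSol (kap ρ s + 1) (field l g) W₀ T W)
include hW

/-- A trajectory satisfies the equation in the sense of tempered distributions. -/
theorem hasDerivWithinAt_vAt (θ : 𝓢(ℝ, ℂ)) {t : ℝ} (ht : t ∈ Icc 0 T) :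
    HasDerivWithinAt (fun τ => vAt l W τ θ)
      (pairLxx l (uAt l W t) θ + pairGxx g (uAt l W t) θ) (Icc 0 T) t := by
  obtain ⟨R, M, C, hbd⟩ := h.exists_uAt_bound hW
  obtain ⟨L, hL0, hL⟩ := exists_lipOn h.g_one R
  set r := kap ρ s + 1 with hr
  -- The pairing of `u_t` with `θ` is an `L²` pairing of
  -- `(1 + ω)⁻¹ (1 + η²)^{-1/2} Λ⁻¹ u_t` with `Ψ`.
  set Ψ : ComplexL2 := (h.memLp_pair (𝓕⁻ θ)).toLp with hΨ
  have hΨe := (h.memLp_pair (𝓕⁻ θ)).coeFn_toLp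
  have hb : BddR fun ξ => omInv l ξ * jb (-r) ξ := h.bddR_omInv.mul (bddR_order ρ s)
  have hcomm : ∀ ξ, omInv l ξ * jb (-r) ξ * om l ξ = omInv l ξ * om l ξ * jb (-r) ξ :=
    fun ξ => by ring
  have hbo : BddR fun ξ => omInv l ξ * jb (-r) ξ * om l ξ := by
    simp only [hcomm]; exact h.bddR_omInv_om.mul (bddR_order ρ s)
  have key : ∀ ξ, (omInv l ξ : ℂ) * (1 + (om l ξ : ℂ)) = 1 := by
    intro ξ
    have : (1 + om l ξ) ≠ 0 := by linarith [h.om_nonneg ξ]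
    exact_mod_cast inv_mul_cancel₀ this
  have habs : ∀ ξ, (|2 * Real.pi * ξ| : ℝ) ^ 2 = (2 * Real.pi * ξ) ^ 2 := fun ξ => sq_abs _
  have hj : ∀ ξ, jb 2 ξ = jb 1 ξ * jb 1 ξ := fun ξ => by rw [← jb_add]; norm_num
  have e0 : ∀ τ ∈ Icc 0 T, vAt l W τ θ
      = pairL2 Ψ (mulR (fun ξ => omInv l ξ * jb (-r) ξ) (frIm (YOf r l W τ))) := by
    intro τ hτ
    rw [(h.hasFourier_vAt hW hτ).apply, pairL2_apply]
    apply integral_congr_ae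
    filter_upwards [hΨe, mulR_coe hb (frIm (YOf r l W τ)),
      mulR_coe (bddR_ab.mul (bddR_order ρ s)) (frIm (YOf r l W τ))] with ξ h1 h2 h3
    rw [h1, h2, h3]
    push_cast
    linear_combination -(jb (-r) ξ : ℂ) * (jb 2 ξ : ℂ) * (ab ξ : ℂ) * (frIm (YOf r l W τ) ξ)
      * (𝓕⁻ θ) ξ * key ξ
  have hd := (pairL2 Ψ).hasFDerivAt.comp_hasDerivWithinAt t
    (h.hasDerivWithinAt_frIm_YOf hW hb (fun ξ => by simp [h.omInv_even]) hbo ht)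
  refine (hd.congr_of_mem (fun τ hτ => e0 τ hτ) ht).congr_deriv ?_
  rw [map_add, map_neg]
  congr 1
  · rw [pairL2_apply, pairLxx, ← integral_neg]
    apply integral_congr_ae
    have hu := h.fr_uAt hW ht
    have hu' := mulR_coe (h.bddR_su.mul (bddR_order ρ s)) (frRe (YOf r l W t))
    rw [← hu] at hu'
    filter_upwards [hΨe, mulR_coe hbo (frRe (YOf r l W t)), hu'] with ξ h1 h2 h3
    rw [← fr_apply, h1, h2, h3, ← h.sl_sq ξ]
    have h4 : (su l ξ : ℂ) * (sl l ξ : ℂ) = (jb 1 ξ : ℂ) := by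
      exact_mod_cast div_mul_cancel₀ _ (h.sl_ne ξ)
    have h5 : (jb (-1) ξ : ℂ) * (jb 1 ξ : ℂ) = 1 := by exact_mod_cast jb_neg_mul 1 ξ
    have h6 : ((|2 * Real.pi * ξ| : ℝ) : ℂ) ^ 2 = (2 * Real.pi * ξ : ℂ) ^ 2 := by
      exact_mod_cast habs ξ
    have h7 : (jb 2 ξ : ℂ) * (ab ξ : ℂ) * (om l ξ : ℂ)
        = (2 * Real.pi * ξ : ℂ) ^ 2 * (jb 1 ξ : ℂ) * (sl l ξ : ℂ) := by
      rw [hj, ab, om, ← h6]; push_cast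
      linear_combination ((|2 * Real.pi * ξ| : ℝ) : ℂ) ^ 2 * (jb 1 ξ : ℂ) * (sl l ξ : ℂ) * h5
    push_cast
    linear_combination -((jb 2 ξ : ℂ) * (ab ξ : ℂ) * (om l ξ : ℂ)) * (jb (-r) ξ : ℂ)
        * frRe (YOf r l W t) ξ * (𝓕⁻ θ) ξ * key ξ
      - (jb (-r) ξ : ℂ) * frRe (YOf r l W t) ξ * (𝓕⁻ θ) ξ * h7
      + (jb (-r) ξ : ℂ) * frRe (YOf r l W t) ξ * (𝓕⁻ θ) ξ * (2 * Real.pi * ξ : ℂ) ^ 2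
        * (sl l ξ : ℂ) * h4
  · rw [pairL2_apply, pairGxx_eq h.g_one.continuous h.zero hL (hbd t ht).1]
    apply integral_congr_ae
    have hn := h.mulR_frIm_NOf hW ht
    have hn' := mulR_coe (bddR_order ρ s) (frIm (NOf r l g W t))
    rw [hn] at hn'
    filter_upwards [hΨe, mulR_coe hb (frIm (NOf r l g W t)), hn',
      Lp.coeFn_neg (mulR ab (fr (compR g (uAt l W t)))),
        mulR_coe bddR_ab (fr (compR g (uAt l W t)))]
      with ξ h1 h2 h3 h4 h5
    rw [h4, Pi.neg_apply, h5] at h3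
    rw [h1, h2]
    have h5 : (jb (-1) ξ : ℂ) * (jb 1 ξ : ℂ) = 1 := by exact_mod_cast jb_neg_mul 1 ξ
    have h6 : ((|2 * Real.pi * ξ| : ℝ) : ℂ) ^ 2 = (2 * Real.pi * ξ : ℂ) ^ 2 := by
      exact_mod_cast habs ξ
    have h7 : (jb 2 ξ : ℂ) * (ab ξ : ℂ) * (ab ξ : ℂ) = (2 * Real.pi * ξ : ℂ) ^ 2 := by
      rw [hj, ab, ← h6]; push_cast
      linear_combination ((|2 * Real.pi * ξ| : ℝ) : ℂ) ^ 2
        * ((jb (-1) ξ : ℂ) * (jb 1 ξ : ℂ) + 1) * h5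
    push_cast
    linear_combination (jb (-r) ξ : ℂ) * frIm (NOf r l g W t) ξ * (jb 2 ξ : ℂ) * (ab ξ : ℂ)
        * (𝓕⁻ θ) ξ * key ξ - (jb 2 ξ : ℂ) * (ab ξ : ℂ) * (𝓕⁻ θ) ξ * h3
      - fr (compR g (uAt l W t)) ξ * (𝓕⁻ θ) ξ * h7

omit hW in
/-- A trajectory on a half open interval solves the Cauchy problem. -/
theorem isSolution {φ : RealL2} {ψ : 𝓢'(ℝ, ℂ)} (hT : 0 < T)
    (hW : ∀ T' < T, IsSol (kap ρ s + 1) (field l g) W₀ T' W)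
    (hφ : uOf l W₀ = φ) (hψ : distOf (mulR ab (frIm W₀)) = ψ) :
    IsSolution ρ s l g φ ψ T (uAt l W) (vAt l W) := by
  have hy : yOf l W 0 = W₀ := by rw [yOf, neg_zero, rot_zero, (hW 0 hT).initial]
  have hmid : ∀ t ∈ Ico 0 T, IsSol (kap ρ s + 1) (field l g) W₀ ((t + T) / 2) W ∧
      t ∈ Icc 0 ((t + T) / 2) ∧ Icc 0 ((t + T) / 2) ∈ 𝓝[Ico 0 T] t := by
    intro t ht
    have h1 : t < (t + T) / 2 := by linarith [ht.2]
    refine ⟨hW _ (by linarith [ht.2]), ⟨ht.1, h1.le⟩, ?_⟩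
    filter_upwards [self_mem_nhdsWithin, mem_nhdsWithin_of_mem_nhds (Iio_mem_nhds h1)] with z hz hz'
    exact ⟨hz.1, (mem_Iio.1 hz').le⟩
  refine ⟨fun t ht => ?_, fun t ht => ?_, fun t ht => ?_, fun t ht => ?_, fun t ht => ?_,
    fun θ t ht => ?_, ?_, ?_⟩
  · exact h.memH_uAt (hmid t ht).1 (hmid t ht).2.1
  · exact h.memH_vAt (hmid t ht).1 (hmid t ht).2.1
  · exact (h.tendsto_normH_uAt (hmid t ht).1 (hmid t ht).2.1).mono_left
      (nhdsWithin_le_of_mem (hmid t ht).2.2)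
  · exact (h.tendsto_normH_vAt (hmid t ht).1 (hmid t ht).2.1).mono_left
      (nhdsWithin_le_of_mem (hmid t ht).2.2)
  · refine (h.tendsto_normH_slope (hmid t ht).1 (hmid t ht).2.1).mono_left ?_
    rw [sdiff_eq, sdiff_eq, nhdsWithin_inter', nhdsWithin_inter']
    exact inf_le_inf_right _ (nhdsWithin_le_of_mem (hmid t ht).2.2)
  · exact (h.hasDerivWithinAt_vAt (hmid t ht).1 θ (hmid t ht).2.1).mono_of_mem_nhdsWithin
      (hmid t ht).2.2
  · rw [uAt, hy, hφ]
  · rw [vAt, hy, hψ]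

end WaveData

/-! ### Unboundedness of the norm -/

lemma mem_sobBall_of_normH_le {s M : ℝ} (hs : 0 ≤ s) (hM : 0 ≤ M) {u : RealL2}
    (hu : normH s u.toDist ≤ ENNReal.ofReal M) : fr u ∈ SobBall s M := by
  rw [mem_sobBall_iff hs hM]
  rwa [normH_eq (hasFourier_toDist u)] at hu

namespace WaveData

variable {ρ s c₁ c₂ : ℝ} {l g : ℝ → ℝ} (h : WaveData ρ s c₁ c₂ l g)
include h

/-- The nonlinear term grows at most linearly in the strong norm, as long as `u` is bounded in
`H^s`. If `κ = 0` this is the `H^1` bound for compositions; otherwise `κ + 1 ≤ s`. -/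
lemma exists_nonlin_linear (M : ℝ) : ∃ L C, 0 < L ∧ 0 ≤ C ∧ ∀ y m, y ∈ SobBall (kap ρ s + 1) m →
    fr (uOf l y) ∈ SobBall s M → nonlin l g y ∈ SobBall (kap ρ s + 1) (L * m + C) := by
  have hc := inv_nonneg.2 h.c₁_pos.le
  rcases le_total (s - ρ / 2) 0 with hk | hk
  · obtain ⟨K, _, hK⟩ := exists_ae_abs_le h.half_lt
    obtain ⟨L, hL0, hL⟩ := exists_lipOn h.g_one (K * M)
    have e : kap ρ s + 1 = 1 := by rw [kap, max_eq_right hk, zero_add]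
    refine ⟨L * c₁⁻¹ + 1, 0, by positivity, le_rfl, fun y m hy hu => ?_⟩
    have hm := sobBall_nonneg hy
    rw [e] at hy ⊢
    have h1 := nonlin_mem zero_le_one (compR_mem_sobBall_one h.g_one.continuous h.zero hL0 hL
      (hK M _ hu) (h.fr_uOf_mem zero_le_one hy))
    exact sobBall_mono zero_le_one le_rfl (by nlinarith) h1
  · have e : kap ρ s + 1 ≤ s := by rw [kap, max_eq_left hk]; linarith [h.two_le]
    obtain ⟨C, hC⟩ := exists_compR_mem_sobBall _ g h.contDiff h.zero (kap ρ s + 1)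
      (by linarith [kap_nonneg ρ s]) h.kap_add_one_le M
    refine ⟨1, max C 0, one_pos, le_max_right _ _, fun y m hy hu => ?_⟩
    have hm := sobBall_nonneg hy
    have h1 := nonlin_mem (kap_add_one_nonneg ρ s)
      (hC _ (sobBall_mono (kap_add_one_nonneg ρ s) e le_rfl hu))
    exact sobBall_mono (kap_add_one_nonneg ρ s) le_rfl (by linarith [le_max_left C 0]) h1

variable {W₀ : ComplexL2} {T : ℝ} {W : ℝ → ComplexL2}

/-- If `u` is bounded in `H^s`, then the trajectory is bounded in the strong norm, by Grönwall's
inequality. -/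
lemma exists_traj_bounded {M₀ M : ℝ} (hW₀ : W₀ ∈ SobBall (kap ρ s + 1) M₀) (hT : 0 < T)
    (hW : ∀ T' < T, IsSol (kap ρ s + 1) (field l g) W₀ T' W)
    (hM : ∀ t ∈ Ico 0 T, fr (uAt l W t) ∈ SobBall s M) :
    ∃ M', ∀ t ∈ Ico 0 T, W t ∈ SobBall (kap ρ s + 1) M' := by
  obtain ⟨L, C, hL, hC, hN⟩ := h.exists_nonlin_linear M
  have hM₀ := sobBall_nonneg hW₀
  refine ⟨2 * (M₀ + C * T) * Real.exp (2 * L * T), fun t ht => ?_⟩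
  have h1 := (hW t ht.2).growth (kap_add_one_nonneg ρ s) hL hC hW₀ (fun τ hτ m hm =>
    h.rot_mem (kap_add_one_nonneg ρ s) (hN _ m (h.rot_mem (kap_add_one_nonneg ρ s) hm)
      (hM τ ⟨hτ.1, hτ.2.trans_lt ht.2⟩))) t ⟨ht.1, le_rfl⟩
  have h0 := ht.1
  have h2 := ht.2.le
  exact sobBall_mono (kap_add_one_nonneg ρ s) le_rfl (by gcongr) h1

/-- A trajectory of order `κ + 1` has `u` in `H^s`, since `s ≤ κ + ρ/2`. -/
lemma exists_fr_uAt_mem (hW : IsSol (kap ρ s + 1) (field l g) W₀ T W) :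
    ∃ M, ∀ t ∈ Icc 0 T, fr (uAt l W t) ∈ SobBall s M := by
  obtain ⟨M, C, hM⟩ := h.exists_traj_bound hW
  obtain ⟨_, D, hD⟩ := h.bddR_uSym (σ := s) le_rfl
  have hD0 : 0 ≤ D := (abs_nonneg _).trans (hD 0)
  refine ⟨D * M, fun t ht => ⟨mulR (uSym ρ s s l) (frRe (YOf (kap ρ s + 1) l W t)), ?_,
    eq_mulR_of_ae (by linarith [h.half_lt]) (h.uSym_ae hW le_rfl ht)⟩⟩
  refine (mulR_norm_le (h.bddR_uSym le_rfl).1 hD _).trans (mul_le_mul_of_nonneg_left ?_ hD0)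
  rw [frRe, fr.norm_map]
  refine (norm_reInv_le _).trans ?_
  rw [YOf, h.norm_rot]
  exact norm_sobTop_le (kap_add_one_nonneg ρ s) (hM t ht).1

/-- The norm of the solution is unbounded near the end of the maximal interval. -/
theorem limsup_eq_top {M₀ : ℝ} (hW₀ : W₀ ∈ SobBall (kap ρ s + 1) M₀) (hT : 0 < T)
    (hW : ∀ T' < T, IsSol (kap ρ s + 1) (field l g) W₀ T' W)
    (hM : ∀ M, ¬ ∀ t ∈ Ico 0 T, W t ∈ SobBall (kap ρ s + 1) M) :
    limsup (fun t => normH s (uAt l W t).toDist + normH (s - 1 - ρ / 2) (vAt l W t)) (𝓝[<] T)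
      = ⊤ := by
  by_contra hne
  obtain ⟨c, hc, _⟩ := ENNReal.lt_iff_exists_nnreal_btwn.1 (lt_top_iff_ne_top.2 hne)
  have hev := eventually_lt_of_limsup_lt hc
  obtain ⟨T₁, hT₁, hsub⟩ := (mem_nhdsLT_iff_exists_Ioo_subset' (show T - 1 < T by linarith)).1 hev
  set T₂ := (max T₁ 0 + T) / 2 with hT₂
  have h1 : max T₁ 0 < T := max_lt hT₁ hT
  obtain ⟨M₁, hM₁⟩ := h.exists_fr_uAt_mem (hW T₂ (by linarith))
  have hs : 0 ≤ s := by linarith [h.half_lt]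
  obtain ⟨M', hM'⟩ := h.exists_traj_bounded (M := max M₁ (c : ℝ)) hW₀ hT hW fun t ht => by
    rcases le_total t T₂ with h2 | h2
    · exact sobBall_mono hs le_rfl (le_max_left _ _) (hM₁ t ⟨ht.1, h2⟩)
    -- Near `T` the norm is bounded by `c`; before that, by continuity of the trajectory.
    · have h3 : t ∈ Ioo T₁ T := ⟨by linarith [le_max_left T₁ 0], ht.2⟩
      have h4 : normH s (uAt l W t).toDist + normH (s - 1 - ρ / 2) (vAt l W t) < c := hsub h3
      refine sobBall_mono hs le_rfl (le_max_right _ _)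
        (mem_sobBall_of_normH_le hs (NNReal.coe_nonneg c) ?_)
      rw [ENNReal.ofReal_coe_nnreal]
      exact (le_self_add.trans h4.le)
  exact hM M' hM'

end WaveData

/-! ### The initial data -/

lemma fr_reInv_of_ae {m : ℝ → ℝ} (hm : ∀ ξ, m (-ξ) = m ξ) {F : ComplexL2} {G : ℝ → ℂ}
    (hF : F =ᵐ[volume] fun ξ => (m ξ : ℂ) * G ξ)
    (hG : ∀ᵐ ξ, (starRingEnd ℂ) (G (-ξ)) = G ξ) : fr (reInv F) = F := by
  apply fr_reInv_of_conj_symm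
  have h' := (Measure.measurePreserving_neg (volume : Measure ℝ)).quasiMeasurePreserving.ae hF
  filter_upwards [hF, h', hG] with ξ h1 h2 h3
  rw [h1, h2, map_mul, Complex.conj_ofReal, hm, h3]

lemma frRe_fr_add_I (f f' : RealL2) : frRe (fr f + Complex.I • fr f') = fr f := by
  rw [frRe, map_add, reInv_fr, reInv_I_fr, add_zero]

lemma frIm_fr_add_I (f f' : RealL2) : frIm (fr f + Complex.I • fr f') = fr f' := by
  rw [frIm, smul_add, smul_smul, Complex.I_mul_I, neg_one_smul, neg_add, neg_neg, map_add, map_neg,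
    reInv_I_fr, neg_zero, zero_add, reInv_fr]

lemma ae_ne_zero : ∀ᵐ ξ : ℝ, ξ ≠ 0 := by simp [ae_iff]

/-- `|η|⁻¹ (1 + η²)^{κ/2}` is controlled by `|η|⁻¹` at low and by `(1 + η²)^{(κ-1)/2}` at high
frequencies. -/
lemma jb_mul_inv_le {k : ℝ} (hk : 0 ≤ k) (ξ : ℝ) :
    jb k ξ * |2 * Real.pi * ξ|⁻¹ ≤ 2 ^ (k / 2) * |2 * Real.pi * ξ|⁻¹ + 2 * jb (k - 1) ξ := by
  have p1 := jb_pos k ξ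
  have p2 := jb_pos (k - 1) ξ
  have p3 : 0 ≤ |2 * Real.pi * ξ|⁻¹ := by positivity
  rcases le_total |2 * Real.pi * ξ| 1 with h5 | h5
  · have h6 : jb k ξ ≤ 2 ^ (k / 2) := by
      rw [jb_rpow]
      apply Real.rpow_le_rpow (by positivity) _ (by linarith)
      have : (2 * Real.pi * ξ) ^ 2 ≤ 1 := by rwa [sq_le_one_iff_abs_le_one]
      linarith
    have := mul_le_mul_of_nonneg_right h6 p3
    linarith
  · have e : jb k ξ = jb (k - 1) ξ * jb 1 ξ := by rw [← jb_add]; congr 1; ring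
    have h7 : 0 < |2 * Real.pi * ξ| := by linarith
    have h6 : jb 1 ξ * |2 * Real.pi * ξ|⁻¹ ≤ 2 := by
      rw [← div_eq_mul_inv, div_le_iff₀ h7]
      linarith [jb_one_le ξ]
    have h8 : 0 ≤ (2 : ℝ) ^ (k / 2) * |2 * Real.pi * ξ|⁻¹ := by positivity
    rw [e, mul_assoc]
    nlinarith

namespace WaveData

variable {ρ s c₁ c₂ : ℝ} {l g : ℝ → ℝ} (h : WaveData ρ s c₁ c₂ l g)
include h

/-- The initial data of the first order equation. -/
theorem exists_initial {φ : RealL2} {ψ : 𝓢'(ℝ, ℂ)} (hφ : MemH s φ.toDist)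
    (hψ : MemH (s - 1 - ρ / 2) ψ) (hψ_real : IsRealDist ψ) {Kφ Λφ Λψ : ComplexL2}
    (hKφ : IsMultiplierL2 (sqrtSymbol l) φ.toDist Kφ)
    (hΛφ : IsMultiplierL2 lambdaInvSymbol φ.toDist Λφ)
    (hΛψ : IsMultiplierL2 lambdaInvSymbol ψ Λψ) :
    ∃ (W₀ : ComplexL2) (M₀ : ℝ) (P₀ : RealL2), W₀ ∈ SobBall (kap ρ s + 1) M₀ ∧ uOf l W₀ = φ ∧
      distOf (mulR ab (frIm W₀)) = ψ ∧ mulR ab (fr P₀) = mulR (jb (-1)) (fr (uOf l W₀)) ∧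
      ‖mulR (jb (-(kap ρ s))) (sobTop (kap ρ s + 1) W₀)‖ ^ 2 = ‖Λψ‖ ^ 2 + ‖Kφ‖ ^ 2 := by
  have hk := kap_nonneg ρ s
  have b1 : BddR (jb (-1)) := bddR_jb (by norm_num)
  obtain ⟨Ψ, hΨ, hN⟩ := hΛψ
  rw [isMultiplierL2_iff (hasFourier_toDist φ)] at hKφ hΛφ
  rw [memH_iff (hasFourier_toDist φ)] at hφ
  rw [memH_iff hΨ] at hψ
  rw [← fr_apply] at hKφ hΛφ hφ
  set K : ComplexL2 := 𝓕 Kφ with hKdef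
  set N : ComplexL2 := 𝓕 Λψ with hNdef
  set Q : ComplexL2 := 𝓕 Λφ with hQdef
  have hK' : K =ᵐ[volume] fun ξ => (sl l ξ : ℂ) * fr φ ξ := hKφ
  have hN' : N =ᵐ[volume] fun ξ => ((|2 * Real.pi * ξ|⁻¹ : ℝ) : ℂ) * Ψ ξ := hN
  have hQ' : Q =ᵐ[volume] fun ξ => ((|2 * Real.pi * ξ|⁻¹ : ℝ) : ℂ) * fr φ ξ := hΛφ
  have hKr : fr (reInv K) = K := fr_reInv_of_ae h.sl_even hK' (fr_conj_symm φ)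
  have hNr : fr (reInv N) = N := fr_reInv_of_ae (by simp) hN' (hψ_real.conj_symm hΨ)
  have hQr : fr (reInv Q) = Q := fr_reInv_of_ae (by simp) hQ' (fr_conj_symm φ)
  have mK : MemLp (fun ξ => (jb (kap ρ s) ξ : ℂ) * K ξ) 2 volume := by
    -- For `s ≤ ρ/2`, `κ = 0` and the claim is the hypothesis on `K φ`; otherwise `κ + ρ/2 = s`.
    rcases le_total (s - ρ / 2) 0 with hk0 | hk0
    · rw [kap, max_eq_right hk0]; simpa using Lp.memLp K
    -- Here `(1 + η²)^{κ/2} √l ≤ c₂ (1 + η²)^{s/2}`.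
    · refine hφ.of_le_mul (c := c₂) ((Complex.continuous_ofReal.comp
        (continuous_jb _)).aestronglyMeasurable.mul (Lp.memLp K).1) ?_
      filter_upwards [hK'] with ξ h1
      have e : jb s ξ = jb (s - ρ / 2) ξ * jb (ρ / 2) ξ := by rw [← jb_add]; congr 1; ring
      rw [kap, max_eq_left hk0, h1]
      simp only [norm_mul, Complex.norm_real, Real.norm_of_nonneg (jb_pos _ _).le,
        Real.norm_of_nonneg (h.sl_pos ξ).le]
      rw [e]
      have h2 := mul_le_mul_of_nonneg_left (h.sl_le ξ) (jb_pos (s - ρ / 2) ξ).le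
      have h3 := mul_le_mul_of_nonneg_right h2 (norm_nonneg (fr φ ξ))
      linarith
  have mN : MemLp (fun ξ => (jb (kap ρ s) ξ : ℂ) * N ξ) 2 volume := by
    rcases le_total (s - ρ / 2) 0 with hk0 | hk0
    · rw [kap, max_eq_right hk0]; simpa using Lp.memLp N
    -- Low frequencies are controlled by `Λ⁻¹ ψ ∈ L²` and high ones by `ψ ∈ H^{κ-1}`.
    · have hb := ((Lp.memLp N).norm.const_mul (2 ^ (kap ρ s / 2))).add (hψ.norm.const_mul 2)
      refine hb.of_le ((Complex.continuous_ofReal.comp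
        (continuous_jb _)).aestronglyMeasurable.mul (Lp.memLp N).1) ?_
      filter_upwards [hN'] with ξ h1
      have e : s - 1 - ρ / 2 = kap ρ s - 1 := by rw [kap, max_eq_left hk0]; ring
      have h2 := mul_le_mul_of_nonneg_right (jb_mul_inv_le hk ξ) (norm_nonneg (Ψ ξ))
      refine le_trans ?_ (le_abs_self _)
      simp only [Pi.add_apply]
      rw [h1, e]
      simp only [norm_mul, Complex.norm_real, Real.norm_of_nonneg (jb_pos _ _).le, norm_inv,
        Real.norm_eq_abs, abs_abs]
      simp only [abs_mul] at h2 ⊢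
      linarith
  have mKN : MemLp (fun ξ => (jb (kap ρ s) ξ : ℂ) * (K + Complex.I • N) ξ) 2 volume := by
    refine (mK.add (mN.const_mul Complex.I)).ae_eq ?_
    filter_upwards [Lp.coeFn_add K (Complex.I • N), Lp.coeFn_smul Complex.I N] with ξ h1 h2
    rw [h1, Pi.add_apply, Pi.add_apply, h2, Pi.smul_apply, smul_eq_mul]; ring
  -- `X` is `(1 + η²)^{κ/2}` times the Fourier transform of `K φ + i Λ⁻¹ ψ`.
  set X : ComplexL2 := mKN.toLp with hX
  have hXe : mulR (jb (-(kap ρ s))) X = K + Complex.I • N := eq_mulR_of_ae hk mKN.coeFn_toLp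
  set W₀ := mulR (jb (-(kap ρ s + 1))) X with hW₀
  have hW₀' : W₀ = mulR (jb (-1)) (K + Complex.I • N) := by
    rw [← hXe, mulR_mulR b1 (bddR_kap ρ s), hW₀]
    refine congrFun (congrArg _ (mulR_congr fun ξ => ?_)) _
    rw [← jb_add]; congr 1; ring
  have hre : frRe W₀ = mulR (jb (-1)) K := by
    rw [hW₀', frRe_mulR b1 (jb_even _), ← hKr, ← hNr, frRe_fr_add_I]
  have him : frIm W₀ = mulR (jb (-1)) N := by
    rw [hW₀', frIm_mulR b1 (jb_even _), ← hKr, ← hNr, frIm_fr_add_I]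
  have hu : uOf l W₀ = φ := by
    apply fr.injective
    have e : fr (uOf l W₀) = mulR (su l) (frRe W₀) := frRe_mulR h.bddR_su h.su_even _
    rw [e, hre]
    apply Lp.ext
    filter_upwards [mulR_coe h.bddR_su (mulR (jb (-1)) K), mulR_coe b1 K, hK'] with ξ h1 h2 h3
    rw [h1, h2, h3]
    have h4 : (su l ξ : ℂ) * (sl l ξ : ℂ) = (jb 1 ξ : ℂ) := by
      exact_mod_cast div_mul_cancel₀ _ (h.sl_ne ξ)
    have h5 : (jb (-1) ξ : ℂ) * (jb 1 ξ : ℂ) = 1 := by exact_mod_cast jb_neg_mul 1 ξ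
    linear_combination (jb (-1) ξ : ℂ) * fr φ ξ * h4 + fr φ ξ * h5
  refine ⟨W₀, ‖X‖, reInv Q, ⟨X, le_rfl, rfl⟩, hu, ?_, ?_, ?_⟩
  · refine (hasFourier_distOf _).eq_of_ae hΨ ?_
    rw [him]
    filter_upwards [mulR_coe bddR_ab (mulR (jb (-1)) N), mulR_coe b1 N, hN', ae_ne_zero]
      with ξ h1 h2 h3 h4
    rw [h1, h2, h3]
    have h5 : (jb (-1) ξ : ℂ) * (jb 1 ξ : ℂ) = 1 := by exact_mod_cast jb_neg_mul 1 ξ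
    have h6 : (jb 2 ξ : ℂ) = (jb 1 ξ : ℂ) * (jb 1 ξ : ℂ) := by
      rw [← Complex.ofReal_mul, ← jb_add]; norm_num
    have h7 : ((|2 * Real.pi * ξ| : ℝ) : ℂ) * ((|2 * Real.pi * ξ|⁻¹ : ℝ) : ℂ) = 1 := by
      have : |2 * Real.pi * ξ| ≠ 0 := abs_ne_zero.2 (mul_ne_zero Real.two_pi_pos.ne' h4)
      exact_mod_cast mul_inv_cancel₀ this
    rw [h6, ab, Complex.ofReal_mul]
    linear_combination ((jb (-1) ξ : ℂ) * (jb 1 ξ : ℂ)) ^ 2 * Ψ ξ * h7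
      + Ψ ξ * ((jb (-1) ξ : ℂ) * (jb 1 ξ : ℂ) + 1) * h5
  · rw [hQr, hu]
    apply Lp.ext
    filter_upwards [mulR_coe bddR_ab Q, mulR_coe b1 (fr φ), hQ', ae_ne_zero] with ξ h1 h2 h3 h4
    rw [h1, h2, h3]
    have h7 : ((|2 * Real.pi * ξ| : ℝ) : ℂ) * ((|2 * Real.pi * ξ|⁻¹ : ℝ) : ℂ) = 1 := by
      have : |2 * Real.pi * ξ| ≠ 0 := abs_ne_zero.2 (mul_ne_zero Real.two_pi_pos.ne' h4)
      exact_mod_cast mul_inv_cancel₀ this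
    rw [ab, Complex.ofReal_mul]
    linear_combination (jb (-1) ξ : ℂ) * fr φ ξ * h7
  · rw [sobTop_eq (kap_add_one_nonneg ρ s) (rfl : mulR (jb (-(kap ρ s + 1))) X = W₀), hXe]
    have e1 : ‖K‖ = ‖Kφ‖ := Lp.norm_fourier_eq Kφ
    have e2 : ‖N‖ = ‖Λψ‖ := Lp.norm_fourier_eq Λψ
    rw [norm_add_sq_real, ← hKr, ← hNr, inner_fr_I_fr, hKr, hNr, norm_smul, Complex.norm_I, one_mul,
      e1, e2]
    ring

end WaveData

/-! ### Uniqueness -/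

/-- A Grönwall argument which needs no bound of the derivative of `X` by `X` alone. -/
lemma le_half_mul_exp {c m T : ℝ} (hm : 0 ≤ m) {X X' D : ℝ → ℝ}
    (hX : ∀ t ∈ Icc 0 T, HasDerivWithinAt X (X' t) (Icc 0 T) t) (h0 : X 0 = 0) (hc : 0 < c)
    (hX' : ∀ t ∈ Icc 0 T, X' t ≤ c * (X t + D t))
    (hD : ∀ t ∈ Icc 0 T, D t ≤ m * Real.exp (3 * c * t)) :
    ∀ t ∈ Icc 0 T, X t ≤ m / 2 * Real.exp (3 * c * t) := by
  intro t ht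
  have he : ∀ a x : ℝ, HasDerivAt (fun x : ℝ => Real.exp (a * x)) (Real.exp (a * x) * a) x :=
    fun a x => by simpa using ((hasDerivAt_id x).const_mul a).exp
  have hf : ∀ x ∈ Icc 0 T, HasDerivWithinAt (fun x => Real.exp (-c * x) * X x)
      (Real.exp (-c * x) * -c * X x + Real.exp (-c * x) * X' x) (Icc 0 T) x := fun x hx =>
    (he (-c) x).hasDerivWithinAt.mul (hX x hx)
  have key := image_le_of_deriv_right_le_deriv_boundary
    (fun x hx => (hf x hx).continuousWithinAt)
    (fun x hx => hasDerivWithinAt_Ici (hf x (Ico_subset_Icc_self hx)) hx)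
    (B := fun x => m / 2 * Real.exp (2 * c * x))
    (B' := fun x => m / 2 * (Real.exp (2 * c * x) * (2 * c)))
    (by simp [h0]; linarith) (by fun_prop)
    (fun x _ => ((he (2 * c) x).const_mul (m / 2)).hasDerivWithinAt) (fun x hx => by
      have hx' := Ico_subset_Icc_self hx
      have e : Real.exp (2 * c * x) = Real.exp (-c * x) * Real.exp (3 * c * x) := by
        rw [← Real.exp_add]; congr 1; ring
      rw [e]
      have h1 := hX' x hx'
      have h2 := hD x hx'
      have h3 : X' x - c * X x ≤ c * (m * Real.exp (3 * c * x)) := by nlinarith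
      nlinarith [mul_le_mul_of_nonneg_left h3 (Real.exp_pos (-c * x)).le]) ht
  have e1 : Real.exp (3 * c * t) = Real.exp (c * t) * Real.exp (2 * c * t) := by
    rw [← Real.exp_add]; congr 1; ring
  have e2 : Real.exp (c * t) * Real.exp (-c * t) = 1 := by rw [← Real.exp_add]; simp
  have h4 := mul_le_mul_of_nonneg_left key (Real.exp_pos (c * t)).le
  rw [e1]
  calc X t = Real.exp (c * t) * (Real.exp (-c * t) * X t) := by rw [← mul_assoc, e2, one_mul]
    _ ≤ _ := h4
    _ = _ := by ring

namespace WaveData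

variable {ρ s c₁ c₂ : ℝ} {l g : ℝ → ℝ} (h : WaveData ρ s c₁ c₂ l g)
include h

lemma bddR_om_sq : BddR fun ξ => jb (-(2 + ρ)) ξ * om l ξ ^ 2 := by
  refine ⟨(measurable_jb _).mul (h.meas_om.pow_const 2), c₂ ^ 2, fun ξ => ?_⟩
  have p := jb_pos (-(2 + ρ)) ξ
  have h1 := pow_le_pow_left₀ (h.om_nonneg ξ) (h.om_le ξ) 2
  rw [abs_of_nonneg (by positivity)]
  have e : jb (-(2 + ρ)) ξ * (c₂ * jb (1 + ρ / 2) ξ) ^ 2 = c₂ ^ 2 := by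
    rw [mul_pow, sq (jb _ _), ← jb_add, show 1 + ρ / 2 + (1 + ρ / 2) = 2 + ρ by ring]
    linear_combination c₂ ^ 2 * jb_neg_mul (2 + ρ) ξ
  exact (mul_le_mul_of_nonneg_left h1 p.le).trans e.le

lemma bddR_freq_sq : BddR fun ξ => jb (-(2 + ρ)) ξ * (2 * Real.pi * ξ) ^ 2 := by
  refine ⟨(measurable_jb _).mul (by fun_prop), 1, fun ξ => ?_⟩
  have p := jb_pos (-(2 + ρ)) ξ
  rw [abs_of_nonneg (by positivity), ← jb_neg_mul (2 + ρ) ξ]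
  refine mul_le_mul_of_nonneg_left ?_ p.le
  refine le_trans ?_ (jb_mono (σ := 2) (by linarith [h.two_le]) ξ)
  rw [jb_two]; linarith

lemma omInv_mul_le (ξ : ℝ) : omInv l ξ * (2 * Real.pi * ξ) ^ 2 ≤ c₁⁻¹ := by
  have hc := h.c₁_pos
  have h0 := h.om_nonneg ξ
  rw [omInv, inv_mul_le_iff₀ (by linarith), ← div_eq_mul_inv, le_div_iff₀ hc, ← sq_abs]
  have h1 : c₁ * |2 * Real.pi * ξ| ≤ sl l ξ :=
    (mul_le_mul_of_nonneg_left (abs_le_jb_one ξ) hc.le).trans (h.jb_one_le_sl ξ)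
  have h2 := mul_le_mul_of_nonneg_left h1 (abs_nonneg (2 * Real.pi * ξ))
  rw [om]
  nlinarith

lemma bddR_cut_om (n : ℕ) : BddR fun ξ => (1 + om l ξ) * cutJb (2 + ρ) n ξ := by
  have hc := h.c₂_pos
  obtain ⟨_, C, hC⟩ := bddR_cutJb (3 + 2 * ρ) n
  refine ⟨(h.meas_om.const_add 1).mul (measurable_cutJb _ n), (1 + c₂) * C, fun ξ => ?_⟩
  have h0 := h.om_nonneg ξ
  have h1 := h.om_le ξ
  rw [abs_of_nonneg (mul_nonneg (by linarith) (cutJb_nonneg _ _ _))]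
  have h2 : 1 + om l ξ ≤ (1 + c₂) * jb (1 + ρ) ξ := by
    have h3 := one_le_jb (σ := 1 + ρ) (by linarith [h.two_le]) ξ
    have h4 := jb_mono (σ := 1 + ρ / 2) (τ := 1 + ρ) (by linarith [h.two_le]) ξ
    nlinarith
  have h5 : jb (1 + ρ) ξ * cutJb (2 + ρ) n ξ = cutJb (3 + 2 * ρ) n ξ := by
    rw [cutJb, cutJb]
    by_cases hξ : ξ ∈ Icc (-(n : ℝ)) n
    · rw [indicator_of_mem hξ, indicator_of_mem hξ, ← jb_add]; congr 1; ring
    · rw [indicator_of_notMem hξ, indicator_of_notMem hξ, mul_zero]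
  calc (1 + om l ξ) * cutJb (2 + ρ) n ξ ≤ (1 + c₂) * jb (1 + ρ) ξ * cutJb (2 + ρ) n ξ :=
        mul_le_mul_of_nonneg_right h2 (cutJb_nonneg _ _ _)
    _ = (1 + c₂) * cutJb (3 + 2 * ρ) n ξ := by rw [mul_assoc, h5]
    _ ≤ (1 + c₂) * C := mul_le_mul_of_nonneg_left ((le_abs_self _).trans (hC ξ)) (by linarith)

/-- The terms of order `ω` cancel in the derivative of the energy. -/
lemma norm_energy_deriv_le (n : ℕ) (d N : ComplexL2) :
    ‖mulR (fun ξ => (1 + om l ξ) * cutJb (2 + ρ) n ξ) (mulR (jb (-(2 + ρ))) d)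
      - mulR (fun ξ => omInv l ξ * cutJb (2 + ρ) n ξ)
        (mulR (fun ξ => jb (-(2 + ρ)) ξ * om l ξ ^ 2) d
          + mulR (fun ξ => jb (-(2 + ρ)) ξ * (2 * Real.pi * ξ) ^ 2) N)‖ ≤ 2 * ‖d‖ + c₁⁻¹ * ‖N‖ := by
  have hρ := h.two_le
  have hc := h.c₁_pos
  have bk : BddR (jb (-(2 + ρ))) := bddR_jb (by linarith)
  have bI := h.bddR_omInv.mul (bddR_cutJb (2 + ρ) n)
  have b1 := h.bddR_cut_om n
  have hcut : ∀ ξ, 0 ≤ cutJb (2 + ρ) n ξ * jb (-(2 + ρ)) ξ ∧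
      cutJb (2 + ρ) n ξ * jb (-(2 + ρ)) ξ ≤ 1 := fun ξ => by
    have p := jb_pos (-(2 + ρ)) ξ
    refine ⟨mul_nonneg (cutJb_nonneg _ _ _) p.le, ?_⟩
    rw [← jb_neg_mul (2 + ρ) ξ, mul_comm]
    exact mul_le_mul_of_nonneg_left (cutJb_le _ _ _) p.le
  set m₁ : ℝ → ℝ := fun ξ => cutJb (2 + ρ) n ξ * jb (-(2 + ρ)) ξ * (omInv l ξ * (1 + 2 * om l ξ))
    with hm₁
  set m₂ : ℝ → ℝ := fun ξ => cutJb (2 + ρ) n ξ * jb (-(2 + ρ)) ξ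
    * (omInv l ξ * (2 * Real.pi * ξ) ^ 2) with hm₂
  have hI : ∀ ξ, omInv l ξ * (1 + om l ξ) = 1 := fun ξ =>
    inv_mul_cancel₀ (by linarith [h.om_nonneg ξ])
  have h1 : ∀ ξ, |m₁ ξ| ≤ 2 := fun ξ => by
    have p := h.omInv_pos ξ
    have h0 := h.om_nonneg ξ
    have h2 : 0 ≤ omInv l ξ * (1 + 2 * om l ξ) := by positivity
    rw [hm₁, abs_of_nonneg (mul_nonneg (hcut ξ).1 h2)]
    have h3 : omInv l ξ * (1 + 2 * om l ξ) ≤ 2 := by nlinarith [hI ξ]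
    exact (mul_le_of_le_one_left h2 (hcut ξ).2).trans h3
  have h2 : ∀ ξ, |m₂ ξ| ≤ c₁⁻¹ := fun ξ => by
    have h2 : 0 ≤ omInv l ξ * (2 * Real.pi * ξ) ^ 2 := mul_nonneg (h.omInv_pos ξ).le (sq_nonneg _)
    rw [hm₂, abs_of_nonneg (mul_nonneg (hcut ξ).1 h2)]
    exact (mul_le_of_le_one_left h2 (hcut ξ).2).trans (h.omInv_mul_le ξ)
  have mm₁ : Measurable m₁ := ((measurable_cutJb _ n).mul (measurable_jb _)).mul
    (h.bddR_omInv.1.mul ((h.meas_om.const_mul 2).const_add 1))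
  have mm₂ : Measurable m₂ := ((measurable_cutJb _ n).mul (measurable_jb _)).mul
    (h.bddR_omInv.1.mul (by fun_prop))
  have e1 : mulR (fun ξ => (1 + om l ξ) * cutJb (2 + ρ) n ξ) (mulR (jb (-(2 + ρ))) d)
      = mulR m₁ d + mulR (fun ξ => omInv l ξ * cutJb (2 + ρ) n ξ)
        (mulR (fun ξ => jb (-(2 + ρ)) ξ * om l ξ ^ 2) d) := by
    rw [mulR_mulR b1 bk, mulR_mulR bI h.bddR_om_sq]
    have hb3 := bI.mul h.bddR_om_sq
    rw [mulR, mulR, mulR, ← mulL2_add_sym (BddR.sym ⟨mm₁, 2, h1⟩) hb3.sym]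
    refine congrArg (fun m => mulL2 m d) (funext fun ξ => ?_)
    rw [← Complex.ofReal_add]
    congr 1
    rw [hm₁]
    linear_combination -(cutJb (2 + ρ) n ξ * jb (-(2 + ρ)) ξ * (1 + om l ξ)) * hI ξ
  have e2 : mulR (fun ξ => omInv l ξ * cutJb (2 + ρ) n ξ)
      (mulR (fun ξ => jb (-(2 + ρ)) ξ * (2 * Real.pi * ξ) ^ 2) N) = mulR m₂ N := by
    rw [mulR_mulR bI h.bddR_freq_sq]
    refine congrFun (congrArg _ (mulR_congr fun ξ => ?_)) N
    rw [hm₂]; ring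
  rw [map_add, e2, e1, add_comm (mulR m₁ d), add_sub_add_left_eq_sub]
  refine (norm_sub_le _ _).trans (add_le_add (mulR_norm_le mm₁ h1 d) (mulR_norm_le mm₂ h2 N))

/-- Uniqueness for the linear wave equation with a source controlled by the solution. The function
`d` is the Fourier transform of the solution and `P`, `Q` are `d` and its time derivative with a
weight that makes them continuously differentiable in `L²`. The energy is truncated in frequency. -/
theorem eq_zero_of_energy {T L : ℝ} (hL : 0 ≤ L) {d N Q : ℝ → ComplexL2}
    (hd : ContinuousOn d (Icc 0 T))
    (hP : ∀ t ∈ Icc 0 T, HasDerivWithinAt (fun t => mulR (jb (-(2 + ρ))) (d t)) (Q t) (Icc 0 T) t)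
    (hQ : ∀ t ∈ Icc 0 T, HasDerivWithinAt Q
      (-(mulR (fun ξ => jb (-(2 + ρ)) ξ * om l ξ ^ 2) (d t)
        + mulR (fun ξ => jb (-(2 + ρ)) ξ * (2 * Real.pi * ξ) ^ 2) (N t))) (Icc 0 T) t)
    (hN : ∀ t ∈ Icc 0 T, ‖N t‖ ≤ L * ‖d t‖) (hd0 : d 0 = 0) (hQ0 : Q 0 = 0) :
    ∀ t ∈ Icc 0 T, d t = 0 := by
  intro t₁ ht₁
  have hc := h.c₁_pos
  have hK : 0 ≤ 2 + ρ := by linarith [h.two_le]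
  set c := 2 + c₁⁻¹ * L with hcdef
  have hc0 : 0 < c := by positivity
  -- The best constant `m` in `‖d(t)‖² ≤ m exp (3 c t)` is shown to satisfy `m ≤ m / 2`.
  obtain ⟨t₀, ht₀, hmax⟩ := (isCompact_Icc (a := (0 : ℝ)) (b := T)).exists_isMaxOn ⟨t₁, ht₁⟩
    (f := fun t => Real.exp (-(3 * c * t)) * ‖d t‖ ^ 2)
    (ContinuousOn.mul (by fun_prop) (hd.norm.pow 2))
  set m := Real.exp (-(3 * c * t₀)) * ‖d t₀‖ ^ 2 with hm
  have hm0 : 0 ≤ m := by positivity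
  have hexp : ∀ t : ℝ, Real.exp (3 * c * t) * Real.exp (-(3 * c * t)) = 1 := fun t => by
    rw [← Real.exp_add]; simp
  have hD : ∀ t ∈ Icc 0 T, ‖d t‖ ^ 2 ≤ m * Real.exp (3 * c * t) := fun t ht => by
    have h1 : Real.exp (-(3 * c * t)) * ‖d t‖ ^ 2 ≤ m := hmax ht
    have h2 := mul_le_mul_of_nonneg_left h1 (Real.exp_pos (3 * c * t)).le
    rw [← mul_assoc, hexp] at h2
    linarith
  have step : ∀ t ∈ Icc 0 T, ‖d t‖ ^ 2 ≤ m / 2 * Real.exp (3 * c * t) := by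
    intro t ht
    have hmem : mulR (jb (-(2 + ρ))) (d t)
        ∈ SobBall (2 + ρ) (Real.sqrt (m / 2 * Real.exp (3 * c * t))) := by
      rw [mem_sobBall_iff_cut hK]
      intro n
      -- `A` and `B` are the frequency truncations of `d` and of `(1 + ω)⁻¹ d'`; the energy is
      -- `‖A‖² + ‖B‖²`, its derivative is `2 ⟨B, Z⟩`, and `Z` is bounded by `d` uniformly in `n`.
      set A : ℝ → ComplexL2 := fun t => mulR (cutJb (2 + ρ) n) (mulR (jb (-(2 + ρ))) (d t)) with hA
      set B : ℝ → ComplexL2 := fun t => mulR (fun ξ => omInv l ξ * cutJb (2 + ρ) n ξ) (Q t) with hB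
      set Z : ℝ → ComplexL2 := fun t =>
        mulR (fun ξ => (1 + om l ξ) * cutJb (2 + ρ) n ξ) (mulR (jb (-(2 + ρ))) (d t))
        - mulR (fun ξ => omInv l ξ * cutJb (2 + ρ) n ξ)
          (mulR (fun ξ => jb (-(2 + ρ)) ξ * om l ξ ^ 2) (d t)
            + mulR (fun ξ => jb (-(2 + ρ)) ξ * (2 * Real.pi * ξ) ^ 2) (N t)) with hZ
      have bI := h.bddR_omInv.mul (bddR_cutJb (2 + ρ) n)
      have b1 := h.bddR_cut_om n
      have hdX : ∀ t ∈ Icc 0 T, HasDerivWithinAt (fun t => ‖A t‖ ^ 2 + ‖B t‖ ^ 2)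
          (2 * inner ℝ (B t) (Z t)) (Icc 0 T) t := by
        intro t ht
        have hA' := ((mulR (cutJb (2 + ρ) n)).restrictScalars ℝ).hasFDerivAt.comp_hasDerivWithinAt t
          (hP t ht)
        have hB' := ((mulR fun ξ => omInv l ξ * cutJb (2 + ρ) n ξ).restrictScalars
          ℝ).hasFDerivAt.comp_hasDerivWithinAt t (hQ t ht)
        refine (hA'.norm_sq.add hB'.norm_sq).congr_deriv ?_
        have e : inner ℝ (A t) (mulR (cutJb (2 + ρ) n) (Q t)) = inner ℝ (B t)
            (mulR (fun ξ => (1 + om l ξ) * cutJb (2 + ρ) n ξ) (mulR (jb (-(2 + ρ))) (d t))) := by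
          rw [hA, hB, inner_mulR (bddR_cutJb _ n), real_inner_comm, ← inner_mulR b1,
            mulR_mulR (bddR_cutJb _ n) (bddR_cutJb _ n), mulR_mulR b1 bI]
          refine congrArg (fun z => inner ℝ z _) (congrFun (congrArg _ (mulR_congr fun ξ => ?_)) _)
          have hI : omInv l ξ * (1 + om l ξ) = 1 :=
            inv_mul_cancel₀ (by linarith [h.om_nonneg ξ])
          linear_combination -(cutJb (2 + ρ) n ξ) ^ 2 * hI
        change 2 * inner ℝ (A t) (mulR (cutJb (2 + ρ) n) (Q t)) + 2 * inner ℝ (B t) _ = _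
        rw [e, ← mul_add, ← inner_add_right, hZ]
        congr 2
        change _ + mulR _ (-_) = _
        rw [map_neg]
        exact (sub_eq_add_neg _ _).symm
      have hbound : ∀ t ∈ Icc 0 T, 2 * inner ℝ (B t) (Z t)
          ≤ c * (‖A t‖ ^ 2 + ‖B t‖ ^ 2 + ‖d t‖ ^ 2) := by
        intro t ht
        have h1 := (real_inner_le_norm (B t) (Z t))
        have h2 : ‖Z t‖ ≤ c * ‖d t‖ := by
          refine (h.norm_energy_deriv_le n (d t) (N t)).trans ?_
          have := mul_le_mul_of_nonneg_left (hN t ht) (inv_nonneg.2 hc.le)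
          rw [hcdef]; linarith
        have h3 := mul_le_mul_of_nonneg_left h2 (norm_nonneg (B t))
        nlinarith [mul_nonneg hc0.le (sq_nonneg (‖B t‖ - ‖d t‖)),
          mul_nonneg hc0.le (sq_nonneg ‖A t‖)]
      have hX := le_half_mul_exp hm0 hdX (by simp [hA, hB, hd0, hQ0]) hc0 hbound hD t ht
      apply Real.le_sqrt_of_sq_le
      have : 0 ≤ ‖B t‖ ^ 2 := sq_nonneg _
      exact le_trans (by linarith) hX
    obtain ⟨Y, hY, hYd⟩ := hmem
    rw [mulR_jb_injective hK hYd] at hY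
    exact (Real.le_sqrt (norm_nonneg _) (by positivity)).1 hY
  have h1 := step t₀ ht₀
  have h2 := mul_le_mul_of_nonneg_left h1 (Real.exp_pos (-(3 * c * t₀))).le
  have h3 : m ≤ m / 2 := by
    refine h2.trans (le_of_eq ?_)
    linear_combination (m / 2) * hexp t₀
  have hm00 : m = 0 := by linarith
  have h4 := step t₁ ht₁
  rw [hm00] at h4
  have h5 : ‖d t₁‖ ^ 2 = 0 := le_antisymm (by simpa using h4) (sq_nonneg _)
  simpa using h5

end WaveData

/-! ### Coordinates of an arbitrary solution -/

lemma MemH.exists_hasFourier {σ : ℝ} {f : 𝓢'(ℝ, ℂ)} (hf : MemH σ f) :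
    ∃ X : ComplexL2, HasFourier f fun ξ => (jb (-σ) ξ : ℂ) * X ξ := by
  obtain ⟨w, F, hF, hw⟩ := hf
  refine ⟨𝓕 w, hF.congr_ae ?_⟩
  filter_upwards [hw] with ξ h1
  rw [h1, ← mul_assoc]
  have h2 : (jb (-σ) ξ : ℂ) * (jb σ ξ : ℂ) = 1 := by exact_mod_cast jb_neg_mul σ ξ
  change _ = (jb (-σ) ξ : ℂ) * (jb σ ξ : ℂ) * F ξ
  rw [h2, one_mul]

lemma normH_of_hasFourier {σ : ℝ} {f : 𝓢'(ℝ, ℂ)} {X : ComplexL2}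
    (hf : HasFourier f fun ξ => (jb (-σ) ξ : ℂ) * X ξ) : normH σ f = ‖X‖ₑ := by
  refine (memH_and_normH_eq hf (ae_of_all _ fun ξ => ?_)).2
  have h2 : (jb (-σ) ξ : ℂ) * (jb σ ξ : ℂ) = 1 := by exact_mod_cast jb_neg_mul σ ξ
  linear_combination -X ξ * h2

lemma eq_of_hasFourier_jb {σ : ℝ} {f : 𝓢'(ℝ, ℂ)} {X X' : ComplexL2}
    (h : HasFourier f fun ξ => (jb σ ξ : ℂ) * X ξ)
    (h' : HasFourier f fun ξ => (jb σ ξ : ℂ) * X' ξ) : X = X' := by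
  apply Lp.ext
  filter_upwards [h.unique h'] with ξ h1
  exact mul_left_cancel₀ (Complex.ofReal_ne_zero.2 (jb_ne σ ξ)) h1

lemma HasFourier.sub_jb {σ : ℝ} {f f' : 𝓢'(ℝ, ℂ)} {X X' : ComplexL2}
    (h : HasFourier f fun ξ => (jb σ ξ : ℂ) * X ξ)
    (h' : HasFourier f' fun ξ => (jb σ ξ : ℂ) * X' ξ) :
    HasFourier (f - f') fun ξ => (jb σ ξ : ℂ) * (X - X' : ComplexL2) ξ := by
  refine (h.sub h').congr_ae ?_
  filter_upwards [Lp.coeFn_sub X X'] with ξ h1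
  rw [h1, Pi.sub_apply, mul_sub]

/-- `H^s` valued continuity expressed through `L²` valued coordinates. -/
lemma continuousOn_of_normH {σ : ℝ} {f : ℝ → 𝓢'(ℝ, ℂ)} {X : ℝ → ComplexL2} {S : Set ℝ}
    (hX : ∀ t ∈ S, HasFourier (f t) fun ξ => (jb (-σ) ξ : ℂ) * X t ξ)
    (hf : ∀ t ∈ S, Tendsto (fun τ => normH σ (f τ - f t)) (𝓝[S] t) (𝓝 0)) :
    ContinuousOn X S := by
  intro t ht
  rw [ContinuousWithinAt, tendsto_iff_edist_tendsto_0]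
  refine (hf t ht).congr' ?_
  filter_upwards [self_mem_nhdsWithin] with τ hτ
  rw [normH_of_hasFourier ((hX τ hτ).sub_jb (hX t ht)), edist_eq_enorm_sub]

namespace IsSolution

variable {ρ s : ℝ} {l g : ℝ → ℝ} {φ : RealL2} {ψ : 𝓢'(ℝ, ℂ)} {T : ℝ}
    {u u' : ℝ → RealL2} {v v' : ℝ → 𝓢'(ℝ, ℂ)}

lemma mono {T' : ℝ} (hS : IsSolution ρ s l g φ ψ T u v) (hT : T' ≤ T) :
    IsSolution ρ s l g φ ψ T' u v := by
  have hsub : Ico 0 T' ⊆ Ico 0 T := Ico_subset_Ico_right hT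
  exact ⟨fun t ht => hS.mem_u t (hsub ht), fun t ht => hS.mem_v t (hsub ht),
    fun t ht => (hS.continuous_u t (hsub ht)).mono_left (nhdsWithin_mono _ hsub),
    fun t ht => (hS.continuous_v t (hsub ht)).mono_left (nhdsWithin_mono _ hsub),
    fun t ht => (hS.deriv_u t (hsub ht)).mono_left
      (nhdsWithin_mono _ (sdiff_subset_sdiff_left hsub)),
    fun θ t ht => (hS.equation θ t (hsub ht)).mono hsub, hS.initial_u, hS.initial_v⟩

/-- A solution in the coordinates `U = (1 + η²)^{s/2} û`, `V = (1 + η²)^{σ/2} v̂` with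
`σ = s - 1 - ρ/2`. -/
lemma exists_coordinates (hs : 0 ≤ s) (hρ : 0 ≤ ρ) (hS : IsSolution ρ s l g φ ψ T u v) :
    ∃ U V : ℝ → ComplexL2, (∀ t ∈ Ico 0 T, mulR (jb (-s)) (U t) = fr (u t)) ∧
      (∀ t ∈ Ico 0 T, HasFourier (u t).toDist fun ξ => (jb (-s) ξ : ℂ) * U t ξ) ∧
      (∀ t ∈ Ico 0 T, HasFourier (v t) fun ξ => (jb (-(s - 1 - ρ / 2)) ξ : ℂ) * V t ξ) ∧
      ContinuousOn U (Ico 0 T) ∧ ContinuousOn V (Ico 0 T) ∧ ∀ t ∈ Ico 0 T,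
        HasDerivWithinAt (fun τ => mulR (jb (-(1 + ρ / 2))) (U τ)) (V t) (Ico 0 T) t := by
  have hU : ∀ t, ∃ X : ComplexL2, t ∈ Ico 0 T →
      HasFourier (u t).toDist fun ξ => (jb (-s) ξ : ℂ) * X ξ := fun t => by
    by_cases ht : t ∈ Ico 0 T
    · obtain ⟨X, hX⟩ := (hS.mem_u t ht).exists_hasFourier
      exact ⟨X, fun _ => hX⟩
    · exact ⟨0, fun h => absurd h ht⟩
  have hV : ∀ t, ∃ X : ComplexL2, t ∈ Ico 0 T →
      HasFourier (v t) fun ξ => (jb (-(s - 1 - ρ / 2)) ξ : ℂ) * X ξ := fun t => by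
    by_cases ht : t ∈ Ico 0 T
    · obtain ⟨X, hX⟩ := (hS.mem_v t ht).exists_hasFourier
      exact ⟨X, fun _ => hX⟩
    · exact ⟨0, fun h => absurd h ht⟩
  choose U hU using hU
  choose V hV using hV
  refine ⟨U, V, fun t ht => ?_, fun t => hU t, fun t => hV t,
    continuousOn_of_normH (f := fun t => (u t).toDist) (fun t => hU t) hS.continuous_u,
    continuousOn_of_normH (fun t => hV t) hS.continuous_v, fun t ht => ?_⟩
  · apply Lp.ext
    filter_upwards [mulR_coe (bddR_jb (neg_nonpos.2 hs)) (U t),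
      (hU t ht).unique (hasFourier_toDist (u t))] with ξ h1 h2
    rw [h1, h2, fr_apply]
  · rw [hasDerivWithinAt_iff_tendsto_slope, tendsto_iff_edist_tendsto_0]
    refine (hS.deriv_u t ht).congr' ?_
    filter_upwards [self_mem_nhdsWithin] with τ hτ
    have b : BddR (jb (-(1 + ρ / 2))) := bddR_jb (by linarith)
    rw [edist_eq_enorm_sub, slope_def_module, ← map_sub]
    have h1 := (((hU τ hτ.1).sub_jb (hU t ht)).smul (((τ - t)⁻¹ : ℝ) : ℂ)).sub (hV t ht)
    refine (memH_and_normH_eq h1 ?_).2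
    filter_upwards [Lp.coeFn_sub ((τ - t)⁻¹ • mulR (jb (-(1 + ρ / 2))) (U τ - U t)) (V t),
      Lp.coeFn_smul (τ - t)⁻¹ (mulR (jb (-(1 + ρ / 2))) (U τ - U t)),
      mulR_coe b (U τ - U t)] with ξ h2 h3 h4
    rw [h2, Pi.sub_apply, h3, Pi.smul_apply, h4, Complex.real_smul]
    have e1 : (jb (-(1 + ρ / 2)) ξ : ℂ) = (jb (s - 1 - ρ / 2) ξ : ℂ) * (jb (-s) ξ : ℂ) := by
      rw [← Complex.ofReal_mul, ← jb_add]; congr 2; ring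
    have e2 : (jb (-(s - 1 - ρ / 2)) ξ : ℂ) * (jb (s - 1 - ρ / 2) ξ : ℂ) = 1 := by
      exact_mod_cast jb_neg_mul _ ξ
    rw [e1]
    linear_combination V t ξ * e2

/-- The norm of a solution stays bounded on compact intervals. -/
lemma exists_normH_le (hs : 0 ≤ s) (hρ : 0 ≤ ρ) (hS : IsSolution ρ s l g φ ψ T u v) {T₁ : ℝ}
    (hT₁ : T₁ < T) : ∃ c : NNReal, ∀ t ∈ Icc 0 T₁,
      normH s (u t).toDist + normH (s - 1 - ρ / 2) (v t) ≤ c := by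
  obtain ⟨U, V, -, hU, hV, cU, cV, -⟩ := hS.exists_coordinates hs hρ
  have hsub : Icc 0 T₁ ⊆ Ico 0 T := fun t ht => ⟨ht.1, lt_of_le_of_lt ht.2 hT₁⟩
  obtain ⟨M, hM⟩ := isCompact_Icc.exists_bound_of_continuousOn (cU.mono hsub)
  obtain ⟨M', hM'⟩ := isCompact_Icc.exists_bound_of_continuousOn (cV.mono hsub)
  refine ⟨M.toNNReal + M'.toNNReal, fun t ht => ?_⟩
  rw [normH_of_hasFourier (hU t (hsub ht)), normH_of_hasFourier (hV t (hsub ht)), ENNReal.coe_add,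
    ← ofReal_norm, ← ofReal_norm]
  exact add_le_add (ENNReal.ofReal_le_ofReal (hM t ht)) (ENNReal.ofReal_le_ofReal (hM' t ht))

end IsSolution

namespace WaveData

variable {ρ s c₁ c₂ : ℝ} {l g : ℝ → ℝ} (h : WaveData ρ s c₁ c₂ l g)
include h

/-- The right hand side of the equation, in `L²` coordinates with weight `(1 + η²)^{-(2+ρ)/2}`. -/
lemma pair_eq {R L : ℝ} (hL : LipOn g R L) {u : RealL2} (hu : ∀ᵐ x, |u x| ≤ R) {θ : 𝓢(ℝ, ℂ)}
    {Θ : ComplexL2} (hΘ : Θ =ᵐ[volume] fun ξ => (jb (2 + ρ) ξ : ℂ) * (𝓕⁻ θ) ξ) :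
    pairLxx l u θ + pairGxx g u θ =
      pairL2 Θ (-(mulR (fun ξ => jb (-(2 + ρ)) ξ * om l ξ ^ 2) (fr u)
        + mulR (fun ξ => jb (-(2 + ρ)) ξ * (2 * Real.pi * ξ) ^ 2) (fr (compR g u)))) := by
  have hj : ∀ ξ, (jb (-(2 + ρ)) ξ : ℂ) * (jb (2 + ρ) ξ : ℂ) = 1 := fun ξ => by
    exact_mod_cast jb_neg_mul _ ξ
  rw [map_neg, map_add, neg_add, pairGxx_eq h.g_one.continuous h.zero hL hu, pairLxx,
    pairL2_apply, pairL2_apply, ← integral_neg, ← integral_neg]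
  congr 1
  · apply integral_congr_ae
    filter_upwards [hΘ, mulR_coe h.bddR_om_sq (fr u)] with ξ h1 h2
    have h3 : (om l ξ : ℂ) ^ 2 = (2 * Real.pi * ξ) ^ 2 * (l (2 * Real.pi * ξ) : ℂ) := by
      rw [← h.sl_sq, ← Complex.ofReal_pow, om, mul_pow, sq_abs]; push_cast; ring
    rw [h1, h2, ← fr_apply]
    push_cast
    linear_combination (om l ξ : ℂ) ^ 2 * fr u ξ * (𝓕⁻ θ) ξ * hj ξ
      + fr u ξ * (𝓕⁻ θ) ξ * h3
  · apply integral_congr_ae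
    filter_upwards [hΘ, mulR_coe h.bddR_freq_sq (fr (compR g u))] with ξ h1 h2
    rw [h1, h2]
    push_cast
    linear_combination (2 * Real.pi * ξ : ℂ) ^ 2 * fr (compR g u) ξ * (𝓕⁻ θ) ξ * hj ξ

/-- Uniqueness of `u`. The difference `d` of two solutions satisfies the linear wave equation with
the source `g(u) - g(u')`, which is bounded by `d` in `L²`, since both solutions are bounded
functions on compact time intervals. -/
theorem eq_of_isSolution {φ : RealL2} {ψ : 𝓢'(ℝ, ℂ)} {T : ℝ} {u u' : ℝ → RealL2}
    {v v' : ℝ → 𝓢'(ℝ, ℂ)} (hS : IsSolution ρ s l g φ ψ T u v)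
    (hS' : IsSolution ρ s l g φ ψ T u' v') {T₁ : ℝ} (hT₁ : T₁ < T) (hT₀ : 0 ≤ T₁) :
    ∀ t ∈ Icc 0 T₁, u t = u' t := by
  have hs : 0 ≤ s := by linarith [h.half_lt]
  have hρ : 0 ≤ ρ := by linarith [h.two_le]
  obtain ⟨U, V, hU, -, hV, cU, -, dU⟩ := hS.exists_coordinates hs hρ
  obtain ⟨U', V', hU', -, hV', cU', -, dU'⟩ := hS'.exists_coordinates hs hρ
  have hsub : Icc 0 T₁ ⊆ Ico 0 T := fun t ht => ⟨ht.1, lt_of_le_of_lt ht.2 hT₁⟩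
  obtain ⟨M, hM⟩ := isCompact_Icc.exists_bound_of_continuousOn (cU.mono hsub)
  obtain ⟨M', hM'⟩ := isCompact_Icc.exists_bound_of_continuousOn (cU'.mono hsub)
  obtain ⟨C, hC, hemb⟩ := exists_ae_abs_le h.half_lt
  set R := C * max M M' with hR
  have hu : ∀ t ∈ Icc 0 T₁, ∀ᵐ x, |u t x| ≤ R := fun t ht =>
    hemb _ _ ⟨U t, (hM t ht).trans (le_max_left _ _), hU t (hsub ht)⟩
  have hu' : ∀ t ∈ Icc 0 T₁, ∀ᵐ x, |u' t x| ≤ R := fun t ht =>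
    hemb _ _ ⟨U' t, (hM' t ht).trans (le_max_right _ _), hU' t (hsub ht)⟩
  obtain ⟨L, hL0, hL⟩ := exists_lipOn h.g_one R
  have hgc := h.g_one.continuous
  have cfu : ContinuousOn (fun t => fr (u t)) (Icc 0 T₁) :=
    ((mulR (jb (-s))).continuous.comp_continuousOn (cU.mono hsub)).congr
      fun t ht => (hU t (hsub ht)).symm
  have cfu' : ContinuousOn (fun t => fr (u' t)) (Icc 0 T₁) :=
    ((mulR (jb (-s))).continuous.comp_continuousOn (cU'.mono hsub)).congr
      fun t ht => (hU' t (hsub ht)).symm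
  have ccomp : ∀ w : ℝ → RealL2, (∀ t ∈ Icc 0 T₁, ∀ᵐ x, |w t x| ≤ R) →
      ContinuousOn (fun t => fr (w t)) (Icc 0 T₁) →
      ContinuousOn (fun t => fr (compR g (w t))) (Icc 0 T₁) := by
    intro w hw cw t ht
    have h1 := (tendsto_iff_norm_sub_tendsto_zero.1 (cw t ht)).const_mul L
    rw [mul_zero] at h1
    refine tendsto_iff_norm_sub_tendsto_zero.2 (squeeze_zero' (Eventually.of_forall fun _ =>
      norm_nonneg _) ?_ h1)
    filter_upwards [self_mem_nhdsWithin] with τ hτ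
    rw [← map_sub, ← map_sub, fr.norm_map, fr.norm_map]
    exact norm_compR_sub_le hgc h.zero hL (hw τ hτ) (hw t ht)
  set N : ℝ → ComplexL2 := fun t => fr (compR g (u t)) - fr (compR g (u' t)) with hN
  set d : ℝ → ComplexL2 := fun t => fr (u t) - fr (u' t) with hd
  set H : ℝ → ComplexL2 := fun t =>
    -(mulR (fun ξ => jb (-(2 + ρ)) ξ * om l ξ ^ 2) (d t)
      + mulR (fun ξ => jb (-(2 + ρ)) ξ * (2 * Real.pi * ξ) ^ 2) (N t)) with hH
  have cd : ContinuousOn d (Icc 0 T₁) := cfu.sub cfu'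
  have cN : ContinuousOn N (Icc 0 T₁) := (ccomp u hu cfu).sub (ccomp u' hu' cfu')
  have cH : ContinuousOn H (Icc 0 T₁) :=
    (((mulR _).continuous.comp_continuousOn cd).add ((mulR _).continuous.comp_continuousOn cN)).neg
  have bQ : BddR (jb (-(1 + s + ρ / 2))) := bddR_jb (by linarith)
  set Q : ℝ → ComplexL2 := fun t => mulR (jb (-(1 + s + ρ / 2))) (V t - V' t) with hQ
  have h00 : (0 : ℝ) ∈ Icc 0 T₁ := ⟨le_rfl, hT₀⟩
  have hQ0 : Q 0 = 0 := by
    have h1 := hV 0 (hsub h00)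
    have h2 := hV' 0 (hsub h00)
    rw [hS.initial_v] at h1
    rw [hS'.initial_v] at h2
    rw [hQ]
    simp only [eq_of_hasFourier_jb h1 h2, sub_self, map_zero]
  have hP : ∀ t ∈ Icc 0 T₁,
      HasDerivWithinAt (fun t => mulR (jb (-(2 + ρ))) (d t)) (Q t) (Icc 0 T₁) t := by
    intro t ht
    have h1 := (((dU t (hsub ht)).sub (dU' t (hsub ht))).mono hsub)
    have h2 := ((mulR (jb (-(1 + s + ρ / 2)))).restrictScalars
      ℝ).hasFDerivAt.comp_hasDerivWithinAt t h1
    refine h2.congr_of_mem (fun τ hτ => ?_) ht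
    change _ = mulR (jb (-(1 + s + ρ / 2))) (mulR (jb (-(1 + ρ / 2))) (U τ)
      - mulR (jb (-(1 + ρ / 2))) (U' τ))
    rw [hd]
    simp only
    rw [← hU τ (hsub hτ), ← hU' τ (hsub hτ), ← map_sub, ← map_sub,
      mulR_mulR (bddR_jb (by linarith)) (bddR_jb (by linarith)),
      mulR_mulR bQ (bddR_jb (by linarith))]
    refine congrFun (congrArg _ (mulR_congr fun ξ => ?_)) _
    rw [← jb_add, ← jb_add]; congr 1; ring
  -- `Q` is differentiable in `L²`, as it agrees with the integral of `H` on all test functions.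
  set H' : ℝ → ComplexL2 := fun t => H (projIcc 0 T₁ hT₀ t) with hH'
  have cH' : Continuous H' := (continuousOn_iff_continuous_domRestrict.1 cH).comp continuous_projIcc
  have hHH : ∀ t ∈ Icc 0 T₁, H' t = H t := fun t ht => by rw [hH']; simp [projIcc_of_mem hT₀ ht]
  set I : ℝ → ComplexL2 := fun t => ∫ x in (0 : ℝ)..t, H' x with hI
  have dI : ∀ t, HasDerivAt I (H' t) t := fun t => (cH'.integral_hasStrictDerivAt 0 t).hasDerivAt
  have hQI : ∀ t ∈ Icc 0 T₁, Q t = I t := by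
    intro t ht
    have hint : ∀ χ : 𝓢(ℝ, ℂ), MemLp (fun ξ => (jb (2 + ρ) ξ : ℂ) * χ ξ) 2 volume := fun χ =>
      memLp_mul_schwartz (measurable_jb _) (C := 1) (σ := 2 + ρ)
        (fun ξ => by rw [abs_of_pos (jb_pos _ _), one_mul]) χ
    have key := ae_zero_of_realTest (F := fun ξ => (jb (2 + ρ) ξ : ℂ) * (Q t - I t : ComplexL2) ξ)
      (fun χ => ?_) (fun f hf hc => ?_)
    · rw [← sub_eq_zero, Lp.eq_zero_iff_ae_eq_zero]
      filter_upwards [key] with ξ h1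
      exact (mul_eq_zero.1 h1).resolve_left (Complex.ofReal_ne_zero.2 (jb_ne _ ξ))
    · refine ((Lp.memLp (Q t - I t)).integrable_mul (hint χ)).congr (ae_of_all _ fun ξ => ?_)
      simp only [Pi.mul_apply]; ring
    · set χ := realTest f hf hc with hχ
      set θ : 𝓢(ℝ, ℂ) := 𝓕 χ with hθ
      have hχθ : 𝓕⁻ θ = χ := FourierTransform.fourierInv_fourier_eq _
      set Θ : ComplexL2 := (hint χ).toLp with hΘ
      have hΘe : Θ =ᵐ[volume] fun ξ => (jb (2 + ρ) ξ : ℂ) * χ ξ := (hint χ).coeFn_toLp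
      have hΘe' : Θ =ᵐ[volume] fun ξ => (jb (2 + ρ) ξ : ℂ) * (𝓕⁻ θ) ξ := by rwa [hχθ]
      have e1 : ∀ τ ∈ Icc 0 T₁, pairL2 Θ (Q τ) = v τ θ - v' τ θ := by
        intro τ hτ
        have h1 := ((hV τ (hsub hτ)).sub_jb (hV' τ (hsub hτ))).apply θ
        rw [hχθ] at h1
        change v τ θ - v' τ θ = _ at h1
        rw [h1, pairL2_apply]
        apply integral_congr_ae
        filter_upwards [hΘe, mulR_coe bQ (V τ - V' τ)] with ξ h2 h3
        have e : (jb (-(s - 1 - ρ / 2)) ξ : ℂ)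
            = (jb (-(1 + s + ρ / 2)) ξ : ℂ) * (jb (2 + ρ) ξ : ℂ) := by
          rw [← Complex.ofReal_mul, ← jb_add]; congr 2; ring
        rw [h2, h3, e]; ring
      have e2 : ∀ τ ∈ Icc 0 T₁, HasDerivWithinAt (fun τ => pairL2 Θ (Q τ - I τ)) 0
          (Icc 0 T₁) τ := by
        intro τ hτ
        have h1 := ((hS.equation θ τ (hsub hτ)).sub (hS'.equation θ τ (hsub hτ))).mono hsub
        have h2 := (pairL2 Θ).hasFDerivAt.comp_hasDerivWithinAt τ
          (dI τ).hasDerivWithinAt (s := Icc 0 T₁)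
        refine ((h1.sub h2).congr_of_mem (fun z hz => ?_) hτ).congr_deriv ?_
        · rw [map_sub, e1 z hz]; rfl
        · have e3 : ∀ b b' : ℝ → ℝ, -(mulR b (d τ) + mulR b' (N τ))
              = -(mulR b (fr (u τ)) + mulR b' (fr (compR g (u τ))))
                - -(mulR b (fr (u' τ)) + mulR b' (fr (compR g (u' τ)))) := fun b b' => by
            simp only [hd, hN, map_sub]; abel
          rw [h.pair_eq hL (hu τ hτ) hΘe', h.pair_eq hL (hu' τ hτ) hΘe', hHH τ hτ, hH]
          simp only
          rw [e3, map_sub, sub_self]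
      have h3 := constant_of_has_deriv_right_zero
        (fun τ hτ => (e2 τ hτ).continuousWithinAt)
        (fun τ hτ => hasDerivWithinAt_Ici (e2 τ (Ico_subset_Icc_self hτ)) hτ) t ht
      simp only [hQ0, hI, intervalIntegral.integral_same, sub_self, map_zero] at h3
      rw [← h3, pairL2_apply]
      apply integral_congr_ae
      filter_upwards [hΘe] with ξ h4
      rw [h4]; ring
  have dQ : ∀ t ∈ Icc 0 T₁, HasDerivWithinAt Q (H t) (Icc 0 T₁) t := fun t ht => by
    rw [← hHH t ht]
    exact (dI t).hasDerivWithinAt.congr_of_mem hQI ht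
  intro t ht
  have hfin := h.eq_zero_of_energy hL0 cd hP dQ (fun t ht => by
    rw [hN, hd]
    simp only
    rw [← map_sub, ← map_sub, fr.norm_map, fr.norm_map]
    exact norm_compR_sub_le hgc h.zero hL (hu t ht) (hu' t ht)) (by
    rw [hd]; simp only [hS.initial_u, hS'.initial_u, sub_self]) hQ0 t ht
  exact fr.injective (sub_eq_zero.1 hfin)

/-- The solution and its time derivative are determined by the initial data. -/
theorem isSolution_unique {φ : RealL2} {ψ : 𝓢'(ℝ, ℂ)} {T : ℝ} {u u' : ℝ → RealL2}
    {v v' : ℝ → 𝓢'(ℝ, ℂ)} (hS : IsSolution ρ s l g φ ψ T u v)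
    (hS' : IsSolution ρ s l g φ ψ T u' v') : ∀ t ∈ Ico 0 T, u t = u' t ∧ v t = v' t := by
  have hs : 0 ≤ s := by linarith [h.half_lt]
  have hρ : 0 ≤ ρ := by linarith [h.two_le]
  have huu : ∀ t ∈ Ico 0 T, u t = u' t := fun t ht =>
    h.eq_of_isSolution hS hS' ht.2 ht.1 t ⟨ht.1, le_rfl⟩
  obtain ⟨U, V, hU, -, hV, -, -, dU⟩ := hS.exists_coordinates hs hρ
  obtain ⟨U', V', hU', -, hV', -, -, dU'⟩ := hS'.exists_coordinates hs hρ
  intro t ht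
  refine ⟨huu t ht, ?_⟩
  have hUU : ∀ τ ∈ Ico 0 T, U τ = U' τ := fun τ hτ => mulR_jb_injective hs (by
    rw [hU τ hτ, hU' τ hτ, huu τ hτ])
  have h1 : HasDerivWithinAt (fun τ => mulR (jb (-(1 + ρ / 2))) (U τ)) (V' t) (Ico 0 T) t :=
    (dU' t ht).congr_of_mem (fun τ hτ => by rw [hUU τ hτ]) ht
  have hVV : V t = V' t := (uniqueDiffOn_Ico 0 T t ht).eq_deriv _ (dU t ht) h1
  exact (hV t ht).eq_of_ae (hV' t ht) (by rw [hVV])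

end WaveData

/-! ### Blow up -/

/-- The structural condition forces `g 0 = 0`: the function `a G(p) - p g(p)`, `a > 1`, is minimal
at `0`, where its derivative is `(a - 1) g(0)`. -/
lemma apply_zero_of_le {g : ℝ → ℝ} {a : ℝ} (hg : ContDiff ℝ 1 g) (ha : 1 < a)
    (hgG : ∀ p, p * g p ≤ a * primitiveG g p) : g 0 = 0 := by
  have h1 := ((hasDerivAt_primitiveG hg.continuous 0).const_mul a).sub
    ((hasDerivAt_id (0 : ℝ)).mul (hg.differentiable one_ne_zero 0).hasDerivAt)
  have hmin : IsLocalMin ((fun p => a * primitiveG g p) - id * g) 0 :=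
    Eventually.of_forall fun p => by
      simp only [Pi.sub_apply, Pi.mul_apply, id_eq, primitiveG_zero, mul_zero, zero_mul, sub_zero]
      linarith [hgG p]
  have h2 := hmin.hasDerivAt_eq_zero h1
  simp only [id_eq, one_mul, zero_mul, add_zero] at h2
  have h3 : (a - 1) * g 0 = 0 := by linarith
  exact (mul_eq_zero.1 h3).resolve_left (by linarith)

/-- A solution whose norm is unbounded at `T` cannot be continued, and every other solution is a
restriction of it. -/
theorem WaveData.blowsUpAt {ρ s c₁ c₂ : ℝ} {l g : ℝ → ℝ} (h : WaveData ρ s c₁ c₂ l g)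
    {φ : RealL2} {ψ : 𝓢'(ℝ, ℂ)} {T : ℝ} {u : ℝ → RealL2} {v : ℝ → 𝓢'(ℝ, ℂ)} (hT : 0 < T)
    (hS : IsSolution ρ s l g φ ψ T u v)
    (hlim : limsup (fun t => normH s (u t).toDist + normH (s - 1 - ρ / 2) (v t)) (𝓝[<] T) = ⊤) :
    BlowsUpAt ρ s l g φ ψ T u v := by
  refine ⟨hT, hS, fun T' u' v' _ hS' => ?_, hlim⟩
  have hle : T' ≤ T := by
    by_contra! hlt
    obtain ⟨c, hc⟩ := hS'.exists_normH_le (by linarith [h.half_lt]) (by linarith [h.two_le]) hlt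
    -- A solution beyond `T` would agree with `u` before `T` and bound its norm there.
    have hu := h.isSolution_unique (hS'.mono hlt.le) hS
    have hb : limsup (fun t => normH s (u t).toDist + normH (s - 1 - ρ / 2) (v t)) (𝓝[<] T)
        ≤ c := by
      refine limsup_le_of_le (h := ?_)
      filter_upwards [Ioo_mem_nhdsLT hT] with t ht
      obtain ⟨h1, h2⟩ := hu t ⟨ht.1.le, ht.2⟩
      rw [← h1, ← h2]
      exact hc t ⟨ht.1.le, ht.2.le⟩
    rw [hlim] at hb
    exact ENNReal.coe_ne_top (top_le_iff.1 hb)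
  exact ⟨hle, h.isSolution_unique hS' (hS.mono hle)⟩

end
theorem theorem5p2
    (ρ s c₁ c₂ ν : ℝ) (l g : ℝ → ℝ) (φ : RealL2) (ψ : 𝓢'(ℝ, ℂ))
    (hρ : 2 ≤ ρ) (hs : 1 / 2 < s) (hc₁ : 0 < c₁) (hc₂ : 0 < c₂)
    (hl_meas : Measurable l) (hl_even : ∀ η, l (-η) = l η)
    (hl_lower : ∀ η, c₁ ^ 2 * (1 + η ^ 2) ^ (ρ / 2) ≤ l η)
    (hl_upper : ∀ η, l η ≤ c₂ ^ 2 * (1 + η ^ 2) ^ (ρ / 2))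
    (hg : ContDiff ℝ ((⌊s⌋₊ + 1 : ℕ) : WithTop ℕ∞) g)
    (hφ : MemH s φ.toDist) (hψ : MemH (s - 1 - ρ / 2) ψ) (hψ_real : IsRealDist ψ)
    (Kφ Λφ Λψ : ComplexL2)
    (hKφ : IsMultiplierL2 (sqrtSymbol l) φ.toDist Kφ)
    (hΛφ : IsMultiplierL2 lambdaInvSymbol φ.toDist Λφ)
    (hΛψ : IsMultiplierL2 lambdaInvSymbol ψ Λψ)
    (hGφ : Integrable (fun x => primitiveG g (φ x)))
    (hν : 0 < ν)
    (hgG : ∀ p, p * g p ≤ 2 * (1 + 2 * ν) * primitiveG g p)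
    (hE : ‖Λψ‖ ^ 2 + ‖Kφ‖ ^ 2 + 2 * ∫ x, primitiveG g (φ x) < 0) :
    ∃ (T : ℝ) (u : ℝ → RealL2) (v : ℝ → 𝓢'(ℝ, ℂ)), BlowsUpAt ρ s l g φ ψ T u v := by
  have h0 : g 0 = 0 := apply_zero_of_le (hg.of_le (by norm_cast; omega)) (by linarith) hgG
  have h : WaveData ρ s c₁ c₂ l g :=
    ⟨hρ, hs, hc₁, hc₂, hl_meas, hl_even, hl_lower, hl_upper, hg, h0⟩
  obtain ⟨W₀, M₀, P₀, hW₀, hφ₀, hψ₀, hP₀, hZ₀⟩ := h.exists_initial hφ hψ hψ_real hKφ hΛφ hΛψ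
  obtain ⟨B, hB⟩ := h.exists_time_bound hν hgG hP₀ (by rwa [hZ₀, hφ₀])
  obtain ⟨T, hT, W, hW, hM⟩ := exists_maximal_isSol (kap_add_one_nonneg ρ s)
    h.tameField hW₀ hB
  exact ⟨T, uAt l W, vAt l W, h.blowsUpAt hT (h.isSolution hT hW hφ₀ hψ₀)
    (h.limsup_eq_top hW₀ hT hW hM)⟩
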